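/- Let $T$ be an edge-to-edge tiling of the hyperbolic plane $\mathbb H^2$ by regular right-angled pentagons (such tilings exist), with hyperbolic metric $d_{\mathbb H}$. Let $\widetilde X$ be the dual square complex: it has one vertex for each pentagon, an edge for each pair of pentagons sharing a side, and a square for each vertex of $T$. The vertex set $\widetilde X^0$ carries the combinatorial metric $d_{\widetilde X}$ (the least number of edges of an edge path) and is identified with the set of centres of the pentagons, so that $\widetilde X^0\subset\mathbb H^2$. Put $$K=\cos\tfrac{2\pi}{5},\qquad c=\operatorname{arccosh}(K+1),\qquad d=\operatorname{arccosh}(2K^2+2K+1),\qquad \lambda=\frac dc .$$ Then: 1. $\widetilde X$ is a CAT(0) square complex (it is connected and simply connected, and the link of every vertex is a flag simplicial complex), and every vertex lies in exactly five edges and exactly five squares. 2. There is a constant $\varepsilon>0$ such that for all $x,y\in\widetilde X^0$ $$c\cdot d_{\widetilde X}(x,y)-\varepsilon\;\le\; d_{\mathbb H}(x,y)\;\le\; d\cdot d_{\widetilde X}(x,y)+\varepsilon .$$ 3. The multiplicative constants $c$ and $d$ are sharp: if real numbers $c',\varepsilon$ satisfy $c'\,d_{\widetilde X}(x,y)-\varepsilon\le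 d_{\mathbb H}(x,y)$ for all $x,y\in\widetilde X^0$, then $c'\le c$; if real numbers $d',\varepsilon$ satisfy $d_{\mathbb H}(x,y)\le d'\,d_{\widetilde X}(x,y)+\varepsilon$ for all $x,y\in\widetilde X^0$, then $d'\ge d$. 4. Call a map $f$ from $\widetilde X^0$ to a metric space $(\Upsilon,d_\Upsilon)$ a $\mu$-quasiisometry if there are constants $\lambda_1,\lambda_2,\varepsilon>0$ with $\lambda_1\lambda_2=\mu$ and $\frac1{\lambda_1}d_{\widetilde X}(x,y)-\varepsilon\le d_\Upsilon(f(x),f(y))\le\lambda_2\,d_{\widetilde X}(x,y)+\varepsilon$ for all $x,y\in\widetilde X^0$. Then the identity map $(\widetilde X^0,d_{\widetilde X})\to(\mathbb H^2,d_{\mathbb H})$ is a $\lambda$-quasiisometry, and $\lambda$ is optimal: if it is a $\mu$-quasiisometry, then $\mu\ge\lambda$. Numerically $\lambda\approx1.5627$, i.e. $|\lambda-1.5627|<5\cdot10^{-5}$. -/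

import Mathlib

namespace PentagonTiling

/-! ### Elementary geometry of the hyperbolic plane

The hyperbolic plane is Mathlib's upper half-plane with its hyperbolic metric. -/

/-- The geodesic segment from `x` to `y`. -/
def seg (x y : UpperHalfPlane) : Set UpperHalfPlane :=
  {z | dist x z + dist z y = dist x y}

/-- For `p ≠ q`, the bi-infinite geodesic through `p` and `q`: the points `z` such that one of
`p`, `q`, `z` lies on the segment between the other two. -/
def line (p q : UpperHalfPlane) : Set UpperHalfPlane :=
  {z | z ∈ seg p q ∨ p ∈ seg z q ∨ q ∈ seg p z}

/-- For `x` not on the geodesic `L`, the closed half-plane bounded by `L` that contains `x`. -/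
def halfPlane (L : Set UpperHalfPlane) (x : UpperHalfPlane) : Set UpperHalfPlane :=
  {z | z ∈ L ∨ Disjoint (seg z x) L}

/-- The coordinate of `q` in the Poincaré disc model centred at `p`: the Cayley transform that is
an isometry onto the disc and sends `p` to `0`. -/
noncomputable def discCoord (p q : UpperHalfPlane) : ℂ :=
  ((q : ℂ) - (p : ℂ)) / ((q : ℂ) - (starRingEnd ℂ) (p : ℂ))

/-- The hyperbolic angle at `p` between the geodesics from `p` to `q` and from `p` to `r`.
The disc model is conformal and its geodesics through `0` are Euclidean diameters, so this is
the Euclidean angle at `0` in the disc model centred at `p`. -/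
noncomputable def hypAngle (q p r : UpperHalfPlane) : ℝ :=
  InnerProductGeometry.angle (discCoord p q) (discCoord p r)

/-! ### Regular right-angled pentagons and tilings by them -/

/-- A regular right-angled pentagon in the hyperbolic plane, with its vertices listed in one of
their cyclic orders. -/
structure Pentagon where
  /-- the vertices, in cyclic order -/
  vertex : ZMod 5 → UpperHalfPlane
  /-- the centre -/
  center : UpperHalfPlane
  /-- Convex position in this cyclic order: the three other vertices lie strictly on one side of
  the geodesic through `vertex i` and `vertex (i + 1)`. -/
  convex : ∀ i j : ZMod 5, j ≠ i → j ≠ i + 1 →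
    Disjoint (seg (vertex j) (vertex (i + 3))) (line (vertex i) (vertex (i + 1)))
  /-- all sides have the same length -/
  equilateral : ∀ i : ZMod 5,
    dist (vertex i) (vertex (i + 1)) = dist (vertex 0) (vertex 1)
  /-- all angles are right angles -/
  right_angled : ∀ i : ZMod 5,
    hypAngle (vertex (i - 1)) (vertex i) (vertex (i + 1)) = Real.pi / 2
  /-- the centre is the point at the same distance from all vertices -/
  center_equidistant : ∀ i : ZMod 5, dist center (vertex i) = dist center (vertex 0)

/-- The `i`-th side. -/
def Pentagon.side (P : Pentagon) (i : ZMod 5) : Set UpperHalfPlane :=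
  seg (P.vertex i) (P.vertex (i + 1))

/-- The closed region enclosed by the pentagon: the intersection of the five closed half-planes
that are bounded by the lines of the sides and contain the pentagon. -/
def Pentagon.region (P : Pentagon) : Set UpperHalfPlane :=
  {z | ∀ i : ZMod 5, z ∈ halfPlane (line (P.vertex i) (P.vertex (i + 1))) (P.vertex (i + 3))}

/-- `T` is an (edge-to-edge) tiling of the hyperbolic plane by regular right-angled pentagons. -/
structure IsTiling (T : Set Pentagon) : Prop where
  covers : ∀ z : UpperHalfPlane, ∃ P ∈ T, z ∈ P.region
  disjoint_interiors : ∀ P ∈ T, ∀ Q ∈ T, P ≠ Q → Disjoint (interior P.region) (interior Q.region)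
  /-- two different tiles are disjoint, or meet in one common vertex, or in one common side -/
  edge_to_edge : ∀ P ∈ T, ∀ Q ∈ T, P ≠ Q →
    P.region ∩ Q.region = ∅ ∨
    (∃ i j : ZMod 5, P.vertex i = Q.vertex j ∧ P.region ∩ Q.region = {P.vertex i}) ∨
    (∃ i j : ZMod 5, P.side i = Q.side j ∧ P.region ∩ Q.region = P.side i)

/-! ### Square complexes -/

/-- A combinatorial square complex with vertex set `V`: a graph (its `1`-skeleton) and a family of
`4`-cycles of the graph along which squares are attached. `IsSquare a b c d` says that some square
has the corners `a, b, c, d` in this cyclic order; a square is thus a quadruple up to the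
symmetries of a `4`-cycle. -/
structure SquareComplex (V : Type) where
  graph : SimpleGraph V
  IsSquare : V → V → V → V → Prop
  adj_of_isSquare : ∀ {a b c d}, IsSquare a b c d → graph.Adj a b
  ne_of_isSquare : ∀ {a b c d}, IsSquare a b c d → a ≠ c
  rotate : ∀ {a b c d}, IsSquare a b c d → IsSquare b c d a
  reflect : ∀ {a b c d}, IsSquare a b c d → IsSquare d c b a

namespace SquareComplex

variable {V : Type}

/-- The combinatorial metric on the vertices: the least number of edges of an edge path. -/
noncomputable def combDist (X : SquareComplex V) (x y : V) : ℝ := (X.graph.dist x y : ℝ)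

/-- Homotopy of edge paths relative to their endpoints: the equivalence relation generated by
deleting a backtrack and by pushing two consecutive sides of a square across that square. -/
inductive Homotopic (X : SquareComplex V) :
    ∀ {u v : V}, X.graph.Walk u v → X.graph.Walk u v → Prop
  | refl {u v : V} (p : X.graph.Walk u v) : Homotopic X p p
  | symm {u v : V} {p q : X.graph.Walk u v} : Homotopic X p q → Homotopic X q p
  | trans {u v : V} {p q r : X.graph.Walk u v} :
      Homotopic X p q → Homotopic X q r → Homotopic X p r
  | backtrack {u a b v : V} (p : X.graph.Walk u a) (h : X.graph.Adj a b)
      (q : X.graph.Walk a v) :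
      Homotopic X (p.append (.cons h (.cons h.symm q))) (p.append q)
  | square {u a b c d v : V} (p : X.graph.Walk u a) (q : X.graph.Walk c v)
      (_ : X.IsSquare a b c d)
      (hab : X.graph.Adj a b) (hbc : X.graph.Adj b c)
      (had : X.graph.Adj a d) (hdc : X.graph.Adj d c) :
      Homotopic X (p.append (.cons hab (.cons hbc q))) (p.append (.cons had (.cons hdc q)))

/-- `a` and `b` are joined by an edge in the link of the vertex `v`: some square has a corner at
`v` formed by the edges from `v` to `a` and to `b`. -/
def LinkAdj (X : SquareComplex V) (v a b : V) : Prop := ∃ d, X.IsSquare a v b d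

/-- A square complex is CAT(0) if it is connected and simply connected, and the link of every
vertex is a flag simplicial complex. In dimension two the latter means that links have no loops
(which holds for every `SquareComplex`), no double edges, and no triangles. -/
structure IsCAT0 (X : SquareComplex V) : Prop where
  connected : X.graph.Connected
  simply_connected : ∀ (v : V) (p : X.graph.Walk v v), X.Homotopic p .nil
  link_no_double_edge : ∀ {a v b d d' : V}, X.IsSquare a v b d → X.IsSquare a v b d' → d = d'
  link_no_triangle : ∀ v a b c : V, ¬ (X.LinkAdj v a b ∧ X.LinkAdj v b c ∧ X.LinkAdj v c a)

/-- The sets of corners of the squares that have `v` as a corner. -/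
def squaresAt (X : SquareComplex V) (v : V) : Set (Set V) :=
  {s | ∃ a b d : V, X.IsSquare a v b d ∧ s = {a, v, b, d}}

/-- `f` is a `lam`-quasiisometry from the vertices of `X`, with the combinatorial metric: there
are separate multiplicative constants for the two bounds, whose product is `lam`. -/
def IsQuasiisometry {Y : Type} [MetricSpace Y] (X : SquareComplex V) (f : V → Y) (lam : ℝ) :
    Prop :=
  ∃ lam₁ lam₂ ε : ℝ, 0 < lam₁ ∧ 0 < lam₂ ∧ 0 < ε ∧ lam₁ * lam₂ = lam ∧
    ∀ x y : V, 1 / lam₁ * X.combDist x y - ε ≤ dist (f x) (f y) ∧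
      dist (f x) (f y) ≤ lam₂ * X.combDist x y + ε

end SquareComplex

/-! ### The square complex dual to a tiling -/

/-- The square complex dual to `T`: one vertex for each tile, an edge between two tiles that share
a side, and a square whenever four tiles surround a vertex of the tiling, consecutive ones sharing
a side. -/
def dualComplex (T : Set Pentagon) : SquareComplex T where
  graph :=
    { Adj := fun P Q => P ≠ Q ∧ ∃ i j : ZMod 5, P.1.side i = Q.1.side j
      symm := ⟨fun _ _ h => ⟨h.1.symm, h.2.elim fun i hi => hi.elim fun j hj => ⟨j, i, hj.symm⟩⟩⟩
      loopless := ⟨fun _ h => h.1 rfl⟩ }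
  IsSquare := fun A B C D =>
    (∃ p : UpperHalfPlane, p ∈ Set.range A.1.vertex ∧ p ∈ Set.range B.1.vertex ∧
      p ∈ Set.range C.1.vertex ∧ p ∈ Set.range D.1.vertex) ∧
    A ≠ C ∧ B ≠ D ∧
    (A ≠ B ∧ ∃ i j : ZMod 5, A.1.side i = B.1.side j) ∧
    (B ≠ C ∧ ∃ i j : ZMod 5, B.1.side i = C.1.side j) ∧
    (C ≠ D ∧ ∃ i j : ZMod 5, C.1.side i = D.1.side j) ∧
    (D ≠ A ∧ ∃ i j : ZMod 5, D.1.side i = A.1.side j)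
  adj_of_isSquare := fun h => h.2.2.2.1
  ne_of_isSquare := fun h => h.2.1
  rotate := by
    rintro A B C D ⟨⟨p, hA, hB, hC, hD⟩, hAC, hBD, h1, h2, h3, h4⟩
    exact ⟨⟨p, hB, hC, hD, hA⟩, hBD, hAC.symm, h2, h3, h4, h1⟩
  reflect := by
    rintro A B C D ⟨⟨p, hA, hB, hC, hD⟩, hAC, hBD, ⟨n1, i1, j1, h1⟩, ⟨n2, i2, j2, h2⟩,
      ⟨n3, i3, j3, h3⟩, ⟨n4, i4, j4, h4⟩⟩
    exact ⟨⟨p, hD, hC, hB, hA⟩, hBD.symm, hAC.symm, ⟨n3.symm, j3, i3, h3.symm⟩,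
      ⟨n2.symm, j2, i2, h2.symm⟩, ⟨n1.symm, j1, i1, h1.symm⟩, ⟨n4.symm, j4, i4, h4.symm⟩⟩

/-- The identity map from the dual complex to the hyperbolic plane, on vertices: the vertex dual
to a tile is the centre of that tile. -/
def idMap (T : Set Pentagon) (P : T) : UpperHalfPlane := P.1.center

/-! ### The constants -/

/-- `K = cos (2π / 5)` -/
noncomputable def K : ℝ := Real.cos (2 * Real.pi / 5)

/-- `c = arccosh (K + 1)` -/
noncomputable def cConst : ℝ := Real.arcosh (K + 1)

/-- `d = arccosh (2 K² + 2 K + 1)` -/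
noncomputable def dConst : ℝ := Real.arcosh (2 * K ^ 2 + 2 * K + 1)

end PentagonTiling

/-!
The proof works in the hyperboloid model: `vec` embeds the upper half-plane into `ℝ³` with a
Lorentzian form for which `cosh (dist z w) = -lorentz (vec z) (vec w)`. The vertices of a regular
right-angled pentagon `P` form a *frame*, a configuration with a Gram matrix in the golden ratio
`φ` (`Pentagon.isFrame`); a concrete frame shows that pentagons exist. The signed distance to the
geodesic of the side `i` is measured by the linear function `Pentagon.height i`, whose values
under the reflections in the sides are explicit.

**The reflection group.** Let `W` be the group generated by the reflections in the sides of `P`,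
with its word length. By induction on the length, `g P` lies on one side of the geodesic of each
side of `P`, and multiplication by the reflection in that side shortens `g` exactly when `g P`
lies beyond it (`Pentagon.side_dichotomy`). So `P` is a strict fundamental domain, and its images
form a tiling (`Pentagon.isTiling_range`). Conversely, in any tiling the neighbour of a tile
across a side can only be its mirror image, so the tiles of an arbitrary tiling correspond to the
elements of `W` (`IsTiling.tile`), and the dual complex is the Cayley complex of `W`: edges join
`g` to `g r_i`, squares belong to pairs of adjacent, hence commuting, sides, and the combinatorial
metric is the word metric (`IsTiling.combDist_tile`). A tile cannot lie beyond two non-adjacent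
sides. Therefore, if a vertex of an edge path is further from the base tile than both its
neighbours on the path, these coincide or the path can be pushed across a square towards the base
tile, which contracts every closed path (`IsTiling.homotopic_nil`). The links are pentagons.

**The constants.** `c` and `d` are the distances between the midpoints of two adjacent,
respectively non-adjacent, sides. Following the midpoints of the sides that are crossed by a
shortest edge path gives the upper bound. For the lower bound, cut a geodesic segment where it
leaves the successive pentagons. A segment between two sides is at least as long as the sum of the
distances of its end points to suitable bisectors of the right angles at the ends of these sides,
and the distances from a point of a side to the bisectors at both ends of that side sum up to at
least `c`. Keeping track of which end of a side is used, these estimates telescope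
(`Pentagon.cConst_mul_length_le_dist`). Both bounds are attained up to an additive constant, by
products of reflections in sides with indices in arithmetic progression of step `1` and `2`: in
the first case consecutive midpoints have distance `c`, in the second case the midpoints lie on a
geodesic at consecutive distances `d`.
-/

namespace PentagonTiling

/-! ### The hyperboloid model -/

/-- The Lorentzian bilinear form on `ℝ³`, of signature `(2, 1)`, in coordinates in which the light
cone is `X₁ X₃ = X₂²`. -/
noncomputable def lorentz : (ℝ × ℝ × ℝ) →ₗ[ℝ] (ℝ × ℝ × ℝ) →ₗ[ℝ] ℝ :=
  LinearMap.mk₂ ℝ (fun X Y => X.2.1 * Y.2.1 - (X.1 * Y.2.2 + X.2.2 * Y.1) / 2)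
    (fun X X' Y => by simp; ring) (fun a X Y => by simp; ring)
    (fun X Y Y' => by simp; ring) (fun a X Y => by simp; ring)

lemma lorentz_apply (X Y : ℝ × ℝ × ℝ) :
    lorentz X Y = X.2.1 * Y.2.1 - (X.1 * Y.2.2 + X.2.2 * Y.1) / 2 := rfl

lemma lorentz_comm (X Y : ℝ × ℝ × ℝ) : lorentz X Y = lorentz Y X := by
  simp only [lorentz_apply]; ring

/-- The point of the hyperboloid `lorentz X X = -1` that corresponds to a point of the upper
half-plane. -/
noncomputable def vec (z : UpperHalfPlane) : ℝ × ℝ × ℝ :=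
  ((z.re ^ 2 + z.im ^ 2) / z.im, z.re / z.im, 1 / z.im)

lemma vec_pos (z : UpperHalfPlane) : 0 < (vec z).2.2 := one_div_pos.mpr z.im_pos

lemma lorentz_vec_self (z : UpperHalfPlane) : lorentz (vec z) (vec z) = -1 := by
  have := z.im_pos.ne'
  simp only [lorentz_apply, vec]
  field_simp
  ring

lemma cosh_dist_eq (z w : UpperHalfPlane) :
    Real.cosh (dist z w) = -lorentz (vec z) (vec w) := by
  have h1 := z.im_pos.ne'
  have h2 := w.im_pos.ne'
  rw [UpperHalfPlane.cosh_dist, Complex.dist_eq_re_im, Real.sq_sqrt (by positivity)]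
  simp only [lorentz_apply, vec, UpperHalfPlane.coe_re, UpperHalfPlane.coe_im]
  field_simp
  ring

lemma lorentz_vec (z w : UpperHalfPlane) :
    lorentz (vec z) (vec w) = -Real.cosh (dist z w) := by rw [cosh_dist_eq]; ring

lemma eq_of_lorentz_eq_neg_one {z w : UpperHalfPlane} (h : lorentz (vec z) (vec w) = -1) :
    z = w := by
  have h1 := cosh_dist_eq z w
  rw [h, neg_neg] at h1
  rw [← dist_eq_zero]
  by_contra h2
  have := (Real.one_lt_cosh (x := dist z w)).2 h2
  linarith

lemma vec_injective : Function.Injective vec := fun z w h =>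
  eq_of_lorentz_eq_neg_one (by rw [h, lorentz_vec_self])

lemma exists_vec_eq {X : ℝ × ℝ × ℝ} (h : lorentz X X = -1) (hpos : 0 < X.2.2) :
    ∃ z, vec z = X := by
  obtain ⟨a, b, c⟩ := X
  simp only [lorentz_apply] at h hpos
  refine ⟨UpperHalfPlane.mk ⟨b / c, 1 / c⟩ (by simpa using hpos), ?_⟩
  have hc := hpos.ne'
  have : a = (b ^ 2 + 1) / c := by field_simp; linarith
  simp only [vec, UpperHalfPlane.mk_re, UpperHalfPlane.mk_im, this, Prod.mk.injEq]
  refine ⟨?_, ?_, ?_⟩ <;> field_simp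

/-- A non-zero combination of points of the hyperboloid with non-negative coefficients can be
rescaled to lie on the hyperboloid. -/
lemma exists_vec_smul (x y : UpperHalfPlane) {a b : ℝ} (ha : 0 ≤ a) (hb : 0 ≤ b)
    (hab : 0 < a + b) : ∃ t : ℝ, 0 < t ∧ ∃ z, vec z = t • (a • vec x + b • vec y) := by
  set W := a • vec x + b • vec y with hW
  have hc := Real.one_le_cosh (dist x y)
  have hWW : lorentz W W = -(a ^ 2 + b ^ 2 + 2 * a * b * Real.cosh (dist x y)) := by
    simp only [hW, map_add, map_smul, LinearMap.add_apply, LinearMap.smul_apply, smul_eq_mul,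
      lorentz_vec_self, lorentz_comm (vec y) (vec x), lorentz_vec]
    ring
  have hpos : 0 < a ^ 2 + b ^ 2 + 2 * a * b * Real.cosh (dist x y) := by
    nlinarith [mul_nonneg ha hb, mul_pos hab hab,
      mul_nonneg (mul_nonneg ha hb) (sub_nonneg.2 hc)]
  have hW3 : 0 < W.2.2 := by
    simp only [hW, Prod.snd_add, Prod.smul_snd, smul_eq_mul]
    rcases ha.eq_or_lt with rfl | ha'
    · have : 0 < b := by linarith
      have := mul_pos this (vec_pos y)
      linarith
    · have := mul_pos ha' (vec_pos x)
      have := mul_nonneg hb (vec_pos y).le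
      linarith
  refine ⟨1 / √(a ^ 2 + b ^ 2 + 2 * a * b * Real.cosh (dist x y)), by positivity, ?_⟩
  refine exists_vec_eq ?_ ?_
  · simp only [map_smul, LinearMap.smul_apply, smul_eq_mul, hWW]
    rw [one_div, ← mul_assoc, ← mul_inv, Real.mul_self_sqrt hpos.le, mul_neg,
      inv_mul_cancel₀ hpos.ne']
  · simp only [Prod.smul_snd, smul_eq_mul]
    positivity

/-- The square of the determinant of three vectors, as a multiple of their Gram determinant. -/
lemma det_sq_eq (X Y Z : ℝ × ℝ × ℝ) :
    (X.1 * (Y.2.1 * Z.2.2 - Y.2.2 * Z.2.1) - X.2.1 * (Y.1 * Z.2.2 - Y.2.2 * Z.1)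
      + X.2.2 * (Y.1 * Z.2.1 - Y.2.1 * Z.1)) ^ 2 =
    -4 * (lorentz X X * lorentz Y Y * lorentz Z Z + 2 * lorentz X Y * lorentz Y Z * lorentz X Z
      - lorentz X X * lorentz Y Z ^ 2 - lorentz Y Y * lorentz X Z ^ 2
      - lorentz Z Z * lorentz X Y ^ 2) := by
  simp only [lorentz_apply]; ring

/-- Vectors with a non-zero Gram determinant span `ℝ³`, so only `0` is orthogonal to all three. -/
lemma eq_zero_of_orthogonal {X Y Z W : ℝ × ℝ × ℝ}
    (hdet : lorentz X X * lorentz Y Y * lorentz Z Z + 2 * lorentz X Y * lorentz Y Z * lorentz X Z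
      - lorentz X X * lorentz Y Z ^ 2 - lorentz Y Y * lorentz X Z ^ 2
      - lorentz Z Z * lorentz X Y ^ 2 ≠ 0)
    (hX : lorentz X W = 0) (hY : lorentz Y W = 0) (hZ : lorentz Z W = 0) : W = 0 := by
  have hD := det_sq_eq X Y Z
  obtain ⟨x1, x2, x3⟩ := X
  obtain ⟨y1, y2, y3⟩ := Y
  obtain ⟨z1, z2, z3⟩ := Z
  obtain ⟨w1, w2, w3⟩ := W
  set D := (x1 * (y2 * z3 - y3 * z2) - x2 * (y1 * z3 - y3 * z1) + x3 * (y1 * z2 - y2 * z1)) with hDd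
  have hD0 : D ≠ 0 := by
    intro h
    simp only [h] at hD
    apply hdet
    linarith
  simp only [lorentz_apply] at hX hY hZ
  have h3 : D * w3 = 0 := by
    rw [hDd]
    linear_combination (-2) * (y2 * z3 - y3 * z2) * hX + 2 * (x2 * z3 - x3 * z2) * hY
      - 2 * (x2 * y3 - x3 * y2) * hZ
  have h2 : D * w2 = 0 := by
    rw [hDd]
    linear_combination -(y1 * z3 - y3 * z1) * hX + (x1 * z3 - x3 * z1) * hY
      - (x1 * y3 - x3 * y1) * hZ
  have h1 : D * w1 = 0 := by
    rw [hDd]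
    linear_combination -2 * (y1 * z2 - y2 * z1) * hX + 2 * (x1 * z2 - x2 * z1) * hY
      - 2 * (x1 * y2 - x2 * y1) * hZ
  simp [hD0] at h1 h2 h3
  simp [h1, h2, h3]

/-! ### Segments, lines, half-planes and right angles in the hyperboloid model -/

lemma mem_seg_of_combination {x y z : UpperHalfPlane} {a b : ℝ} (ha : 0 ≤ a) (hb : 0 ≤ b)
    (h : vec z = a • vec x + b • vec y) : z ∈ seg x y := by
  set c := Real.cosh (dist x y) with hc
  have hs : 0 ≤ Real.sinh (dist x y) := Real.sinh_nonneg_iff.2 dist_nonneg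
  have hs2 := Real.cosh_sq' (dist x y)
  have e1 : Real.cosh (dist x z) = a + b * c := by
    rw [cosh_dist_eq, h]
    simp only [map_add, map_smul, smul_eq_mul, lorentz_vec_self, lorentz_vec]
    ring
  have e2 : Real.cosh (dist z y) = a * c + b := by
    rw [cosh_dist_eq, h]
    simp only [map_add, map_smul, smul_eq_mul, lorentz_vec_self, lorentz_vec,
      LinearMap.add_apply, LinearMap.smul_apply]
    ring
  have e3 : a ^ 2 + b ^ 2 + 2 * a * b * c = 1 := by
    have := lorentz_vec_self z
    rw [h] at this
    simp only [map_add, map_smul, smul_eq_mul, lorentz_vec_self, lorentz_vec,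
      LinearMap.add_apply, LinearMap.smul_apply, dist_comm y x] at this
    linarith
  have s1 : Real.sinh (dist x z) = b * Real.sinh (dist x y) := by
    rw [← pow_left_inj₀ (Real.sinh_nonneg_iff.2 dist_nonneg) (by positivity) two_ne_zero]
    rw [Real.sinh_sq, e1]
    nlinarith
  have s2 : Real.sinh (dist z y) = a * Real.sinh (dist x y) := by
    rw [← pow_left_inj₀ (Real.sinh_nonneg_iff.2 dist_nonneg) (by positivity) two_ne_zero]
    rw [Real.sinh_sq, e2]
    nlinarith
  change dist x z + dist z y = dist x y
  apply Real.cosh_strictMonoOn.injOn (Set.mem_Ici.2 (by positivity)) (Set.mem_Ici.2 dist_nonneg)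
  rw [Real.cosh_add, e1, e2, s1, s2]
  linear_combination c * e3 - a * b * hs2

lemma mem_seg_iff {x y z : UpperHalfPlane} :
    z ∈ seg x y ↔ ∃ a b : ℝ, 0 ≤ a ∧ 0 ≤ b ∧ vec z = a • vec x + b • vec y := by
  refine ⟨fun h => ?_, fun ⟨a, b, ha, hb, h⟩ => mem_seg_of_combination ha hb h⟩
  change dist x z + dist z y = dist x y at h
  rcases eq_or_ne x y with rfl | hxy
  · have : dist x z = 0 := by
      have := dist_nonneg (x := x) (y := z)
      have := dist_nonneg (x := z) (y := x)
      rw [dist_self] at h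
      linarith
    rw [dist_eq_zero] at this
    exact ⟨1, 0, zero_le_one, le_rfl, by simp [this]⟩
  have hs : 0 < Real.sinh (dist x y) := Real.sinh_pos_iff.2 (dist_pos.2 hxy)
  have h1 : 0 ≤ Real.sinh (dist x z) := Real.sinh_nonneg_iff.2 dist_nonneg
  have h2 : 0 ≤ Real.sinh (dist z y) := Real.sinh_nonneg_iff.2 dist_nonneg
  set a := Real.sinh (dist z y) / Real.sinh (dist x y) with ha
  set b := Real.sinh (dist x z) / Real.sinh (dist x y) with hb
  have ha0 : 0 ≤ a := by positivity
  have hb0 : 0 ≤ b := by positivity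
  have hsum : a * Real.cosh (dist x z) + b * Real.cosh (dist z y) = 1 := by
    have : Real.sinh (dist x y) = Real.sinh (dist x z + dist z y) := by rw [h]
    rw [Real.sinh_add] at this
    rw [ha, hb]
    field_simp
    linarith
  have hquad : a ^ 2 + b ^ 2 + 2 * a * b * Real.cosh (dist x y) = 1 := by
    have e1 : Real.cosh (dist x y) = Real.cosh (dist x z + dist z y) := by rw [h]
    have e2 : Real.sinh (dist x y) = Real.sinh (dist x z + dist z y) := by rw [h]
    rw [Real.cosh_add] at e1
    rw [Real.sinh_add] at e2
    have q1 := Real.cosh_sq' (dist x z)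
    have q2 := Real.cosh_sq' (dist z y)
    rw [ha, hb, e1]
    field_simp
    rw [e2]
    linear_combination (Real.sinh (dist z y)) ^ 2 * q1 * (-1) - (Real.sinh (dist x z)) ^ 2 * q2
  have hself : lorentz (a • vec x + b • vec y) (a • vec x + b • vec y) = -1 := by
    simp only [map_add, map_smul, smul_eq_mul, lorentz_vec_self, lorentz_vec,
      LinearMap.add_apply, LinearMap.smul_apply, dist_comm y x]
    linarith
  obtain ⟨w, hw⟩ : ∃ w, vec w = a • vec x + b • vec y := by
    refine exists_vec_eq hself ?_
    have hne : ¬ (a = 0 ∧ b = 0) := by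
      rintro ⟨h, h'⟩
      rw [h, h'] at hsum
      simp at hsum
    simp only [Prod.snd_add, Prod.smul_snd, smul_eq_mul]
    have := vec_pos x
    have := vec_pos y
    rcases ha0.eq_or_lt with h | h
    · have : 0 < b := hb0.lt_of_ne (fun h' => hne ⟨h.symm, h'.symm⟩)
      rw [← h]; positivity
    · positivity
  have : z = w := by
    apply eq_of_lorentz_eq_neg_one
    rw [hw]
    simp only [map_add, map_smul, smul_eq_mul, lorentz_vec, dist_comm z x]
    linarith
  exact ⟨a, b, ha0, hb0, this ▸ hw⟩

lemma one_lt_cosh_dist {p q : UpperHalfPlane} (h : p ≠ q) : 1 < Real.cosh (dist p q) :=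
  Real.one_lt_cosh.2 (dist_ne_zero.2 h)

/-- The geodesic through `p` and `q` is cut out by a vector orthogonal to `p` and `q`. -/
lemma mem_line_iff {p q : UpperHalfPlane} (hpq : p ≠ q) {n : ℝ × ℝ × ℝ} (hn : 0 < lorentz n n)
    (hp : lorentz (vec p) n = 0) (hq : lorentz (vec q) n = 0) (z : UpperHalfPlane) :
    z ∈ line p q ↔ lorentz (vec z) n = 0 := by
  constructor
  · rintro (h | h | h) <;> obtain ⟨a, b, ha, hb, h⟩ := mem_seg_iff.1 h
    · simp [h, hp, hq]
    · have h' := congrArg (fun X => lorentz X n) h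
      simp only [map_add, map_smul, LinearMap.add_apply, LinearMap.smul_apply, hp, hq, smul_eq_mul,
        mul_zero, add_zero] at h'
      refine (mul_eq_zero.1 h'.symm).resolve_left ?_
      rintro rfl
      have h1 := lorentz_vec_self p
      have h2 : 0 < (vec p).2.2 := vec_pos p
      simp only [zero_smul, zero_add] at h
      rw [h] at h1
      simp only [map_smul, LinearMap.smul_apply, lorentz_vec_self, smul_eq_mul] at h1
      have : b = 1 := by nlinarith
      rw [this, one_smul] at h
      exact hpq (vec_injective h)
    · have h' := congrArg (fun X => lorentz X n) h
      simp only [map_add, map_smul, LinearMap.add_apply, LinearMap.smul_apply, hp, hq, smul_eq_mul,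
        mul_zero, zero_add] at h'
      refine (mul_eq_zero.1 h'.symm).resolve_left ?_
      rintro rfl
      have h1 := lorentz_vec_self q
      simp only [zero_smul, add_zero] at h
      rw [h] at h1
      simp only [map_smul, LinearMap.smul_apply, lorentz_vec_self, smul_eq_mul] at h1
      have : a = 1 := by nlinarith
      rw [this, one_smul] at h
      exact hpq (vec_injective h.symm)
  · intro hz
    have hc := one_lt_cosh_dist hpq
    set c := Real.cosh (dist p q) with hcd
    set u := Real.cosh (dist p z) with hu
    set v := Real.cosh (dist q z) with hv
    have hc2 : c ^ 2 - 1 ≠ 0 := by nlinarith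
    set a := (c * v - u) / (c ^ 2 - 1) with ha
    set b := (c * u - v) / (c ^ 2 - 1) with hb
    have hW : vec z - (a • vec p + b • vec q) = 0 := by
      apply eq_zero_of_orthogonal (X := vec p) (Y := vec q) (Z := n)
      · simp only [lorentz_vec_self, hp, hq, lorentz_vec]
        rw [← hcd]
        have : 0 < lorentz n n * (c ^ 2 - 1) := mul_pos hn (by nlinarith)
        intro h
        nlinarith
      · simp only [map_sub, map_add, map_smul, smul_eq_mul, lorentz_vec_self, lorentz_vec]
        rw [← hcd, ← hu, ha, hb]
        field_simp
        ring
      · simp only [map_sub, map_add, map_smul, smul_eq_mul, lorentz_vec_self, lorentz_vec,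
          dist_comm q p]
        rw [← hcd, ← hv, ha, hb]
        field_simp
        ring
      · simp [lorentz_comm n, hp, hq, hz]
    rw [sub_eq_zero] at hW
    have h3 := congrArg (fun X => X.2.2) hW
    simp only [Prod.snd_add, Prod.smul_snd, smul_eq_mul] at h3
    have zp := vec_pos z
    have pp := vec_pos p
    have qp := vec_pos q
    rcases le_or_gt 0 a with h0 | h0
    · rcases le_or_gt 0 b with h1 | h1
      · exact Or.inl (mem_seg_of_combination h0 h1 hW)
      · have h0' : 0 < a := by
          rcases h0.eq_or_lt with h | h
          · rw [← h] at h3; nlinarith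
          · exact h
        refine Or.inr (Or.inl (mem_seg_of_combination (a := 1 / a) (b := -b / a) (by positivity)
          (div_nonneg (by linarith) h0) ?_))
        rw [hW, smul_add, smul_smul, smul_smul, add_assoc, ← add_smul]
        have : 1 / a * b + -b / a = 0 := by field_simp; ring
        rw [this, one_div_mul_cancel h0'.ne']
        simp
    · have h1 : 0 < b := by
        by_contra h
        nlinarith [mul_nonneg (neg_nonneg.2 (not_lt.1 h)) qp.le, mul_pos (neg_pos.2 h0) pp]
      refine Or.inr (Or.inr (mem_seg_of_combination (a := -a / b) (b := 1 / b)
        (div_nonneg (by linarith) h1.le) (by positivity) ?_))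
      rw [hW, smul_add, smul_smul, smul_smul, ← add_assoc, ← add_smul]
      have : -a / b + 1 / b * a = 0 := by field_simp; ring
      rw [this, one_div_mul_cancel h1.ne']
      simp

/-- A segment that ends strictly beyond a geodesic meets it, in the rescaled combination of the end
points that is orthogonal to the normal vector `n` of the geodesic. -/
lemma exists_mem_seg_crossing {x y : UpperHalfPlane} {n : ℝ × ℝ × ℝ}
    (hx : 0 ≤ lorentz (vec x) n) (hy : lorentz (vec y) n < 0) :
    ∃ t : ℝ, 0 < t ∧ ∃ z ∈ seg x y,
      vec z = t • ((-lorentz (vec y) n) • vec x + lorentz (vec x) n • vec y) := by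
  obtain ⟨t, ht, z, hz⟩ := exists_vec_smul x y (a := -lorentz (vec y) n) (b := lorentz (vec x) n)
    (by linarith) hx (by linarith)
  refine ⟨t, ht, z, mem_seg_of_combination (a := t * (-lorentz (vec y) n))
    (b := t * lorentz (vec x) n) (mul_nonneg ht.le (by linarith)) (by positivity) ?_, hz⟩
  rw [hz, smul_add, smul_smul, smul_smul]

/-- Two points lie strictly on the same side of a geodesic if and only if their segment avoids
it. -/
lemma disjoint_seg_iff {L : Set UpperHalfPlane} {n : ℝ × ℝ × ℝ}
    (hL : ∀ z, z ∈ L ↔ lorentz (vec z) n = 0) (x y : UpperHalfPlane) :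
    Disjoint (seg x y) L ↔ 0 < lorentz (vec x) n * lorentz (vec y) n := by
  constructor
  · intro h
    rw [Set.disjoint_left] at h
    have hx : lorentz (vec x) n ≠ 0 := fun h0 =>
      h (show x ∈ seg x y by simp [seg]) ((hL x).2 h0)
    have hy : lorentz (vec y) n ≠ 0 := fun h0 =>
      h (show y ∈ seg x y by simp [seg]) ((hL y).2 h0)
    by_contra hneg
    have hneg' : lorentz (vec x) n * lorentz (vec y) n < 0 :=
      lt_of_le_of_ne (not_lt.1 hneg) (mul_ne_zero hx hy)
    rcases mul_neg_iff.1 hneg' with ⟨h1, h2⟩ | ⟨h1, h2⟩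
    · obtain ⟨t, ht, z, hz, hz'⟩ := exists_mem_seg_crossing h1.le h2
      refine h hz ((hL z).2 ?_)
      rw [hz']
      simp; ring
    · obtain ⟨t, ht, z, hz, hz'⟩ := exists_mem_seg_crossing (x := x) (y := y) (n := -n)
        (by simp [h1.le]) (by simpa using h2)
      refine h hz ((hL z).2 ?_)
      rw [hz']
      simp; ring
  · intro h
    rw [Set.disjoint_left]
    intro z hz hzL
    rw [hL] at hzL
    obtain ⟨a, b, ha, hb, hab⟩ := mem_seg_iff.1 hz
    have h0 : a * lorentz (vec x) n + b * lorentz (vec y) n = 0 := by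
      rw [hab] at hzL; simpa using hzL
    have hab0 : a ≠ 0 ∨ b ≠ 0 := by
      by_contra hcon
      push Not at hcon
      have := vec_pos z
      rw [hab, hcon.1, hcon.2] at this
      simp at this
    have h1 : a * lorentz (vec x) n * lorentz (vec x) n
        + b * (lorentz (vec x) n * lorentz (vec y) n) = 0 := by
      linear_combination lorentz (vec x) n * h0
    have hx : 0 < lorentz (vec x) n * lorentz (vec x) n := by
      rw [← pow_two]
      have : lorentz (vec x) n ≠ 0 := by rintro h'; simp [h'] at h
      positivity
    have h2 : 0 ≤ a * (lorentz (vec x) n * lorentz (vec x) n) := by positivity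
    have h3 : 0 ≤ b * (lorentz (vec x) n * lorentz (vec y) n) := by positivity
    rcases hab0 with h4 | h4
    · have : 0 < a * (lorentz (vec x) n * lorentz (vec x) n) := by positivity
      linarith
    · have : 0 < b * (lorentz (vec x) n * lorentz (vec y) n) := by positivity
      linarith

lemma mem_halfPlane_iff {L : Set UpperHalfPlane} {n : ℝ × ℝ × ℝ}
    (hL : ∀ z, z ∈ L ↔ lorentz (vec z) n = 0) {x : UpperHalfPlane} (hx : 0 < lorentz (vec x) n)
    (z : UpperHalfPlane) : z ∈ halfPlane L x ↔ 0 ≤ lorentz (vec z) n := by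
  change z ∈ L ∨ Disjoint (seg z x) L ↔ _
  rw [disjoint_seg_iff hL, hL, mul_pos_iff_of_pos_right hx, le_iff_eq_or_lt, eq_comm]

lemma discCoord_eq (p q : UpperHalfPlane) :
    (discCoord p q).re = ((q.re - p.re) ^ 2 + q.im ^ 2 - p.im ^ 2) /
        ((q.re - p.re) ^ 2 + (q.im + p.im) ^ 2) ∧
      (discCoord p q).im = (-2 * (q.re - p.re) * p.im) /
        ((q.re - p.re) ^ 2 + (q.im + p.im) ^ 2) := by
  have hp := p.im_pos
  have hq := q.im_pos
  have hq2 : (q.re - p.re) ^ 2 + (q.im + p.im) ^ 2 ≠ 0 := by positivity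
  have hN : Complex.normSq ((q : ℂ) - (starRingEnd ℂ) (p : ℂ)) =
      (q.re - p.re) ^ 2 + (q.im + p.im) ^ 2 := by
    simp [Complex.normSq_apply]; ring
  constructor
  · rw [discCoord, Complex.div_re, hN, ← add_div]
    simp; ring
  · rw [discCoord, Complex.div_im, hN, ← sub_div]
    simp; ring

/-- The Pythagorean theorem and its converse. -/
lemma hypAngle_eq_pi_div_two_iff (q p r : UpperHalfPlane) :
    hypAngle q p r = Real.pi / 2 ↔
      Real.cosh (dist q r) = Real.cosh (dist p q) * Real.cosh (dist p r) := by
  rw [hypAngle, ← InnerProductGeometry.inner_eq_zero_iff_angle_eq_pi_div_two]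
  rw [cosh_dist_eq, cosh_dist_eq, cosh_dist_eq, Complex.inner]
  have hp := p.im_pos
  have hq := q.im_pos
  have hr := r.im_pos
  have hq2 : (q.re - p.re) ^ 2 + (q.im + p.im) ^ 2 ≠ 0 := by positivity
  have hr2 : (r.re - p.re) ^ 2 + (r.im + p.im) ^ 2 ≠ 0 := by positivity
  have key : (((starRingEnd ℂ) (discCoord p q)) * discCoord p r).re =
      4 * p.im ^ 2 * q.im * r.im / (((q.re - p.re) ^ 2 + (q.im + p.im) ^ 2) *
        ((r.re - p.re) ^ 2 + (r.im + p.im) ^ 2)) *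
        (lorentz (vec q) (vec r) + lorentz (vec p) (vec q) * lorentz (vec p) (vec r)) := by
    rw [Complex.mul_re, Complex.conj_re, Complex.conj_im, (discCoord_eq p q).1,
      (discCoord_eq p q).2, (discCoord_eq p r).1, (discCoord_eq p r).2]
    simp only [lorentz_apply, vec]
    field_simp
    ring
  have hpos : 4 * p.im ^ 2 * q.im * r.im / (((q.re - p.re) ^ 2 + (q.im + p.im) ^ 2) *
        ((r.re - p.re) ^ 2 + (r.im + p.im) ^ 2)) ≠ 0 := by positivity
  rw [mul_comm (discCoord p r), key, mul_eq_zero, or_iff_right hpos]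
  constructor <;> intro h <;> linarith

/-! ### Frames of regular right-angled pentagons -/

/-- The golden ratio, the hyperbolic cosine of the side of a regular right-angled pentagon. -/
noncomputable def φ : ℝ := Real.goldenRatio

/-- The vectors of the five vertices of a regular right-angled pentagon, characterised by their
Gram matrix: the hyperbolic cosine of the side is the golden ratio `φ`, that of the diagonal is
`φ ^ 2`. -/
structure IsFrame (V : ZMod 5 → ℝ × ℝ × ℝ) : Prop where
  self : ∀ i, lorentz (V i) (V i) = -1
  side : ∀ i, lorentz (V i) (V (i + 1)) = -φ
  diagonal : ∀ i, lorentz (V i) (V (i + 2)) = -φ ^ 2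

/-- An inward normal vector, of Lorentzian square `φ ^ 3`, of the side from `V i` to
`V (i + 1)`. -/
def normal (V : ZMod 5 → ℝ × ℝ × ℝ) (i : ZMod 5) : ℝ × ℝ × ℝ := V (i + 3) - V i - V (i + 1)

lemma phi_sq : φ ^ 2 = φ + 1 := Real.goldenRatio_sq

lemma phi_four : φ ^ 4 = 3 * φ + 2 := by linear_combination (φ ^ 2 + φ + 2) * phi_sq

lemma phi_pos : 0 < φ := Real.goldenRatio_pos

lemma one_lt_phi : 1 < φ := Real.one_lt_goldenRatio

lemma phi_lt_two : φ < 2 := Real.goldenRatio_lt_two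

namespace IsFrame

variable {V : ZMod 5 → ℝ × ℝ × ℝ}

lemma diagonal' (hV : IsFrame V) (i : ZMod 5) : lorentz (V i) (V (i + 3)) = -φ ^ 2 := by
  have := hV.diagonal (i + 3)
  rwa [add_assoc, show (3 : ZMod 5) + 2 = 0 by decide, add_zero, lorentz_comm] at this

lemma side' (hV : IsFrame V) (i : ZMod 5) : lorentz (V i) (V (i + 4)) = -φ := by
  have := hV.side (i + 4)
  rwa [add_assoc, show (4 : ZMod 5) + 1 = 0 by decide, add_zero, lorentz_comm] at this

/-- All entries of the Gram matrix, in terms of the difference of the indices. -/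
lemma gram (hV : IsFrame V) (i j : ZMod 5) : lorentz (V i) (V j) =
    if j - i = 0 then -1 else if j - i = 1 ∨ j - i = 4 then -φ else -φ ^ 2 := by
  obtain ⟨k, rfl⟩ : ∃ k, j = i + k := ⟨j - i, by ring⟩
  rw [add_sub_cancel_left]
  have hk : ∀ k : ZMod 5, k = 0 ∨ k = 1 ∨ k = 2 ∨ k = 3 ∨ k = 4 := by decide
  rcases hk k with rfl | rfl | rfl | rfl | rfl
  · simp [hV.self]
  · rw [hV.side, if_neg (by decide), if_pos (by decide)]
  · rw [hV.diagonal, if_neg (by decide), if_neg (by decide)]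
  · rw [hV.diagonal', if_neg (by decide), if_neg (by decide)]
  · rw [hV.side', if_neg (by decide), if_pos (by decide)]

lemma lorentz_normal (hV : IsFrame V) (i j : ZMod 5) : lorentz (V j) (normal V i) =
    if j = i ∨ j = i + 1 then 0 else if j = i + 3 then 2 * φ + 1 else φ + 1 := by
  obtain ⟨k, rfl⟩ : ∃ k, j = i + k := ⟨j - i, by ring⟩
  have hk : ∀ k : ZMod 5, k = 0 ∨ k = 1 ∨ k = 2 ∨ k = 3 ∨ k = 4 := by decide
  simp only [normal, map_sub, hV.gram, add_sub_add_left_eq_sub, sub_add_cancel_left,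
    add_right_inj, add_eq_left]
  have := phi_sq
  rcases hk k with rfl | rfl | rfl | rfl | rfl
  · rw [if_neg (by decide), if_neg (by decide), if_pos (by decide), if_neg (by decide),
      if_pos (by decide), if_pos (by decide)]; linarith
  · rw [if_neg (by decide), if_neg (by decide), if_neg (by decide), if_pos (by decide),
      if_pos (by decide), if_pos (by decide)]; linarith
  · rw [if_neg (by decide), if_pos (by decide), if_neg (by decide), if_neg (by decide),
      if_neg (by decide), if_pos (by decide), if_neg (by decide), if_neg (by decide)]; linarith
  · rw [if_pos (by decide), if_neg (by decide), if_neg (by decide), if_neg (by decide),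
      if_neg (by decide), if_neg (by decide), if_pos (by decide)]; linarith
  · rw [if_neg (by decide), if_pos (by decide), if_neg (by decide), if_pos (by decide),
      if_neg (by decide), if_neg (by decide), if_neg (by decide), if_neg (by decide)]; linarith

lemma normal_zero (hV : IsFrame V) (i : ZMod 5) : lorentz (V i) (normal V i) = 0 := by
  rw [hV.lorentz_normal, if_pos (Or.inl rfl)]

lemma normal_one (hV : IsFrame V) (i : ZMod 5) : lorentz (V (i + 1)) (normal V i) = 0 := by
  rw [hV.lorentz_normal, if_pos (Or.inr rfl)]

lemma normal_three (hV : IsFrame V) (i : ZMod 5) :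
    lorentz (V (i + 3)) (normal V i) = 2 * φ + 1 := by
  rw [hV.lorentz_normal, if_neg, if_pos rfl]
  rw [add_eq_left, add_right_inj]; decide

lemma lorentz_normal_nonneg (hV : IsFrame V) (i j : ZMod 5) : 0 ≤ lorentz (V j) (normal V i) := by
  have := phi_pos
  rw [hV.lorentz_normal]
  split_ifs <;> positivity

lemma lorentz_normal_pos (hV : IsFrame V) {i j : ZMod 5} (h : j ≠ i) (h' : j ≠ i + 1) :
    0 < lorentz (V j) (normal V i) := by
  have := phi_pos
  rw [hV.lorentz_normal, if_neg (by tauto)]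
  split_ifs <;> positivity

lemma normal_normal (hV : IsFrame V) (i j : ZMod 5) : lorentz (normal V j) (normal V i) =
    if j = i then 2 * φ + 1 else if j = i + 1 ∨ j = i + 4 then 0 else -(3 * φ + 2) := by
  obtain ⟨k, rfl⟩ : ∃ k, j = i + k := ⟨j - i, by ring⟩
  have hk : ∀ k : ZMod 5, k = 0 ∨ k = 1 ∨ k = 2 ∨ k = 3 ∨ k = 4 := by decide
  conv_lhs => rw [normal]
  simp only [map_sub, LinearMap.sub_apply, hV.lorentz_normal, add_assoc, add_right_inj,
    add_eq_left]
  rcases hk k with rfl | rfl | rfl | rfl | rfl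
  · rw [if_neg (by decide), if_pos (by decide), if_pos (by decide), if_pos (by decide),
      if_pos (by decide)]; ring
  · rw [if_neg (by decide), if_neg (by decide), if_pos (by decide), if_neg (by decide),
      if_neg (by decide), if_neg (by decide), if_pos (by decide)]; ring
  · rw [if_pos (by decide), if_neg (by decide), if_neg (by decide), if_neg (by decide),
      if_pos (by decide), if_neg (by decide), if_neg (by decide)]; ring
  · rw [if_pos (by decide), if_neg (by decide), if_pos (by decide), if_neg (by decide),
      if_neg (by decide), if_neg (by decide), if_neg (by decide)]; ring
  · rw [if_neg (by decide), if_neg (by decide), if_neg (by decide), if_neg (by decide),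
      if_pos (by decide), if_neg (by decide), if_pos (by decide)]; ring

lemma normal_self (hV : IsFrame V) (i : ZMod 5) :
    lorentz (normal V i) (normal V i) = 2 * φ + 1 := by
  rw [hV.normal_normal, if_pos rfl]

/-- Three consecutive vertices span. -/
lemma eq_zero_of_vertex (hV : IsFrame V) {W : ℝ × ℝ × ℝ} (i : ZMod 5)
    (h0 : lorentz (V i) W = 0) (h1 : lorentz (V (i + 1)) W = 0)
    (h2 : lorentz (V (i + 2)) W = 0) : W = 0 := by
  refine eq_zero_of_orthogonal ?_ h0 h1 h2
  have h12 := hV.side (i + 1)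
  rw [add_assoc, show (1 : ZMod 5) + 1 = 2 by decide] at h12
  rw [hV.self, hV.self, hV.self, hV.side, h12, hV.diagonal]
  have := one_lt_phi
  have h : -1 * -1 * -1 + 2 * -φ * -φ * -φ ^ 2 - -1 * (-φ) ^ 2 - -1 * (-φ ^ 2) ^ 2 - -1 * (-φ) ^ 2
      = -(φ + 1) := by linear_combination 2 * phi_sq - phi_four
  rw [h]
  linarith

/-- The normals of three consecutive sides span. -/
lemma eq_zero_of_normal (hV : IsFrame V) {W : ℝ × ℝ × ℝ} (i : ZMod 5)
    (h0 : lorentz (normal V i) W = 0) (h1 : lorentz (normal V (i + 1)) W = 0)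
    (h2 : lorentz (normal V (i + 4)) W = 0) : W = 0 := by
  refine eq_zero_of_orthogonal ?_ h0 h1 h2
  simp only [hV.normal_normal, add_right_inj, add_assoc, left_eq_add]
  simp (decide := true) only [if_true, if_false]
  have := phi_sq
  have := one_lt_phi
  have h : (2 * φ + 1) * (2 * φ + 1) * (2 * φ + 1) + 2 * 0 * -(3 * φ + 2) * 0 -
      (2 * φ + 1) * (-(3 * φ + 2)) ^ 2 - (2 * φ + 1) * 0 ^ 2 - (2 * φ + 1) * 0 ^ 2
      = -(2 * φ + 1) * ((3 * φ + 2) ^ 2 - (2 * φ + 1) ^ 2) := by ring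
  rw [h]
  have : 0 < (2 * φ + 1) * ((3 * φ + 2) ^ 2 - (2 * φ + 1) ^ 2) := by
    apply mul_pos <;> nlinarith
  linarith [this.ne']

/-- The diagonals of the regular pentagon are parallel to the sides, in the golden ratio. -/
lemma diagonal_sub (hV : IsFrame V) (i : ZMod 5) :
    V (i + 3) - V i = φ • (V (i + 2) - V (i + 1)) := by
  rw [← sub_eq_zero]
  apply hV.eq_zero_of_vertex i <;>
    simp only [map_sub, map_smul, smul_eq_mul, hV.gram, add_sub_add_left_eq_sub,
      sub_add_cancel_left, add_sub_cancel_left, sub_self] <;>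
    simp (decide := true) only [if_true, if_false]
  · linear_combination (φ - 1) * phi_sq
  · ring
  · ring

/-- A frame is determined by one side and the normal of that side. -/
lemma unique (hV : IsFrame V) {W : ZMod 5 → ℝ × ℝ × ℝ} (hW : IsFrame W) {i j : ZMod 5}
    (h0 : V i = W j) (h1 : V (i + 1) = W (j + 1)) (hn : normal V i = normal W j) (k : ZMod 5) :
    V (i + k) = W (j + k) := by
  have h3 : V (i + 3) = W (j + 3) := by
    have := hn
    simp only [normal, h0, h1] at this
    simpa using this
  have h2 : V (i + 2) = W (j + 2) := by
    have e1 := hV.diagonal_sub i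
    have e2 := hW.diagonal_sub j
    rw [h0, h1, h3, e2] at e1
    have := smul_right_injective _ phi_pos.ne' e1
    simpa using this.symm
  have h4 : V (i + 4) = W (j + 4) := by
    have e1 := hV.diagonal_sub (i + 1)
    have e2 := hW.diagonal_sub (j + 1)
    simp only [add_assoc] at e1 e2
    norm_num at e1 e2
    rw [h1, h2, h3, ← e2] at e1
    simpa using e1
  have hk : ∀ k : ZMod 5, k = 0 ∨ k = 1 ∨ k = 2 ∨ k = 3 ∨ k = 4 := by decide
  rcases hk k with rfl | rfl | rfl | rfl | rfl
  · simpa using h0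
  all_goals assumption

/-- A frame listed in the opposite direction. -/
lemma reverse (hV : IsFrame V) (a : ZMod 5) : IsFrame (fun k => V (a - k)) where
  self i := hV.self _
  side i := by
    have := hV.side (a - (i + 1))
    rwa [lorentz_comm, show a - (i + 1) + 1 = a - i by ring] at this
  diagonal i := by
    have := hV.diagonal (a - (i + 2))
    rwa [lorentz_comm, show a - (i + 2) + 2 = a - i by ring] at this

end IsFrame

lemma normal_reverse (V : ZMod 5 → ℝ × ℝ × ℝ) (a i : ZMod 5) :
    normal (fun k => V (a - k)) i = normal V (a - i - 1) := by
  have h5 : (5 : ZMod 5) = 0 := by decide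
  simp only [normal]
  rw [show a - i - 1 + 3 = a - (i + 3) by linear_combination h5,
    show a - i - 1 + 1 = a - i by ring, show a - (i + 1) = a - i - 1 by ring]
  abel

/-! ### The frame of a pentagon -/

namespace Pentagon

variable (P : Pentagon)

lemma vertex_ne (i : ZMod 5) : P.vertex i ≠ P.vertex (i + 1) := by
  intro h
  have hij : i + 2 ≠ i ∧ i + 2 ≠ i + 1 := by
    constructor
    · rw [Ne, add_eq_left]; decide
    · rw [Ne, add_right_inj]; decide
  have := P.convex i (i + 2) hij.1 hij.2
  rw [Set.disjoint_left] at this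
  refine this (show P.vertex (i + 2) ∈ _ by simp [seg]) ?_
  refine Or.inr (Or.inl ?_)
  change _ + _ = _
  rw [h, dist_self, add_zero]

/-- The right angles express the diagonals through the side, and since the five vertices lie in a
space of dimension three this forces the hyperbolic cosine of the side to be the golden ratio. -/
lemma isFrame : IsFrame (fun i => vec (P.vertex i)) := by
  set s := Real.cosh (dist (P.vertex 0) (P.vertex 1)) with hs
  have h1 (i : ZMod 5) : lorentz (vec (P.vertex i)) (vec (P.vertex (i + 1))) = -s := by
    rw [lorentz_vec, P.equilateral i]
  have h2 (i : ZMod 5) : lorentz (vec (P.vertex i)) (vec (P.vertex (i + 2))) = -s ^ 2 := by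
    have h := (hypAngle_eq_pi_div_two_iff _ _ _).1 (P.right_angled (i + 1))
    have e1 := h1 (i + 1)
    have e0 := h1 i
    rw [cosh_dist_eq, cosh_dist_eq, cosh_dist_eq] at h
    rw [add_sub_cancel_right] at h
    rw [add_assoc, show (1 : ZMod 5) + 1 = 2 by decide] at h e1
    rw [lorentz_comm (vec (P.vertex (i + 1))), e0, e1] at h
    linarith
  have hs1 : 1 < s := one_lt_cosh_dist (by simpa using P.vertex_ne 0)
  have e01 := h1 0
  have e12 := h1 1
  have e23 := h1 2
  have e02 := h2 0
  have e13 := h2 1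
  have e03 := h2 3
  rw [show (0 : ZMod 5) + 1 = 1 by decide] at e01
  rw [show (1 : ZMod 5) + 1 = 2 by decide] at e12
  rw [show (2 : ZMod 5) + 1 = 3 by decide] at e23
  rw [show (0 : ZMod 5) + 2 = 2 by decide] at e02
  rw [show (1 : ZMod 5) + 2 = 3 by decide] at e13
  rw [show (3 : ZMod 5) + 2 = 0 by decide, lorentz_comm] at e03
  have f0 := lorentz_vec_self (P.vertex 0)
  have f1 := lorentz_vec_self (P.vertex 1)
  have f2 := lorentz_vec_self (P.vertex 2)
  have f3 := lorentz_vec_self (P.vertex 3)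
  have e10 := e01
  have e21 := e12
  have e32 := e23
  have e20 := e02
  have e31 := e13
  have e30 := e03
  rw [lorentz_comm] at e10 e21 e32 e20 e31 e30
  set v0 := vec (P.vertex 0)
  set v1 := vec (P.vertex 1)
  set v2 := vec (P.vertex 2)
  set v3 := vec (P.vertex 3)
  -- Four vertices are symmetric under reversal; the antisymmetric part of their span has
  -- dimension one because the symmetric part already has dimension two.
  have hW : (s + 1) • (v1 - v2) - s • (v0 - v3) = 0 := by
    apply eq_zero_of_orthogonal (X := v0 + v3) (Y := v1 + v2) (Z := v0 - v3)
    · simp only [map_add, map_sub, LinearMap.add_apply, LinearMap.sub_apply, e01, e12, e23, e02,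
        e13, e03, e10, e21, e32, e20, e31, e30, f0, f1, f2, f3]
      have : 0 < (s ^ 2 - 1) * ((1 + s) * (s ^ 3 - 1)) := by
        apply mul_pos (by nlinarith)
        apply mul_pos (by linarith)
        nlinarith [mul_pos (sub_pos.2 hs1) (sub_pos.2 hs1)]
      intro h
      nlinarith
    all_goals
      simp only [map_add, map_sub, map_smul, smul_eq_mul, LinearMap.add_apply,
        LinearMap.sub_apply, e01, e12, e23, e02,
        e13, e03, e10, e21, e32, e20, e31, e30, f0, f1, f2, f3]
      ring
  have hphi : s = φ := by
    have h := congrArg (fun W => lorentz v1 W) hW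
    simp only [map_sub, map_smul, smul_eq_mul, e12, e10, e13, f1, map_zero] at h
    have h' : (s - 1) * (s ^ 2 - s - 1) = 0 := by nlinarith
    have h'' : s ^ 2 - s - 1 = 0 := (mul_eq_zero.1 h').resolve_left (by linarith)
    have : (s - φ) * (s + φ - 1) = 0 := by linear_combination h'' - phi_sq
    have hne : s + φ - 1 ≠ 0 := by
      have := one_lt_phi
      linarith
    linarith [(mul_eq_zero.1 this).resolve_right hne]
  exact ⟨fun i => lorentz_vec_self _, fun i => by rw [h1, hphi], fun i => by rw [h2, hphi]⟩

/-- A function that is positive on the inner side of the `i`-th side, negative on the other side,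
and zero on its geodesic; up to the factor `φ ^ (3 / 2)` it is the hyperbolic sine of the signed
distance. -/
noncomputable def height (i : ZMod 5) (z : UpperHalfPlane) : ℝ :=
  Real.cosh (dist z (P.vertex i)) + Real.cosh (dist z (P.vertex (i + 1)))
    - Real.cosh (dist z (P.vertex (i + 3)))

/-- The vectors of the vertices of a pentagon. -/
noncomputable def frame (i : ZMod 5) : ℝ × ℝ × ℝ := vec (P.vertex i)

lemma isFrame_frame : IsFrame P.frame := P.isFrame

lemma height_eq (i : ZMod 5) (z : UpperHalfPlane) :
    P.height i z = lorentz (vec z) (normal P.frame i) := by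
  simp only [height, cosh_dist_eq, normal, frame, map_sub]
  ring

lemma height_vertex (i j : ZMod 5) : P.height i (P.vertex j) =
    if j = i ∨ j = i + 1 then 0 else if j = i + 3 then 2 * φ + 1 else φ + 1 := by
  rw [height_eq]
  exact P.isFrame_frame.lorentz_normal i j

/-- Non-adjacent sides lie on disjoint geodesics: no point is beyond both. -/
lemma height_add_height_pos (i : ZMod 5) (z : UpperHalfPlane) :
    0 < P.height i z + P.height (i + 2) z := by
  have h1 : i + 2 + 1 = i + 3 := by ring
  have h2 : i + 2 + 3 = i := by rw [add_assoc, show (2 : ZMod 5) + 3 = 0 by decide, add_zero]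
  simp only [height, h1, h2]
  have := Real.cosh_pos (dist z (P.vertex (i + 1)))
  have := Real.cosh_pos (dist z (P.vertex (i + 2)))
  linarith

lemma mem_line_side_iff (i : ZMod 5) (z : UpperHalfPlane) :
    z ∈ line (P.vertex i) (P.vertex (i + 1)) ↔ P.height i z = 0 := by
  rw [height_eq]
  apply mem_line_iff (P.vertex_ne i)
  · rw [P.isFrame_frame.normal_self]
    have := phi_pos
    positivity
  · exact P.isFrame_frame.normal_zero i
  · exact P.isFrame_frame.normal_one i

lemma mem_region_iff (z : UpperHalfPlane) : z ∈ P.region ↔ ∀ i, 0 ≤ P.height i z := by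
  refine forall_congr' fun i => ?_
  rw [height_eq]
  apply mem_halfPlane_iff
  · intro z
    rw [mem_line_side_iff, height_eq]
  · refine (P.isFrame_frame.normal_three i).symm ▸ ?_
    have := phi_pos
    positivity

/-- Points of the geodesic of a side, as combinations of the end points of the side. -/
lemma vec_eq_of_height_eq_zero {i : ZMod 5} {z : UpperHalfPlane} (h : P.height i z = 0) :
    vec z = ((2 - φ) * P.height (i + 1) z) • P.frame i
      + ((2 - φ) * P.height (i + 4) z) • P.frame (i + 1) := by
  rw [← sub_eq_zero]
  have hV := P.isFrame_frame
  rw [height_eq] at h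
  simp only [height_eq]
  have h2 := phi_sq
  apply hV.eq_zero_of_normal i <;> rw [lorentz_comm] <;>
    simp only [map_sub, map_add, map_smul, smul_eq_mul, LinearMap.sub_apply, LinearMap.add_apply,
      LinearMap.smul_apply, hV.lorentz_normal, add_assoc, add_right_inj, left_eq_add] <;>
    simp (decide := true) only [if_true, if_false, or_true]
  · rw [h]; ring
  · linear_combination (lorentz (vec z) (normal P.frame (i + 1))) * h2
  · linear_combination (lorentz (vec z) (normal P.frame (i + 4))) * h2

lemma mem_side_iff (i : ZMod 5) (z : UpperHalfPlane) :
    z ∈ P.side i ↔ P.height i z = 0 ∧ z ∈ P.region := by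
  constructor
  · intro h
    obtain ⟨a, b, ha, hb, hab⟩ := mem_seg_iff.1 h
    have hV := P.isFrame_frame
    have key (j : ZMod 5) : P.height j z =
        a * lorentz (P.frame i) (normal P.frame j)
          + b * lorentz (P.frame (i + 1)) (normal P.frame j) := by
      rw [height_eq, hab]
      simp [frame]
    refine ⟨by rw [key, hV.normal_zero, hV.normal_one]; ring, ?_⟩
    rw [mem_region_iff]
    intro j
    rw [key]
    exact add_nonneg (mul_nonneg ha (hV.lorentz_normal_nonneg _ _))
      (mul_nonneg hb (hV.lorentz_normal_nonneg _ _))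
  · rintro ⟨h0, h⟩
    rw [mem_region_iff] at h
    have := phi_lt_two
    exact mem_seg_of_combination (mul_nonneg (by linarith) (h _))
      (mul_nonneg (by linarith) (h _)) (P.vec_eq_of_height_eq_zero h0)

end Pentagon

/-! ### Reflections -/

lemma pos_of_lorentz_neg {W : ℝ × ℝ × ℝ} {z : UpperHalfPlane} (hW : lorentz W W = -1)
    (h : lorentz W (vec z) < 0) : 0 < W.2.2 := by
  by_contra hneg
  have hW2 := hW
  rw [lorentz_apply] at hW2
  have h0 : W.2.2 ≠ 0 := by
    intro h0
    rw [h0] at hW2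
    nlinarith [sq_nonneg W.2.1]
  have hneg' : 0 < (-W).2.2 := by
    have := lt_of_le_of_ne (not_lt.1 hneg) h0
    simpa using this
  obtain ⟨w, hw⟩ := exists_vec_eq (X := -W) (by simpa using hW) hneg'
  have h1 := Real.cosh_pos (dist w z)
  rw [cosh_dist_eq, hw] at h1
  simp only [map_neg, LinearMap.neg_apply, neg_neg] at h1
  linarith

lemma eq_of_forall_cosh_dist {x y : UpperHalfPlane}
    (h : ∀ w, Real.cosh (dist x w) = Real.cosh (dist y w)) : x = y := by
  have := h y
  rw [dist_self, Real.cosh_zero] at this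
  by_contra hne
  exact (one_lt_cosh_dist hne).ne' this

lemma four_phi_sub_six_pos : 0 < 4 * φ - 6 := by
  have := phi_sq
  have := one_lt_phi
  nlinarith

lemma IsFrame.lorentz_sum {V : ZMod 5 → ℝ × ℝ × ℝ} (hV : IsFrame V) (i : ZMod 5) :
    lorentz (V i) (∑ j, V j) = -(4 * φ + 3) := by
  rw [← Equiv.sum_comp (Equiv.addLeft i)]
  have h : ∑ j, V (Equiv.addLeft i j) = V (i + 0) + V (i + 1) + V (i + 2) + V (i + 3)
      + V (i + 4) := Fin.sum_univ_five (fun j : Fin 5 => V (i + (show ZMod 5 from j)))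
  rw [h, add_zero]
  simp only [map_add, hV.self, hV.side, hV.diagonal, hV.diagonal', hV.side']
  linear_combination -2 * phi_sq

namespace Pentagon

variable (P : Pentagon)

lemma exists_reflection (i : ZMod 5) (z : UpperHalfPlane) :
    ∃ w, vec w = vec z - ((4 * φ - 6) * P.height i z) • normal P.frame i := by
  have hn := P.isFrame_frame.normal_self i
  have h := P.height_eq i z
  have hz := lorentz_vec_self z
  have h2 := phi_sq
  have h6 := four_phi_sub_six_pos
  have hself : lorentz (vec z - ((4 * φ - 6) * P.height i z) • normal P.frame i)
      (vec z - ((4 * φ - 6) * P.height i z) • normal P.frame i) = -1 := by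
    simp only [map_sub, map_smul, LinearMap.sub_apply, LinearMap.smul_apply, smul_eq_mul, hn, hz,
      ← h, lorentz_comm (normal P.frame i) (vec z)]
    linear_combination (P.height i z) ^ 2 * (32 * φ - 48) * h2
  refine exists_vec_eq hself (pos_of_lorentz_neg (z := z) hself ?_)
  simp only [map_sub, map_smul, LinearMap.sub_apply, LinearMap.smul_apply, smul_eq_mul, hz,
      ← h, lorentz_comm (normal P.frame i) (vec z)]
  nlinarith [sq_nonneg (P.height i z)]

/-- The reflection in the geodesic of the `i`-th side, as a map. -/
noncomputable def reflFun (i : ZMod 5) (z : UpperHalfPlane) : UpperHalfPlane :=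
  (P.exists_reflection i z).choose

lemma vec_reflFun (i : ZMod 5) (z : UpperHalfPlane) : vec (P.reflFun i z) =
    vec z - ((4 * φ - 6) * P.height i z) • normal P.frame i :=
  (P.exists_reflection i z).choose_spec

lemma height_reflFun_self (i : ZMod 5) (z : UpperHalfPlane) :
    P.height i (P.reflFun i z) = -P.height i z := by
  rw [height_eq, vec_reflFun]
  simp only [map_sub, map_smul, LinearMap.sub_apply, LinearMap.smul_apply, smul_eq_mul,
    P.isFrame_frame.normal_self, ← height_eq]
  linear_combination (-8 * P.height i z) * phi_sq

lemma reflFun_reflFun (i : ZMod 5) (z : UpperHalfPlane) :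
    P.reflFun i (P.reflFun i z) = z := by
  apply vec_injective
  rw [vec_reflFun, vec_reflFun, height_reflFun_self, mul_neg, neg_smul]
  abel

lemma cosh_dist_reflFun (i : ZMod 5) (z w : UpperHalfPlane) :
    Real.cosh (dist (P.reflFun i z) w) =
      Real.cosh (dist z w) + (4 * φ - 6) * P.height i z * P.height i w := by
  rw [cosh_dist_eq, cosh_dist_eq, vec_reflFun]
  simp only [map_sub, map_smul, LinearMap.sub_apply, LinearMap.smul_apply, smul_eq_mul,
    lorentz_comm (normal P.frame i) (vec w), ← height_eq]
  ring

/-- The reflection in the geodesic of the `i`-th side. -/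
noncomputable def refl (i : ZMod 5) : UpperHalfPlane ≃ᵢ UpperHalfPlane where
  toFun := P.reflFun i
  invFun := P.reflFun i
  left_inv := P.reflFun_reflFun i
  right_inv := P.reflFun_reflFun i
  isometry_toFun := by
    refine Isometry.of_dist_eq fun z w => ?_
    apply Real.cosh_strictMonoOn.injOn (Set.mem_Ici.2 dist_nonneg) (Set.mem_Ici.2 dist_nonneg)
    rw [cosh_dist_reflFun, dist_comm z, cosh_dist_reflFun, height_reflFun_self, dist_comm w]
    ring

lemma vec_refl (i : ZMod 5) (z : UpperHalfPlane) : vec (P.refl i z) =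
    vec z - ((4 * φ - 6) * P.height i z) • normal P.frame i := P.vec_reflFun i z

lemma refl_refl (i : ZMod 5) (z : UpperHalfPlane) : P.refl i (P.refl i z) = z :=
  P.reflFun_reflFun i z

lemma refl_mul_refl (i : ZMod 5) : P.refl i * P.refl i = 1 :=
  IsometryEquiv.ext fun z => P.refl_refl i z

lemma cosh_dist_refl (i : ZMod 5) (z w : UpperHalfPlane) :
    Real.cosh (dist (P.refl i z) w) =
      Real.cosh (dist z w) + (4 * φ - 6) * P.height i z * P.height i w :=
  P.cosh_dist_reflFun i z w

lemma refl_of_height_eq_zero {i : ZMod 5} {z : UpperHalfPlane} (h : P.height i z = 0) :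
    P.refl i z = z := vec_injective (by rw [vec_refl, h]; simp)

lemma height_refl_self (i : ZMod 5) (z : UpperHalfPlane) :
    P.height i (P.refl i z) = -P.height i z := P.height_reflFun_self i z

lemma height_refl_of_adjacent {i j : ZMod 5} (h : j = i + 1 ∨ i = j + 1) (z : UpperHalfPlane) :
    P.height j (P.refl i z) = P.height j z := by
  rw [height_eq, height_eq, vec_refl]
  simp only [map_sub, map_smul, LinearMap.sub_apply, LinearMap.smul_apply, smul_eq_mul,
    P.isFrame_frame.normal_normal]
  rcases h with rfl | rfl
  · simp only [left_eq_add, add_assoc]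
    simp (decide := true)
  · simp only [add_eq_left]
    simp (decide := true)

lemma height_refl_of_nonadjacent {i j : ZMod 5} (h : j = i + 2 ∨ i = j + 2)
    (z : UpperHalfPlane) :
    P.height j (P.refl i z) = P.height j z + 2 * φ * P.height i z := by
  rw [height_eq, height_eq, vec_refl]
  simp only [map_sub, map_smul, LinearMap.sub_apply, LinearMap.smul_apply, smul_eq_mul,
    P.isFrame_frame.normal_normal, height_eq]
  have h2 := phi_sq
  rcases h with rfl | rfl
  · simp only [left_eq_add, add_assoc]
    simp (decide := true)
    linear_combination 12 * (lorentz (vec z) (normal P.frame i)) * h2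
  · simp only [add_eq_left, add_right_inj]
    simp (decide := true)
    linear_combination 12 * (lorentz (vec z) (normal P.frame (j + 2))) * h2

lemma refl_comm (i : ZMod 5) : P.refl i * P.refl (i + 1) = P.refl (i + 1) * P.refl i := by
  ext1 z
  apply vec_injective
  simp only [IsometryEquiv.mul_apply, vec_refl, P.height_refl_of_adjacent (Or.inl rfl),
    P.height_refl_of_adjacent (Or.inr rfl)]
  abel

/-! ### The centre and the size of a pentagon -/

lemma lorentz_frame_center (i : ZMod 5) : lorentz (P.frame i) (vec P.center) =
    -Real.cosh (dist P.center (P.vertex 0)) := by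
  rw [lorentz_comm, frame, lorentz_vec, P.center_equidistant]

/-- The centre is the rescaled sum of the vertices. -/
lemma smul_vec_center : (4 * φ + 3) • vec P.center =
    Real.cosh (dist P.center (P.vertex 0)) • ∑ i, P.frame i := by
  rw [← sub_eq_zero]
  apply P.isFrame_frame.eq_zero_of_vertex 0 <;>
  · simp only [map_sub, map_smul, smul_eq_mul, lorentz_frame_center, P.isFrame_frame.lorentz_sum]
    ring

lemma cosh_dist_center_sq :
    Real.cosh (dist P.center (P.vertex 0)) ^ 2 = (4 * φ + 3) / 5 := by
  set q := Real.cosh (dist P.center (P.vertex 0)) with hq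
  have h := congrArg (fun W => lorentz W (vec P.center)) P.smul_vec_center
  simp only [map_smul, map_sum, LinearMap.smul_apply, LinearMap.sum_apply, lorentz_frame_center,
    smul_eq_mul, lorentz_vec_self, Finset.sum_const] at h
  have h5 : (Finset.univ : Finset (ZMod 5)).card = 5 := rfl
  rw [h5, ← hq] at h
  simp only [nsmul_eq_mul, Nat.cast_ofNat] at h
  linarith

lemma cosh_dist_center_eq : Real.cosh (dist P.center (P.vertex 0)) = √((4 * φ + 3) / 5) := by
  rw [← cosh_dist_center_sq, Real.sqrt_sq (Real.cosh_pos _).le]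

lemma center_eq_of_sum_eq {P Q : Pentagon} (h : ∑ i, P.frame i = ∑ i, Q.frame i) :
    P.center = Q.center := by
  have hP := P.smul_vec_center
  rw [h, cosh_dist_center_eq, ← Q.cosh_dist_center_eq, ← Q.smul_vec_center] at hP
  have := phi_pos
  exact vec_injective (smul_right_injective _ (by positivity) hP)

lemma height_center (i : ZMod 5) :
    P.height i P.center = Real.cosh (dist P.center (P.vertex 0)) := by
  simp only [height, P.center_equidistant]
  ring

lemma height_center_pos (i : ZMod 5) : 0 < P.height i P.center := by
  rw [height_center]
  exact Real.cosh_pos _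

lemma center_mem_region : P.center ∈ P.region := by
  rw [mem_region_iff]
  exact fun i => (P.height_center_pos i).le

/-- A positive number smaller than the radius of the inscribed circle. -/
noncomputable def innerRadius : ℝ := Real.arcosh (4 * φ - 5) / 2

lemma innerRadius_pos : 0 < innerRadius :=
  half_pos (Real.arcosh_pos (by linarith [four_phi_sub_six_pos]))

lemma height_pos_of_dist_lt {z : UpperHalfPlane} (h : dist z P.center < innerRadius)
    (i : ZMod 5) : 0 < P.height i z := by
  by_contra hneg
  have h6 := four_phi_sub_six_pos
  have hq := P.height_center i
  have hq1 := Real.one_le_cosh (dist P.center (P.vertex 0))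
  have h1 : dist (P.refl i P.center) z ≤ dist z P.center := by
    have h2 : Real.cosh (dist (P.refl i P.center) z) ≤ Real.cosh (dist z P.center) := by
      rw [cosh_dist_refl, dist_comm P.center, mul_assoc]
      have : P.height i P.center * P.height i z ≤ 0 :=
        mul_nonpos_of_nonneg_of_nonpos (P.height_center_pos i).le (not_lt.1 hneg)
      nlinarith
    rwa [Real.cosh_le_cosh, abs_of_nonneg dist_nonneg, abs_of_nonneg dist_nonneg] at h2
  have h2 : Real.arcosh (4 * φ - 5) ≤ dist (P.refl i P.center) P.center := by
    rw [← Real.arcosh_cosh (x := dist _ _) dist_nonneg]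
    rw [Real.arcosh_le_arcosh (by linarith) (Real.cosh_pos _), cosh_dist_refl, dist_self,
      Real.cosh_zero, hq]
    nlinarith [mul_nonneg h6.le (mul_nonneg (sub_nonneg.2 hq1) (sub_nonneg.2 hq1))]
  have h3 := dist_triangle (P.refl i P.center) z P.center
  rw [innerRadius] at h
  linarith

/-- The coordinates of a point of the pentagon with respect to the vectors of three consecutive
vertices have sum at most one. The centre has the same product with all vertices, so this bounds the
distance of the point from the centre. -/
lemma sum_coeff_le_one {a b c : ℝ} (ha : 0 ≤ a) (hc : 0 ≤ c) (h1 : 0 ≤ φ * a + b)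
    (h2 : 0 ≤ b + φ * c) (h3 : 0 ≤ a + φ * b + c)
    (h : a ^ 2 + b ^ 2 + c ^ 2 + 2 * φ * (a * b + b * c) + 2 * (φ + 1) * (a * c) = 1) :
    a + b + c ≤ 1 := by
  have p2 := phi_sq
  have p1 := one_lt_phi
  have p3 := phi_lt_two
  have key : (a + b + c) ^ 2 + 2 * ((φ - 1) * (b * (a + c)) + φ * (a * c)) = 1 := by
    linear_combination h
  have : 0 ≤ (φ - 1) * (b * (a + c)) + φ * (a * c) := by
    rcases le_or_gt 0 b with hb | hb
    · have : 0 ≤ (φ - 1) * (b * (a + c)) := by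
        apply mul_nonneg <;> nlinarith
      have : 0 ≤ φ * (a * c) := by positivity
      linarith
    · have e : (φ - 1) * (b * (a + c)) + φ * (a * c) =
          (φ - 1) * ((φ * a + b) * (φ * c + b)) + (2 - φ) * (-b) * (a + φ * b + c) := by
        linear_combination (-b * a - b * c - φ * a * c - b ^ 2) * p2
      rw [e]
      have : 0 ≤ (φ - 1) * ((φ * a + b) * (φ * c + b)) :=
        mul_nonneg (by linarith) (mul_nonneg h1 (by linarith))
      have : 0 ≤ (2 - φ) * (-b) * (a + φ * b + c) :=
        mul_nonneg (mul_nonneg (by linarith) (by linarith)) h3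
      linarith
  nlinarith

lemma cosh_dist_center_le_two {z : UpperHalfPlane} (h : z ∈ P.region) :
    Real.cosh (dist P.center z) ≤ 2 := by
  rw [mem_region_iff] at h
  have hV := P.isFrame_frame
  have p2 := phi_sq
  have p1 := one_lt_phi
  set a := (2 - φ) * P.height 1 z with ha
  set c := (2 - φ) * P.height 0 z with hc
  set b := (2 - φ) * P.height 4 z - φ * c with hb
  have e : vec z - (a • P.frame 0 + b • P.frame (0 + 1) + c • P.frame (0 + 2)) = 0 := by
    apply hV.eq_zero_of_normal 0 <;> rw [lorentz_comm] <;>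
      simp only [map_sub, map_add, map_smul, smul_eq_mul, LinearMap.sub_apply,
        LinearMap.add_apply, LinearMap.smul_apply, hV.lorentz_normal, ← height_eq, zero_add] <;>
      simp (decide := true) only [if_true, if_false]
    · rw [hc]; linear_combination (P.height 0 z) * p2
    · rw [ha]; linear_combination (P.height 1 z) * p2
    · rw [hb, hc]; linear_combination (P.height 4 z) * p2 + (2 - φ) * P.height 0 z * p2
  rw [sub_eq_zero] at e
  simp only [zero_add] at e
  have hh (i : ZMod 5) : P.height i z = a * lorentz (P.frame 0) (normal P.frame i)
      + b * lorentz (P.frame 1) (normal P.frame i)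
      + c * lorentz (P.frame 2) (normal P.frame i) := by
    rw [height_eq, e]
    simp
  have h2 := hh 2
  have h3 := hh 3
  have h4 := hh 4
  simp only [hV.lorentz_normal] at h2 h3 h4
  simp (decide := true) only [if_true, if_false] at h2 h3 h4
  have hsum : a + b + c ≤ 1 := by
    apply sum_coeff_le_one
    · exact mul_nonneg (by linarith [phi_lt_two]) (h 1)
    · exact mul_nonneg (by linarith [phi_lt_two]) (h 0)
    · have := h 2
      rw [h2] at this
      have e : a * (2 * φ + 1) + b * (φ + 1) + c * 0 = (φ + 1) * (φ * a + b) := by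
        linear_combination -a * p2
      rw [e] at this
      exact nonneg_of_mul_nonneg_right this (by linarith)
    · have := h 4
      rw [h4] at this
      have e : a * 0 + b * (φ + 1) + c * (2 * φ + 1) = (φ + 1) * (b + φ * c) := by
        linear_combination -c * p2
      rw [e] at this
      exact nonneg_of_mul_nonneg_right this (by linarith)
    · have := h 3
      rw [h3] at this
      have e : a * (φ + 1) + b * (2 * φ + 1) + c * (φ + 1) = (φ + 1) * (a + φ * b + c) := by
        linear_combination -b * p2
      rw [e] at this
      exact nonneg_of_mul_nonneg_right this (by linarith)
    · have hz := lorentz_vec_self z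
      rw [e] at hz
      simp only [map_add, map_smul, smul_eq_mul, LinearMap.add_apply, LinearMap.smul_apply,
        hV.gram] at hz
      simp (decide := true) only [if_true, if_false] at hz
      linear_combination -hz - 2 * a * c * p2
  have hq := P.cosh_dist_center_sq
  have hq1 := Real.one_le_cosh (dist P.center (P.vertex 0))
  have := phi_lt_two
  rw [cosh_dist_eq, lorentz_comm, e]
  simp only [map_add, map_smul, smul_eq_mul, LinearMap.add_apply, LinearMap.smul_apply,
    lorentz_frame_center]
  nlinarith

end Pentagon

/-! ### Isometric images of pentagons -/

lemma mem_seg_map (g : UpperHalfPlane ≃ᵢ UpperHalfPlane) {x y z : UpperHalfPlane} :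
    g z ∈ seg (g x) (g y) ↔ z ∈ seg x y := by
  simp [seg, g.dist_eq]

lemma mem_line_map (g : UpperHalfPlane ≃ᵢ UpperHalfPlane) {p q z : UpperHalfPlane} :
    g z ∈ line (g p) (g q) ↔ z ∈ line p q := by
  simp [line, mem_seg_map]

/-- The image of a pentagon under an isometry, with the vertices listed in the same order. -/
noncomputable def Pentagon.map (g : UpperHalfPlane ≃ᵢ UpperHalfPlane) (P : Pentagon) :
    Pentagon where
  vertex i := g (P.vertex i)
  center := g P.center
  convex i j h h' := by
    rw [Set.disjoint_left]
    intro z hz hz'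
    obtain ⟨w, rfl⟩ := g.surjective z
    rw [mem_seg_map] at hz
    rw [mem_line_map] at hz'
    exact Set.disjoint_left.1 (P.convex i j h h') hz hz'
  equilateral i := by simp only [g.dist_eq, P.equilateral i]
  right_angled i := by
    rw [hypAngle_eq_pi_div_two_iff]
    simp only [g.dist_eq]
    rw [← hypAngle_eq_pi_div_two_iff, P.right_angled]
  center_equidistant i := by simp only [g.dist_eq, P.center_equidistant i]

namespace Pentagon

variable (P : Pentagon) (g : UpperHalfPlane ≃ᵢ UpperHalfPlane)

@[simp] lemma map_vertex (i : ZMod 5) : (P.map g).vertex i = g (P.vertex i) := rfl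

lemma height_map (i : ZMod 5) (z : UpperHalfPlane) :
    (P.map g).height i (g z) = P.height i z := by
  simp [height, g.dist_eq]

lemma mem_region_map {z : UpperHalfPlane} : g z ∈ (P.map g).region ↔ z ∈ P.region := by
  simp [mem_region_iff, height_map]

lemma mem_side_map {i : ZMod 5} {z : UpperHalfPlane} :
    g z ∈ (P.map g).side i ↔ z ∈ P.side i := mem_seg_map g

lemma refl_map (i : ZMod 5) (z : UpperHalfPlane) :
    (P.map g).refl i (g z) = g (P.refl i z) := by
  apply eq_of_forall_cosh_dist
  intro w
  obtain ⟨w, rfl⟩ := g.surjective w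
  rw [cosh_dist_refl, height_map, height_map, g.dist_eq, g.dist_eq, cosh_dist_refl]

lemma map_mul (h : UpperHalfPlane ≃ᵢ UpperHalfPlane) : P.map (g * h) = (P.map h).map g := rfl

/-! ### The interior of a pentagon -/

lemma exists_dist_lt_height_neg {i : ZMod 5} {z : UpperHalfPlane} (h : P.height i z = 0) {ε : ℝ}
    (hε : 0 < ε) : ∃ w, dist z w < ε ∧ P.height i w < 0 := by
  have hn := P.isFrame_frame.normal_self i
  have hp := phi_pos
  have hz := lorentz_vec_self z
  have hzn := h
  rw [height_eq] at hzn
  set n := normal P.frame i with hnd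
  set r := √(2 * φ + 1) with hr
  have hr0 : 0 < r := by positivity
  have hr2 : r ^ 2 = 2 * φ + 1 := Real.sq_sqrt (by positivity)
  set t := ε / 2 with ht
  have ht0 : 0 < t := by positivity
  have hs : 0 < Real.sinh t := Real.sinh_pos_iff.2 ht0
  have hcs := Real.cosh_sq' t
  have hself : lorentz (Real.cosh t • vec z - (Real.sinh t / r) • n)
      (Real.cosh t • vec z - (Real.sinh t / r) • n) = -1 := by
    simp only [map_sub, map_smul, LinearMap.sub_apply, LinearMap.smul_apply, smul_eq_mul, hn, hz,
      hzn, lorentz_comm n (vec z)]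
    rw [← hr2]
    field_simp
    linear_combination (-r) * hcs
  have hlz : lorentz (Real.cosh t • vec z - (Real.sinh t / r) • n) (vec z) = -Real.cosh t := by
    simp only [map_sub, map_smul, LinearMap.sub_apply, LinearMap.smul_apply, smul_eq_mul, hz,
      hzn, lorentz_comm n (vec z)]
    ring
  obtain ⟨w, hw⟩ := exists_vec_eq hself (pos_of_lorentz_neg (z := z) hself
    (by rw [hlz]; linarith [Real.cosh_pos t]))
  refine ⟨w, ?_, ?_⟩
  · have h1 : Real.cosh (dist w z) = Real.cosh t := by rw [cosh_dist_eq, hw, hlz, neg_neg]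
    have h2 := Real.cosh_strictMonoOn.injOn (Set.mem_Ici.2 dist_nonneg) (Set.mem_Ici.2 ht0.le) h1
    rw [dist_comm, h2, ht]
    linarith
  · rw [height_eq, hw]
    simp only [map_sub, map_smul, LinearMap.sub_apply, LinearMap.smul_apply, smul_eq_mul, ← hnd,
      hn, hzn]
    have : 0 < Real.sinh t / r * (2 * φ + 1) := by positivity
    linarith

lemma height_pos_of_mem_interior {z : UpperHalfPlane} (h : z ∈ interior P.region) (i : ZMod 5) :
    0 < P.height i z := by
  have hz := (P.mem_region_iff z).1 (interior_subset h) i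
  refine hz.lt_of_ne fun h0 => ?_
  obtain ⟨ε, hε, hball⟩ := Metric.isOpen_iff.1 isOpen_interior z h
  obtain ⟨w, hw, hw'⟩ := P.exists_dist_lt_height_neg h0.symm hε
  have := (P.mem_region_iff w).1 (interior_subset (hball (by rwa [Metric.mem_ball, dist_comm]))) i
  linarith

lemma isClosed_region : IsClosed P.region := by
  have : P.region = ⋂ i, {z | 0 ≤ P.height i z} := by
    ext z; simp [mem_region_iff]
  rw [this]
  refine isClosed_iInter fun i => isClosed_le continuous_const ?_
  unfold height
  have := Real.continuous_cosh
  fun_prop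

end Pentagon

/-- A uniformly separated family of points is locally finite. -/
lemma finite_dist_le {ι : Type*} {f : ι → UpperHalfPlane} {δ : ℝ} (hδ : 0 < δ)
    (hf : ∀ i j, i ≠ j → δ ≤ dist (f i) (f j)) (x : UpperHalfPlane) (R : ℝ) :
    {i | dist x (f i) ≤ R}.Finite := by
  obtain ⟨t, -, ht, hcover⟩ := finite_cover_balls_of_compact
    (isCompact_closedBall x R) (half_pos hδ)
  refine (ht.biUnion (t := fun y => {i | dist (f i) y < δ / 2}) fun y _ => ?_).subset ?_
  · refine Set.Subsingleton.finite fun i hi j hj => ?_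
    by_contra hij
    have := hf i j hij
    have := dist_triangle_right (f i) (f j) y
    simp only [Set.mem_ofPred_eq] at hi hj
    linarith
  · intro i hi
    have : f i ∈ Metric.closedBall x R := by rwa [Metric.mem_closedBall, dist_comm]
    simpa using hcover this

/-! ### The group generated by the reflections in the sides -/

namespace Pentagon

variable (P : Pentagon)

/-- The group generated by the reflections in the sides of `P`. -/
noncomputable def group : Subgroup (UpperHalfPlane ≃ᵢ UpperHalfPlane) :=
  Subgroup.closure (Set.range P.refl)

/-- The reflection in the `i`-th side, as an element of the reflection group. -/
noncomputable def gen (i : ZMod 5) : P.group :=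
  ⟨P.refl i, Subgroup.subset_closure ⟨i, rfl⟩⟩

variable {P}

lemma gen_mul_gen (i : ZMod 5) : P.gen i * P.gen i = 1 := Subtype.ext (P.refl_mul_refl i)

lemma gen_inv (i : ZMod 5) : (P.gen i)⁻¹ = P.gen i := inv_eq_of_mul_eq_one_left (gen_mul_gen i)

@[simp] lemma gen_mul_gen_mul (i : ZMod 5) (g : P.group) : P.gen i * (P.gen i * g) = g := by
  rw [← mul_assoc, gen_mul_gen, one_mul]

@[simp] lemma mul_gen_mul_gen (i : ZMod 5) (g : P.group) : g * P.gen i * P.gen i = g := by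
  rw [mul_assoc, gen_mul_gen, mul_one]

lemma gen_comm (i : ZMod 5) : P.gen i * P.gen (i + 1) = P.gen (i + 1) * P.gen i :=
  Subtype.ext (P.refl_comm i)

lemma gen_comm_of_adjacent {i j : ZMod 5} (h : j = i + 1 ∨ i = j + 1) :
    P.gen i * P.gen j = P.gen j * P.gen i := by
  rcases h with rfl | rfl
  · exact gen_comm i
  · exact (gen_comm j).symm

lemma exists_word (g : P.group) : ∃ w : List (ZMod 5), (w.map P.gen).prod = g := by
  obtain ⟨g, hg⟩ := g
  induction hg using Subgroup.closure_induction with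
  | mem x hx =>
    obtain ⟨i, rfl⟩ := hx
    exact ⟨[i], by simp; rfl⟩
  | one => exact ⟨[], rfl⟩
  | mul x y hx hy ihx ihy =>
    obtain ⟨v, hv⟩ := ihx
    obtain ⟨w, hw⟩ := ihy
    exact ⟨v ++ w, by rw [List.map_append, List.prod_append, hv, hw]; rfl⟩
  | inv x hx ih =>
    obtain ⟨w, hw⟩ := ih
    refine ⟨w.reverse, ?_⟩
    have h : ∀ w : List (ZMod 5), (w.reverse.map P.gen).prod = ((w.map P.gen).prod)⁻¹ := by
      intro w
      induction w with
      | nil => simp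
      | cons i w ih =>
        rw [List.reverse_cons, List.map_append, List.prod_append, ih]
        simp [gen_inv]
    rw [h, hw]
    rfl

/-- The word length of an element of the reflection group. -/
noncomputable def length (g : P.group) : ℕ :=
  sInf {n | ∃ w : List (ZMod 5), w.length = n ∧ (w.map P.gen).prod = g}

lemma length_prod_le (w : List (ZMod 5)) : length (w.map P.gen).prod ≤ w.length :=
  Nat.sInf_le ⟨w, rfl, rfl⟩

lemma exists_reduced_word (g : P.group) :
    ∃ w : List (ZMod 5), w.length = length g ∧ (w.map P.gen).prod = g := by
  have : {n | ∃ w : List (ZMod 5), w.length = n ∧ (w.map P.gen).prod = g}.Nonempty := by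
    obtain ⟨w, hw⟩ := exists_word g
    exact ⟨_, w, rfl, hw⟩
  exact Nat.sInf_mem this

lemma length_gen_mul_le (i : ZMod 5) (g : P.group) : length (P.gen i * g) ≤ length g + 1 := by
  obtain ⟨w, hw, rfl⟩ := exists_reduced_word g
  rw [← hw]
  exact length_prod_le (i :: w)

lemma length_one : length (1 : P.group) = 0 := Nat.le_zero.1 (length_prod_le [])

lemma eq_one_of_length_eq_zero {g : P.group} (h : length g = 0) : g = 1 := by
  obtain ⟨w, hw, rfl⟩ := exists_reduced_word g
  rw [h, List.length_eq_zero_iff] at hw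
  simp [hw]

lemma exists_eq_gen_mul {g : P.group} {n : ℕ} (h : length g = n + 1) :
    ∃ i k, g = P.gen i * k ∧ length k = n := by
  obtain ⟨w, hw, rfl⟩ := exists_reduced_word g
  rw [h] at hw
  obtain ⟨i, w, rfl⟩ := List.exists_cons_of_length_eq_add_one hw
  refine ⟨i, (w.map P.gen).prod, by simp, ?_⟩
  have h1 := length_prod_le (P := P) w
  have h2 := length_gen_mul_le i (w.map P.gen).prod
  simp only [List.map_cons, List.prod_cons] at h
  simp only [List.length_cons] at hw
  omega

lemma gen_mul_apply (i : ZMod 5) (g : P.group) (z : UpperHalfPlane) :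
    (P.gen i * g).1 z = P.refl i (g.1 z) := rfl

lemma eq_or_adjacent_or_nonadjacent : ∀ i j : ZMod 5,
    j = i ∨ (j = i + 1 ∨ i = j + 1) ∨ (j = i + 2 ∨ i = j + 2) := by decide

lemma height_add_height_pos_of_nonadjacent {i j : ZMod 5} (h : j = i + 2 ∨ i = j + 2)
    (z : UpperHalfPlane) : 0 < P.height i z + P.height j z := by
  rcases h with rfl | rfl
  · exact P.height_add_height_pos i z
  · rw [add_comm]; exact P.height_add_height_pos j z

/-- The image `g P` lies on one side of the geodesic of every side of `P`, and it lies beyond the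
geodesic only if multiplying by the reflection shortens `g`. -/
lemma side_dichotomy (n : ℕ) : ∀ g : P.group, length g = n → ∀ i : ZMod 5,
    (∀ x ∈ P.region, 0 ≤ P.height i (g.1 x) ∧
      ((∀ k, 0 < P.height k x) → 0 < P.height i (g.1 x))) ∨
    ((∀ x ∈ P.region, P.height i (g.1 x) ≤ 0 ∧
      ((∀ k, 0 < P.height k x) → P.height i (g.1 x) < 0)) ∧
        length (P.gen i * g) < length g) := by
  induction n with
  | zero =>
    intro g hg i
    rw [eq_one_of_length_eq_zero hg]
    exact Or.inl fun x hx => ⟨(P.mem_region_iff x).1 hx i, fun h => h i⟩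
  | succ n ih =>
    intro g hg i
    obtain ⟨j, k, rfl, hk⟩ := exists_eq_gen_mul hg
    have hj := (ih k hk j).resolve_right (fun h => by have := h.2; omega)
    have hp := one_lt_phi
    rcases eq_or_adjacent_or_nonadjacent j i with rfl | hij | hij
    · refine Or.inr ⟨fun x hx => ?_, by rw [gen_mul_gen_mul, hg, hk]; omega⟩
      obtain ⟨h1, h2⟩ := hj x hx
      rw [gen_mul_apply, height_refl_self]
      exact ⟨by linarith, fun h => by linarith [h2 h]⟩
    · rcases ih k hk i with h | ⟨h, hlt⟩
      · refine Or.inl fun x hx => ?_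
        rw [gen_mul_apply, height_refl_of_adjacent P hij]
        exact h x hx
      · refine Or.inr ⟨fun x hx => ?_, ?_⟩
        · rw [gen_mul_apply, height_refl_of_adjacent P hij]
          exact h x hx
        · rw [← mul_assoc, ← gen_comm_of_adjacent hij, mul_assoc]
          have := length_gen_mul_le j (P.gen i * k)
          omega
    · refine Or.inl fun x hx => ?_
      have h1 := (hj x hx).1
      have h2 := height_add_height_pos_of_nonadjacent (P := P) hij (k.1 x)
      rw [gen_mul_apply, height_refl_of_nonadjacent P hij]
      have h3 : 0 < P.height i (k.1 x) + 2 * φ * P.height j (k.1 x) := by nlinarith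
      exact ⟨h3.le, fun _ => h3⟩

lemma length_gen_mul_of_neg {g : P.group} {i : ZMod 5} (h : P.height i (g.1 P.center) < 0) :
    length (P.gen i * g) + 1 = length g := by
  rcases side_dichotomy _ g rfl i with h1 | ⟨-, h1⟩
  · linarith [(h1 _ P.center_mem_region).1]
  · have := length_gen_mul_le i (P.gen i * g)
    rw [gen_mul_gen_mul] at this
    omega

lemma length_gen_mul_of_pos {g : P.group} {i : ZMod 5} (h : 0 < P.height i (g.1 P.center)) :
    length (P.gen i * g) = length g + 1 := by
  have := length_gen_mul_of_neg (g := P.gen i * g) (i := i)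
    (by rw [gen_mul_apply, height_refl_self]; linarith)
  rw [gen_mul_gen_mul] at this
  exact this.symm

lemma height_ne_zero (g : P.group) (i : ZMod 5) : P.height i (g.1 P.center) ≠ 0 := by
  rcases side_dichotomy _ g rfl i with h | ⟨h, -⟩
  · exact ((h _ P.center_mem_region).2 P.height_center_pos).ne'
  · exact ((h _ P.center_mem_region).2 P.height_center_pos).ne

lemma height_nonpos_of_neg {g : P.group} {i : ZMod 5} (h : P.height i (g.1 P.center) < 0)
    {x : UpperHalfPlane} (hx : x ∈ P.region) : P.height i (g.1 x) ≤ 0 := by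
  rcases side_dichotomy _ g rfl i with h1 | ⟨h1, -⟩
  · linarith [(h1 _ P.center_mem_region).1]
  · exact (h1 x hx).1

lemma exists_height_neg {g : P.group} (h : g ≠ 1) : ∃ i, P.height i (g.1 P.center) < 0 := by
  have h0 : length g ≠ 0 := fun h0 => h (eq_one_of_length_eq_zero h0)
  obtain ⟨n, hn⟩ := Nat.exists_eq_succ_of_ne_zero h0
  obtain ⟨i, k, rfl, hk⟩ := exists_eq_gen_mul hn
  refine ⟨i, ?_⟩
  by_contra hneg
  have := length_gen_mul_of_pos (g := P.gen i * k) (i := i)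
    (lt_of_le_of_ne (not_lt.1 hneg) (height_ne_zero _ _).symm)
  rw [gen_mul_gen_mul] at this
  omega

/-- The pentagon is a strict fundamental domain of the reflection group. -/
lemma apply_eq_self {x : UpperHalfPlane} (hx : x ∈ P.region) :
    ∀ (n : ℕ) (g : P.group), length g = n → g.1 x ∈ P.region → g.1 x = x := by
  intro n
  induction n with
  | zero =>
    intro g hg _
    rw [eq_one_of_length_eq_zero hg]
    rfl
  | succ n ih =>
    intro g hg hgx
    have hg1 : g ≠ 1 := by
      rintro rfl
      rw [length_one] at hg
      omega
    obtain ⟨i, hi⟩ := exists_height_neg hg1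
    have h0 : P.height i (g.1 x) = 0 :=
      le_antisymm (height_nonpos_of_neg hi hx) ((P.mem_region_iff _).1 hgx i)
    have h1 : (P.gen i * g).1 x = g.1 x := by
      rw [gen_mul_apply, refl_of_height_eq_zero P h0]
    rw [← h1]
    apply ih
    · have := length_gen_mul_of_neg hi
      omega
    · rwa [h1]

lemma innerRadius_le_dist {g h : P.group} (hne : g ≠ h) :
    innerRadius ≤ dist (g.1 P.center) (h.1 P.center) := by
  by_contra hlt
  have hne' : g⁻¹ * h ≠ 1 := fun h1 => hne (inv_mul_eq_one.1 h1)
  obtain ⟨i, hi⟩ := exists_height_neg hne'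
  have : 0 < P.height i ((g⁻¹ * h).1 P.center) := by
    apply P.height_pos_of_dist_lt
    rw [dist_comm, ← g.1.dist_eq]
    have e : g.1 ((g⁻¹ * h).1 P.center) = h.1 P.center := by
      change (g * (g⁻¹ * h)).1 P.center = _
      rw [mul_inv_cancel_left]
    rw [e]
    exact not_le.1 hlt
  linarith

/-- The images of the pentagon under the reflection group cover the plane. -/
lemma exists_mem_region_map (z : UpperHalfPlane) : ∃ g : P.group, z ∈ (P.map g.1).region := by
  have hfin := finite_dist_le (f := fun g : P.group => g.1 P.center) innerRadius_pos
    (fun g h hne => innerRadius_le_dist hne) z (dist z P.center)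
  obtain ⟨g, hg, hmin⟩ := Set.exists_min_image _ (fun g : P.group => dist z (g.1 P.center)) hfin
    ⟨1, le_refl (dist z P.center)⟩
  refine ⟨g, ?_⟩
  obtain ⟨y, rfl⟩ := g.1.surjective z
  rw [mem_region_map, mem_region_iff]
  intro i
  by_contra hneg
  have hlt : dist (g.1 y) ((g * P.gen i).1 P.center) < dist (g.1 y) (g.1 P.center) := by
    change dist (g.1 y) (g.1 (P.refl i P.center)) < _
    rw [g.1.dist_eq, g.1.dist_eq, dist_comm y, dist_comm y]
    have h1 : Real.cosh (dist (P.refl i P.center) y) < Real.cosh (dist P.center y) := by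
      rw [cosh_dist_refl]
      have : 0 < (4 * φ - 6) * P.height i P.center * -P.height i y :=
        mul_pos (mul_pos four_phi_sub_six_pos (P.height_center_pos i)) (by linarith)
      linarith
    rwa [Real.cosh_lt_cosh, abs_of_nonneg dist_nonneg, abs_of_nonneg dist_nonneg] at h1
  have := hmin (g * P.gen i) (hlt.le.trans hg)
  linarith

end Pentagon

/-! ### Existence of a regular right-angled pentagon -/

lemma exists_pentagon_of_isFrame {v : ZMod 5 → UpperHalfPlane} (hV : IsFrame fun i => vec (v i)) :
    ∃ P : Pentagon, P.vertex = v := by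
  have hp := phi_pos
  have hp1 := one_lt_phi
  have hsum := hV.lorentz_sum
  set S := ∑ j, vec (v j) with hS
  have hSS : lorentz S S = -(5 * (4 * φ + 3)) := by
    have hSW (W : ℝ × ℝ × ℝ) : lorentz S W = ∑ j, lorentz (vec (v j)) W := by
      rw [hS, map_sum, LinearMap.sum_apply]
    simp only [hSW, hsum]
    rw [Finset.sum_const, show (Finset.univ : Finset (ZMod 5)).card = 5 from rfl, nsmul_eq_mul]
    push_cast; ring
  set r := √(5 * (4 * φ + 3)) with hr
  have hr0 : 0 < r := by positivity
  have hr2 : r ^ 2 = 5 * (4 * φ + 3) := Real.sq_sqrt (by positivity)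
  have hself : lorentz ((1 / r) • S) ((1 / r) • S) = -1 := by
    simp only [map_smul, LinearMap.smul_apply, smul_eq_mul, hSS]
    rw [← hr2]
    field_simp
  obtain ⟨c, hc⟩ := exists_vec_eq hself (pos_of_lorentz_neg (z := v 0) hself (by
    rw [lorentz_comm]
    simp only [map_smul, smul_eq_mul, hsum]
    have : 0 < 1 / r * (4 * φ + 3) := by positivity
    linarith))
  have hne (i : ZMod 5) : v i ≠ v (i + 1) := by
    intro h
    have h1 := hV.side i
    simp only [← h, lorentz_vec_self] at h1
    linarith
  have hL (i : ZMod 5) (z : UpperHalfPlane) : z ∈ line (v i) (v (i + 1)) ↔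
      lorentz (vec z) (normal (fun i => vec (v i)) i) = 0 := by
    apply mem_line_iff (hne i)
    · rw [hV.normal_self]; positivity
    · exact hV.normal_zero i
    · exact hV.normal_one i
  have hcosh (i : ZMod 5) : Real.cosh (dist (v i) (v (i + 1))) = φ := by
    rw [cosh_dist_eq, hV.side i, neg_neg]
  have hcosh2 (i : ZMod 5) : Real.cosh (dist (v i) (v (i + 2))) = φ ^ 2 := by
    rw [cosh_dist_eq, hV.diagonal i, neg_neg]
  have heq {a b c d : UpperHalfPlane}
      (h : Real.cosh (dist a b) = Real.cosh (dist c d)) : dist a b = dist c d :=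
    Real.cosh_strictMonoOn.injOn (Set.mem_Ici.2 dist_nonneg) (Set.mem_Ici.2 dist_nonneg) h
  refine ⟨⟨v, c, fun i j h h' => ?_, fun i => heq ?_, fun i => ?_, fun i => heq ?_⟩, rfl⟩
  · rw [disjoint_seg_iff (hL i)]
    apply mul_pos
    · exact hV.lorentz_normal_pos h h'
    · rw [hV.normal_three]; positivity
  · rw [hcosh, ← hcosh 0, zero_add]
  · rw [hypAngle_eq_pi_div_two_iff]
    have e1 := hcosh (i - 1)
    have e2 := hcosh2 (i - 1)
    rw [show i - 1 + 2 = i + 1 by ring] at e2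
    rw [sub_add_cancel, dist_comm] at e1
    rw [e1, e2, hcosh, pow_two]
  · rw [cosh_dist_eq, cosh_dist_eq, hc, lorentz_comm, lorentz_comm _ (vec (v 0))]
    simp only [map_smul, hsum]

/-- The standard frame has the vertex `0` at the origin of the hyperboloid and the two sides at this
vertex along coordinate axes. -/
noncomputable def standardFrame : ZMod 5 → ℝ × ℝ × ℝ :=
  ![(1, 0, 1), (φ + √φ, 0, φ - √φ), (φ + 1 + φ * √φ, √φ, φ + 1 - φ * √φ),
    (φ + 1 + √φ, φ * √φ, φ + 1 - √φ), (φ, √φ, φ)]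

lemma isFrame_standardFrame : IsFrame standardFrame := by
  have f0 : standardFrame 0 = (1, 0, 1) := rfl
  have f1 : standardFrame 1 = (φ + √φ, 0, φ - √φ) := rfl
  have f2 : standardFrame 2 = (φ + 1 + φ * √φ, √φ, φ + 1 - φ * √φ) := rfl
  have f3 : standardFrame 3 = (φ + 1 + √φ, φ * √φ, φ + 1 - √φ) := rfl
  have f4 : standardFrame 4 = (φ, √φ, φ) := rfl
  have hr : √φ ^ 2 = φ := Real.sq_sqrt phi_pos.le
  have h2 := phi_sq
  generalize √φ = r at *
  have hi : ∀ i : ZMod 5, i = 0 ∨ i = 1 ∨ i = 2 ∨ i = 3 ∨ i = 4 := by decide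
  refine ⟨fun i => ?_, fun i => ?_, fun i => ?_⟩ <;>
    rcases hi i with rfl | rfl | rfl | rfl | rfl
  · simp only [f0, lorentz_apply]; grind
  · simp only [f1, lorentz_apply]; grind
  · simp only [f2, lorentz_apply]; grind
  · simp only [f3, lorentz_apply]; grind
  · simp only [f4, lorentz_apply]; grind
  · rw [show (0 : ZMod 5) + 1 = 1 by decide]; simp only [f0, f1, lorentz_apply]; grind
  · rw [show (1 : ZMod 5) + 1 = 2 by decide]; simp only [f1, f2, lorentz_apply]; grind
  · rw [show (2 : ZMod 5) + 1 = 3 by decide]; simp only [f2, f3, lorentz_apply]; grind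
  · rw [show (3 : ZMod 5) + 1 = 4 by decide]; simp only [f3, f4, lorentz_apply]; grind
  · rw [show (4 : ZMod 5) + 1 = 0 by decide]; simp only [f4, f0, lorentz_apply]; grind
  · rw [show (0 : ZMod 5) + 2 = 2 by decide]; simp only [f0, f2, lorentz_apply]; grind
  · rw [show (1 : ZMod 5) + 2 = 3 by decide]; simp only [f1, f3, lorentz_apply]; grind
  · rw [show (2 : ZMod 5) + 2 = 4 by decide]; simp only [f2, f4, lorentz_apply]; grind
  · rw [show (3 : ZMod 5) + 2 = 0 by decide]; simp only [f3, f0, lorentz_apply]; grind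
  · rw [show (4 : ZMod 5) + 2 = 1 by decide]; simp only [f4, f1, lorentz_apply]; grind

theorem exists_pentagon : Nonempty Pentagon := by
  have hr : √φ ^ 2 = φ := Real.sq_sqrt phi_pos.le
  have hlt : √φ < φ := by
    rw [Real.sqrt_lt' phi_pos]
    nlinarith [one_lt_phi]
  have hpos : ∀ i, 0 < (standardFrame i).2.2 := by
    have h2 := phi_sq
    have h1 := one_lt_phi
    intro i
    fin_cases i <;> simp [standardFrame]
    · exact h1
    · nlinarith
    · linarith
    · linarith
  have hF := isFrame_standardFrame
  choose v hv using fun i => exists_vec_eq (hF.self i) (hpos i)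
  obtain ⟨P, -⟩ := exists_pentagon_of_isFrame (v := v) (by simpa only [hv] using hF)
  exact ⟨P⟩

/-! ### The tiling generated by the reflections -/

namespace Pentagon

variable {P : Pentagon}

lemma eq_vertex_of_height_eq_zero {i : ZMod 5} {z : UpperHalfPlane} (h : P.height i z = 0)
    (h' : P.height (i + 1) z = 0) : z = P.vertex (i + 1) := by
  have hz := P.vec_eq_of_height_eq_zero h
  rw [h', mul_zero, zero_smul, zero_add] at hz
  set t := (2 - φ) * P.height (i + 4) z
  have h1 := lorentz_vec_self z
  rw [hz] at h1
  simp only [map_smul, LinearMap.smul_apply, smul_eq_mul, P.isFrame_frame.self] at h1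
  have h2 := vec_pos z
  have h3 := vec_pos (P.vertex (i + 1))
  rw [hz] at h2
  simp only [Prod.smul_snd, smul_eq_mul, frame] at h2
  have ht : 0 < t := by
    by_contra hneg
    nlinarith
  have : t = 1 := by nlinarith
  rw [this, one_smul] at hz
  exact vec_injective hz

lemma exists_vertex_of_height_eq_zero {i j : ZMod 5} (hij : j = i + 1 ∨ i = j + 1) :
    ∃ m, ∀ z, P.height i z = 0 → P.height j z = 0 → z = P.vertex m := by
  rcases hij with rfl | rfl
  · exact ⟨_, fun z h h' => eq_vertex_of_height_eq_zero h h'⟩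
  · exact ⟨_, fun z h h' => eq_vertex_of_height_eq_zero h' h⟩

lemma apply_eq_self_of_mem {g : P.group} {x : UpperHalfPlane} (hx : x ∈ P.region)
    (hx' : x ∈ (P.map g.1).region) : g.1 x = x := by
  obtain ⟨y, rfl⟩ := g.1.surjective x
  rw [mem_region_map] at hx'
  have := apply_eq_self hx' _ g rfl hx
  rw [this, this]

lemma mem_region_map_of_apply_eq {g : P.group} {x : UpperHalfPlane} (hx : x ∈ P.region)
    (h : g.1 x = x) : x ∈ (P.map g.1).region := by
  rw [← h, mem_region_map]
  exact hx

lemma height_eq_zero_of_mem {g : P.group} {i : ZMod 5} (hi : P.height i (g.1 P.center) < 0)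
    {x : UpperHalfPlane} (hx : x ∈ P.region) (hx' : x ∈ (P.map g.1).region) :
    P.height i x = 0 := by
  refine le_antisymm ?_ ((P.mem_region_iff x).1 hx i)
  have := height_nonpos_of_neg hi hx
  rwa [apply_eq_self_of_mem hx hx'] at this

lemma side_map_refl (i : ZMod 5) : (P.map (P.refl i)).side i = P.side i := by
  ext z
  have key : ∀ z, z ∈ P.side i → P.refl i z = z := fun z hz =>
    P.refl_of_height_eq_zero ((P.mem_side_iff i z).1 hz).1
  constructor
  · intro h
    rw [← P.refl_refl i z, mem_side_map] at h
    have := key _ h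
    rw [refl_refl] at this
    rwa [← this] at h
  · intro h
    rw [← key z h, mem_side_map]
    exact h

lemma region_inter_region_map_refl (i : ZMod 5) :
    P.region ∩ (P.map (P.refl i)).region = P.side i := by
  ext z
  rw [mem_side_iff]
  constructor
  · rintro ⟨h, h'⟩
    have h1 := apply_eq_self_of_mem (g := P.gen i) h h'
    have h2 := P.height_refl_self i z
    rw [show P.refl i z = z from h1] at h2
    exact ⟨by linarith, h⟩
  · rintro ⟨h, h'⟩
    exact ⟨h', mem_region_map_of_apply_eq (g := P.gen i) h' (P.refl_of_height_eq_zero h)⟩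

/-- Two pentagons are disjoint, or meet in one common vertex, or in one common side. -/
def EdgeToEdge (P Q : Pentagon) : Prop :=
  P.region ∩ Q.region = ∅ ∨
    (∃ i j : ZMod 5, P.vertex i = Q.vertex j ∧ P.region ∩ Q.region = {P.vertex i}) ∨
    (∃ i j : ZMod 5, P.side i = Q.side j ∧ P.region ∩ Q.region = P.side i)

lemma edgeToEdge_map_of_ne_one {g : P.group} (hg : g ≠ 1) : EdgeToEdge P (P.map g.1) := by
  obtain ⟨i, hi⟩ := exists_height_neg hg
  by_cases hk : P.gen i * g = 1
  · have : g = P.gen i := by rw [← gen_inv]; exact (inv_eq_of_mul_eq_one_right hk).symm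
    rw [this]
    exact Or.inr (Or.inr ⟨i, i, (side_map_refl i).symm, region_inter_region_map_refl i⟩)
  · obtain ⟨j, hj⟩ := exists_height_neg hk
    have hij : j ≠ i := by
      rintro rfl
      rw [gen_mul_apply, height_refl_self] at hj
      linarith
    have key : ∀ x ∈ P.region ∩ (P.map g.1).region, P.height i x = 0 ∧ P.height j x = 0 := by
      rintro x ⟨hx, hx'⟩
      have h0 := height_eq_zero_of_mem hi hx hx'
      refine ⟨h0, height_eq_zero_of_mem hj hx (mem_region_map_of_apply_eq hx ?_)⟩
      rw [gen_mul_apply, apply_eq_self_of_mem hx hx', refl_of_height_eq_zero P h0]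
    rcases Set.eq_empty_or_nonempty (P.region ∩ (P.map g.1).region) with h0 | ⟨x, hx⟩
    · exact Or.inl h0
    · rcases eq_or_adjacent_or_nonadjacent i j with h | h | h
      · exact absurd h hij
      · obtain ⟨m, hm⟩ := exists_vertex_of_height_eq_zero (P := P) h
        have hxm := hm x (key x hx).1 (key x hx).2
        refine Or.inr (Or.inl ⟨m, m, ?_, ?_⟩)
        · rw [map_vertex, ← hxm, apply_eq_self_of_mem hx.1 hx.2]
        · apply Set.eq_singleton_iff_unique_mem.2
          exact ⟨hxm ▸ hx, fun y hy => hm y (key y hy).1 (key y hy).2⟩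
      · have := height_add_height_pos_of_nonadjacent (P := P) h x
        linarith [(key x hx).1, (key x hx).2]

lemma disjoint_interior_map_of_ne_one {g : P.group} (hg : g ≠ 1) :
    Disjoint (interior P.region) (interior (P.map g.1).region) := by
  obtain ⟨i, hi⟩ := exists_height_neg hg
  rw [Set.disjoint_left]
  intro x hx hx'
  exact (P.height_pos_of_mem_interior hx i).ne'
    (height_eq_zero_of_mem hi (interior_subset hx) (interior_subset hx'))

lemma region_map (Q : Pentagon) (g : UpperHalfPlane ≃ᵢ UpperHalfPlane) :
    (Q.map g).region = g '' Q.region := by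
  ext z
  obtain ⟨y, rfl⟩ := g.surjective z
  rw [mem_region_map, g.injective.mem_set_image]

lemma side_map (Q : Pentagon) (g : UpperHalfPlane ≃ᵢ UpperHalfPlane) (i : ZMod 5) :
    (Q.map g).side i = g '' Q.side i := by
  ext z
  obtain ⟨y, rfl⟩ := g.surjective z
  rw [mem_side_map, g.injective.mem_set_image]

lemma EdgeToEdge.map {Q R : Pentagon} (h : EdgeToEdge Q R)
    (g : UpperHalfPlane ≃ᵢ UpperHalfPlane) : EdgeToEdge (Q.map g) (R.map g) := by
  simp only [EdgeToEdge, region_map, side_map, map_vertex, ← Set.image_inter g.injective]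
  rcases h with h | ⟨i, j, h, h'⟩ | ⟨i, j, h, h'⟩
  · exact Or.inl (by rw [h, Set.image_empty])
  · exact Or.inr (Or.inl ⟨i, j, by rw [h], by rw [h', Set.image_singleton]⟩)
  · exact Or.inr (Or.inr ⟨i, j, by rw [h], by rw [h']⟩)

lemma map_eq_map_map (g h : P.group) : P.map h.1 = (P.map (g⁻¹ * h).1).map g.1 := by
  rw [← map_mul]
  change _ = P.map (g * (g⁻¹ * h)).1
  rw [mul_inv_cancel_left]

/-- The images of a regular right-angled pentagon under the group generated by the reflections in
its sides form a tiling. -/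
theorem isTiling_range (P : Pentagon) : IsTiling (Set.range fun g : P.group => P.map g.1) where
  covers z := by
    obtain ⟨g, hg⟩ := exists_mem_region_map (P := P) z
    exact ⟨_, ⟨g, rfl⟩, hg⟩
  disjoint_interiors := by
    rintro _ ⟨g, rfl⟩ _ ⟨h, rfl⟩ hne
    have hk : g⁻¹ * h ≠ 1 := fun h1 => hne (by rw [inv_mul_eq_one.1 h1])
    simp only
    rw [map_eq_map_map g h, region_map, region_map, ← IsometryEquiv.coe_toHomeomorph,
      ← Homeomorph.image_interior, ← Homeomorph.image_interior,
      Set.disjoint_image_iff g.1.toHomeomorph.injective]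
    exact disjoint_interior_map_of_ne_one hk
  edge_to_edge := by
    rintro _ ⟨g, rfl⟩ _ ⟨h, rfl⟩ hne
    have hk : g⁻¹ * h ≠ 1 := fun h1 => hne (by rw [inv_mul_eq_one.1 h1])
    simp only
    rw [map_eq_map_map g h]
    exact (edgeToEdge_map_of_ne_one hk).map g.1

end Pentagon

/-! ### Relabelled pentagons -/

/-- `P` and `Q` are the same pentagon with its vertices listed in two of their cyclic orders. -/
def IsRelabelling (P Q : Pentagon) : Prop :=
  ∃ a : ZMod 5, (∀ k, P.vertex (a + k) = Q.vertex k) ∨ ∀ k, P.vertex (a - k) = Q.vertex k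

namespace IsRelabelling

variable {P Q R : Pentagon}

lemma trans (h : IsRelabelling P Q) (h' : IsRelabelling Q R) : IsRelabelling P R := by
  obtain ⟨a, h | h⟩ := h <;> obtain ⟨b, h' | h'⟩ := h'
  · exact ⟨a + b, Or.inl fun k => by rw [add_assoc, h, h']⟩
  · exact ⟨a + b, Or.inr fun k => by rw [add_sub_assoc, h, h']⟩
  · exact ⟨a - b, Or.inr fun k => by rw [sub_sub, h, h']⟩
  · exact ⟨a - b, Or.inl fun k => by rw [show a - b + k = a - (b - k) by ring, h, h']⟩

lemma map (h : IsRelabelling P Q) (g : UpperHalfPlane ≃ᵢ UpperHalfPlane) :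
    IsRelabelling (P.map g) (Q.map g) := by
  obtain ⟨a, h | h⟩ := h
  · exact ⟨a, Or.inl fun k => by simp [h]⟩
  · exact ⟨a, Or.inr fun k => by simp [h]⟩

lemma exists_height_eq (h : IsRelabelling P Q) :
    ∃ σ : Equiv.Perm (ZMod 5), ∀ i, P.height (σ i) = Q.height i := by
  obtain ⟨a, h | h⟩ := h
  · refine ⟨Equiv.addLeft a, fun i => ?_⟩
    ext z
    simp only [Pentagon.height, Equiv.coe_addLeft, add_assoc, h]
  · refine ⟨Equiv.subLeft (a - 1), fun i => ?_⟩
    have h5 : (5 : ZMod 5) = 0 := by decide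
    ext z
    simp only [Pentagon.height, Equiv.subLeft_apply]
    rw [show a - 1 - i = a - (i + 1) by ring, show a - (i + 1) + 1 = a - i by ring,
      show a - (i + 1) + 3 = a - (i + 3) by linear_combination h5, h, h, h]
    ring

lemma region_eq (h : IsRelabelling P Q) : P.region = Q.region := by
  obtain ⟨σ, hσ⟩ := h.exists_height_eq
  ext z
  rw [Pentagon.mem_region_iff, Pentagon.mem_region_iff, ← σ.forall_congr_right]
  simp only [hσ]

lemma exists_side_eq (h : IsRelabelling P Q) :
    ∃ σ : Equiv.Perm (ZMod 5), ∀ i, P.height (σ i) = Q.height i ∧ P.side (σ i) = Q.side i := by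
  obtain ⟨σ, hσ⟩ := h.exists_height_eq
  refine ⟨σ, fun i => ⟨hσ i, ?_⟩⟩
  ext z
  rw [Pentagon.mem_side_iff, Pentagon.mem_side_iff, hσ, h.region_eq]

lemma center_eq (h : IsRelabelling P Q) : P.center = Q.center := by
  apply Pentagon.center_eq_of_sum_eq
  obtain ⟨a, h | h⟩ := h
  · rw [← Equiv.sum_comp (Equiv.addLeft a)]
    simp [Pentagon.frame, h]
  · rw [← Equiv.sum_comp (Equiv.subLeft a)]
    simp [Pentagon.frame, h]

lemma range_vertex_eq (h : IsRelabelling P Q) : Set.range P.vertex = Set.range Q.vertex := by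
  obtain ⟨a, h | h⟩ := h
  · rw [← (Equiv.addLeft a).surjective.range_comp]
    congr 1
    ext1 k
    exact h k
  · rw [← (Equiv.subLeft a).surjective.range_comp]
    congr 1
    ext1 k
    exact h k

end IsRelabelling

lemma Pentagon.refl_eq_of_height_eq {P Q : Pentagon} {i j : ZMod 5} (h : P.height i = Q.height j) :
    P.refl i = Q.refl j := by
  ext1 z
  apply eq_of_forall_cosh_dist
  intro w
  rw [cosh_dist_refl, cosh_dist_refl, h]

/-! ### Pentagons with a common side -/

lemma eq_or_eq_of_seg_eq {x y x' y' : UpperHalfPlane} (hne : x' ≠ y')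
    (hd : dist x y = dist x' y') (hx : x ∈ seg x' y') (hy : y ∈ seg x' y') :
    (x = x' ∧ y = y') ∨ (x = y' ∧ y = x') := by
  obtain ⟨a, b, ha, hb, hab⟩ := mem_seg_iff.1 hx
  obtain ⟨c, d, hc, hd', hcd⟩ := mem_seg_iff.1 hy
  have hC := one_lt_cosh_dist hne
  set C := Real.cosh (dist x' y') with hCd
  have e1 := lorentz_vec_self x
  have e2 := lorentz_vec_self y
  have e3 := lorentz_vec x y
  rw [hd, ← hCd] at e3
  rw [hab] at e1
  rw [hcd] at e2
  rw [hab, hcd] at e3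
  simp only [map_add, map_smul, smul_eq_mul, lorentz_vec_self, lorentz_vec,
    LinearMap.add_apply, LinearMap.smul_apply, dist_comm y' x'] at e1 e2 e3
  rw [← hCd] at e1 e2 e3
  have hdet : (a * d - b * c) ^ 2 = 1 := by
    have h1 : ((a * d - b * c) ^ 2 - 1) * (1 - C ^ 2) = 0 := by
      have e1' : a ^ 2 + b ^ 2 + 2 * a * b * C = 1 := by linarith
      have e2' : c ^ 2 + d ^ 2 + 2 * c * d * C = 1 := by linarith
      have e3' : a * c + b * d + (a * d + b * c) * C = C := by linarith
      linear_combination (c ^ 2 + d ^ 2 + 2 * c * d * C) * e1' + e2'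
        - (a * c + b * d + (a * d + b * c) * C + C) * e3'
    have h2 : 1 - C ^ 2 ≠ 0 := by nlinarith
    linarith [(mul_eq_zero.1 h1).resolve_right h2]
  have hab' : 0 ≤ a * b * C := by positivity
  have hcd' : 0 ≤ c * d * C := by positivity
  have ha1 : a ≤ 1 := by nlinarith
  have hb1 : b ≤ 1 := by nlinarith
  have hc1 : c ≤ 1 := by nlinarith
  have hd1 : d ≤ 1 := by nlinarith
  have hbc : 0 ≤ b * c := by positivity
  have had : 0 ≤ a * d := by positivity
  rcases mul_self_eq_one_iff.1 ((pow_two _).symm.trans hdet) with h | h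
  · have ha' : a = 1 := by nlinarith
    have hd'' : d = 1 := by nlinarith
    have hb' : b = 0 := by nlinarith
    have hc' : c = 0 := by nlinarith
    left
    constructor <;> apply vec_injective
    · rw [hab, ha', hb']; simp
    · rw [hcd, hc', hd'']; simp
  · have hb' : b = 1 := by nlinarith
    have hc' : c = 1 := by nlinarith
    have ha' : a = 0 := by nlinarith
    have hd'' : d = 0 := by nlinarith
    right
    constructor <;> apply vec_injective
    · rw [hab, ha', hb']; simp
    · rw [hcd, hc', hd'']; simp

namespace Pentagon

variable {P Q : Pentagon}

lemma cosh_dist_vertex (P : Pentagon) (i : ZMod 5) :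
    Real.cosh (dist (P.vertex i) (P.vertex (i + 1))) = φ := by
  rw [cosh_dist_eq, P.isFrame.side i, neg_neg]

lemma normal_map_refl (P : Pentagon) (i : ZMod 5) :
    normal (P.map (P.refl i)).frame i = -normal P.frame i := by
  have h3 : P.height i (P.vertex (i + 3)) = 2 * φ + 1 := by
    rw [height_eq]; exact P.isFrame_frame.normal_three i
  have h0 : P.height i (P.vertex i) = 0 := by
    rw [height_eq]; exact P.isFrame_frame.normal_zero i
  have h1 : P.height i (P.vertex (i + 1)) = 0 := by
    rw [height_eq]; exact P.isFrame_frame.normal_one i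
  have e : (4 * φ - 6) * (2 * φ + 1) = 2 := by linear_combination 8 * phi_sq
  conv_lhs => rw [normal]
  simp only [frame, map_vertex, vec_refl, h3, h0, h1, e]
  rw [normal, frame]
  simp only [mul_zero, zero_smul, sub_zero, frame, two_smul]
  abel

lemma isRelabelling_of_normal_eq {i j : ZMod 5} (hv : (P.vertex i = Q.vertex j ∧
    P.vertex (i + 1) = Q.vertex (j + 1)) ∨ (P.vertex i = Q.vertex (j + 1) ∧
    P.vertex (i + 1) = Q.vertex j)) (hn : normal P.frame i = normal Q.frame j) :
    IsRelabelling Q P := by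
  rcases hv with ⟨h0, h1⟩ | ⟨h0, h1⟩
  · refine ⟨j - i, Or.inl fun k => ?_⟩
    have := P.isFrame_frame.unique Q.isFrame_frame (congrArg vec h0) (congrArg vec h1) hn (k - i)
    rw [add_sub_cancel] at this
    rw [show j - i + k = j + (k - i) by ring]
    exact (vec_injective this).symm
  · refine ⟨j + 1 + i, Or.inr fun k => ?_⟩
    have hr := Q.isFrame_frame.reverse (2 * j + 1)
    have := P.isFrame_frame.unique hr (i := i) (j := j)
      (by rw [show 2 * j + 1 - j = j + 1 by ring]; exact congrArg vec h0)
      (by rw [show 2 * j + 1 - (j + 1) = j by ring]; exact congrArg vec h1)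
      (by rw [normal_reverse, show 2 * j + 1 - j - 1 = j by ring]; exact hn) (k - i)
    simp only [add_sub_cancel] at this
    rw [show j + 1 + i - k = 2 * j + 1 - (j + (k - i)) by ring]
    exact (vec_injective this).symm

/-- A regular right-angled pentagon is determined by one of its sides up to reflection in it. -/
lemma isRelabelling_or_of_side_eq {i j : ZMod 5} (h : P.side i = Q.side j) :
    IsRelabelling Q P ∨ IsRelabelling Q (P.map (P.refl i)) := by
  have hv : (P.vertex i = Q.vertex j ∧ P.vertex (i + 1) = Q.vertex (j + 1)) ∨
      (P.vertex i = Q.vertex (j + 1) ∧ P.vertex (i + 1) = Q.vertex j) := by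
    apply eq_or_eq_of_seg_eq (Q.vertex_ne j)
    · apply Real.cosh_strictMonoOn.injOn (Set.mem_Ici.2 dist_nonneg) (Set.mem_Ici.2 dist_nonneg)
      simp only [cosh_dist_vertex]
    · change _ ∈ Q.side j
      rw [← h]
      simp [side, seg]
    · change _ ∈ Q.side j
      rw [← h]
      simp [side, seg]
  have hV := P.isFrame_frame
  have hW := Q.isFrame_frame
  have hp := phi_pos
  have hp1 := one_lt_phi
  have hN0 : lorentz (P.frame i) (normal Q.frame j) = 0 ∧
      lorentz (P.frame (i + 1)) (normal Q.frame j) = 0 := by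
    rcases hv with ⟨h0, h1⟩ | ⟨h0, h1⟩ <;> simp only [frame, h0, h1]
    · exact ⟨hW.normal_zero j, hW.normal_one j⟩
    · exact ⟨hW.normal_one j, hW.normal_zero j⟩
  have hNm := hV.normal_self i
  have hNN := hW.normal_self j
  set l := lorentz (normal P.frame i) (normal Q.frame j) / (2 * φ + 1) with hl
  have hN : normal Q.frame j - l • normal P.frame i = 0 := by
    apply eq_zero_of_orthogonal (X := P.frame i) (Y := P.frame (i + 1)) (Z := normal P.frame i)
    · rw [hV.self, hV.self, hV.side, hV.normal_zero, hV.normal_one, hNm]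
      have : 0 < (2 * φ + 1) * (φ ^ 2 - 1) := mul_pos (by linarith) (by nlinarith)
      intro h
      nlinarith
    · simp [hN0.1, hV.normal_zero]
    · simp [hN0.2, hV.normal_one]
    · simp only [map_sub, map_smul, smul_eq_mul, hNm, hl]
      field_simp
      ring
  rw [sub_eq_zero] at hN
  have hl2 : l ^ 2 = 1 := by
    rw [hN] at hNN
    simp only [map_smul, LinearMap.smul_apply, smul_eq_mul, hNm] at hNN
    have : (l ^ 2 - 1) * (2 * φ + 1) = 0 := by linear_combination hNN
    linarith [(mul_eq_zero.1 this).resolve_right (by linarith)]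
  rcases mul_self_eq_one_iff.1 ((pow_two _).symm.trans hl2) with h1 | h1
  · left
    exact isRelabelling_of_normal_eq hv (by rw [hN, h1, one_smul])
  · right
    have f0 : P.refl i (P.vertex i) = P.vertex i := by
      apply refl_of_height_eq_zero
      rw [height_eq]; exact hV.normal_zero i
    have f1 : P.refl i (P.vertex (i + 1)) = P.vertex (i + 1) := by
      apply refl_of_height_eq_zero
      rw [height_eq]; exact hV.normal_one i
    apply isRelabelling_of_normal_eq (i := i) (j := j)
    · rwa [map_vertex, map_vertex, f0, f1]
    · rw [hN, h1, normal_map_refl, neg_one_smul]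

lemma exists_midpoint (P : Pentagon) (i : ZMod 5) : ∃ z, vec z =
    (1 / √(2 * φ + 2)) • (P.frame i + P.frame (i + 1)) := by
  have hp := phi_pos
  have hV := P.isFrame_frame
  have hr : √(2 * φ + 2) * √(2 * φ + 2) = 2 * φ + 2 := Real.mul_self_sqrt (by positivity)
  have hr0 : √(2 * φ + 2) ≠ 0 := by positivity
  have h1 : lorentz (P.frame (i + 1)) (P.frame i) = -φ := by rw [lorentz_comm]; exact hV.side i
  apply exists_vec_eq
  · simp only [map_smul, map_add, LinearMap.smul_apply, LinearMap.add_apply, smul_eq_mul, hV.self,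
      hV.side, h1]
    generalize √(2 * φ + 2) = r at hr hr0
    field_simp
    linear_combination hr
  · have h1 : 0 < (P.frame i).2.2 := vec_pos _
    have h2 : 0 < (P.frame (i + 1)).2.2 := vec_pos _
    simp only [Prod.smul_snd, Prod.snd_add, smul_eq_mul]
    positivity

/-- The midpoint of the `i`-th side. -/
noncomputable def midpoint (P : Pentagon) (i : ZMod 5) : UpperHalfPlane :=
  (P.exists_midpoint i).choose

lemma vec_midpoint (P : Pentagon) (i : ZMod 5) : vec (P.midpoint i) =
    (1 / √(2 * φ + 2)) • (P.frame i + P.frame (i + 1)) := (P.exists_midpoint i).choose_spec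

lemma height_midpoint (P : Pentagon) (i : ZMod 5) : P.height i (P.midpoint i) = 0 := by
  rw [height_eq, vec_midpoint]
  simp [P.isFrame_frame.normal_zero, P.isFrame_frame.normal_one]

lemma height_midpoint_pos (P : Pentagon) {i j : ZMod 5} (h : j ≠ i) :
    0 < P.height j (P.midpoint i) := by
  have hp := phi_pos
  have hV := P.isFrame_frame
  rw [height_eq, vec_midpoint]
  simp only [map_smul, map_add, LinearMap.smul_apply, LinearMap.add_apply, smul_eq_mul]
  apply mul_pos (by positivity)
  by_cases h' : i = j + 1
  · apply add_pos_of_nonneg_of_pos (hV.lorentz_normal_nonneg _ _)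
    rw [h']
    apply hV.lorentz_normal_pos
    · rw [add_assoc, Ne, add_eq_left]; decide
    · rw [Ne, add_eq_left]; decide
  · exact add_pos_of_pos_of_nonneg (hV.lorentz_normal_pos h.symm h')
      (hV.lorentz_normal_nonneg _ _)

lemma midpoint_mem_region (P : Pentagon) (i : ZMod 5) : P.midpoint i ∈ P.region := by
  rw [mem_region_iff]
  intro j
  by_cases h : j = i
  · rw [h, height_midpoint]
  · exact (P.height_midpoint_pos h).le

lemma height_vertex_eq_zero_iff (P : Pentagon) {i j : ZMod 5} :
    P.height i (P.vertex j) = 0 ↔ j = i ∨ j = i + 1 := by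
  constructor
  · intro h
    by_contra hne
    push Not at hne
    have := P.isFrame_frame.lorentz_normal_pos hne.1 hne.2
    rw [height_eq] at h
    exact this.ne' h
  · intro h
    rw [height_vertex, if_pos h]

end Pentagon

/-! ### The tiles of a tiling -/

namespace IsTiling

open Pentagon

variable {T : Set Pentagon}

lemma eq_of_center_mem (hT : IsTiling T) {P Q : Pentagon} (hP : P ∈ T) (hQ : Q ∈ T)
    (h : Q.center ∈ P.region) :
    P = Q := by
  by_contra hne
  have hmem : Q.center ∈ P.region ∩ Q.region := ⟨h, Q.center_mem_region⟩
  rcases hT.edge_to_edge P hP Q hQ hne with h1 | ⟨i, j, hij, h1⟩ | ⟨i, j, hij, h1⟩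
  · rw [h1] at hmem
    exact hmem
  · rw [h1, hij] at hmem
    have h2 : Q.height j (Q.vertex j) = 0 := Q.height_vertex_eq_zero_iff.2 (Or.inl rfl)
    rw [← Set.mem_singleton_iff.1 hmem] at h2
    exact (Q.height_center_pos j).ne' h2
  · rw [h1, hij] at hmem
    exact (Q.height_center_pos j).ne' ((Q.mem_side_iff j _).1 hmem).1

lemma eq_of_center_eq (hT : IsTiling T) {P Q : Pentagon} (hP : P ∈ T) (hQ : Q ∈ T)
    (h : P.center = Q.center) :
    P = Q := hT.eq_of_center_mem hP hQ (h ▸ P.center_mem_region)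

lemma finite_tiles (hT : IsTiling T) (x : UpperHalfPlane) (R : ℝ) :
    {Q : T | dist x Q.1.center ≤ R}.Finite := by
  apply finite_dist_le innerRadius_pos
  intro P Q hne
  by_contra hlt
  refine hne (Subtype.ext (hT.eq_of_center_mem P.2 Q.2 ?_))
  rw [mem_region_iff]
  exact fun i => (P.1.height_pos_of_dist_lt (by rw [dist_comm]; exact not_le.1 hlt) i).le

lemma exists_other_tile (hT : IsTiling T) {P : Pentagon} (i : ZMod 5) :
    ∃ Q ∈ T, Q ≠ P ∧ P.midpoint i ∈ Q.region := by
  by_contra hcon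
  push Not at hcon
  set M := P.midpoint i
  set F := {Q : T | dist M Q.1.center ≤ Real.arcosh 2 + 1} \ {Q | Q.1 = P} with hF
  have hFfin : F.Finite := (hT.finite_tiles _ _).sdiff
  have hclosed : IsClosed (⋃ Q ∈ F, Q.1.region) :=
    hFfin.isClosed_biUnion fun Q _ => Q.1.isClosed_region
  have hM : M ∈ (⋃ Q ∈ F, Q.1.region)ᶜ := by
    simp only [Set.mem_compl_iff, Set.mem_iUnion, not_exists]
    exact fun Q hQ => hcon Q.1 Q.2 hQ.2
  obtain ⟨ε, hε, hball⟩ := Metric.isOpen_iff.1 hclosed.isOpen_compl M hM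
  obtain ⟨w, hw, hw'⟩ := P.exists_dist_lt_height_neg (P.height_midpoint i) (lt_min hε one_pos)
  obtain ⟨Q, hQ, hwQ⟩ := hT.covers w
  have h1 := hball (show w ∈ Metric.ball M ε by
    rw [Metric.mem_ball, dist_comm]; exact hw.trans_le (min_le_left _ _))
  simp only [Set.mem_compl_iff, Set.mem_iUnion, not_exists] at h1
  refine h1 ⟨Q, hQ⟩ ⟨?_, ?_⟩ hwQ
  · have h2 := Q.cosh_dist_center_le_two hwQ
    have h3 : dist Q.center w ≤ Real.arcosh 2 := by
      rw [← Real.arcosh_cosh (x := dist _ _) dist_nonneg]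
      rwa [Real.arcosh_le_arcosh (Real.cosh_pos _) two_pos]
    have h4 := dist_triangle_right M Q.center w
    have h5 := hw.trans_le (min_le_right _ _)
    simp only [Set.mem_ofPred_eq]
    linarith
  · rintro rfl
    exact absurd ((mem_region_iff _ w).1 hwQ i) (not_le.2 hw')

lemma exists_neighbor (hT : IsTiling T) {P : Pentagon} (hP : P ∈ T) (i : ZMod 5) :
    ∃ Q ∈ T, IsRelabelling Q (P.map (P.refl i)) := by
  obtain ⟨Q, hQ, hne, hM⟩ := hT.exists_other_tile (P := P) i
  have hMP := P.midpoint_mem_region i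
  have huniq : ∀ j, P.height j (P.midpoint i) = 0 → j = i := fun j hj => by
    by_contra h
    exact (P.height_midpoint_pos h).ne' hj
  rcases hT.edge_to_edge P hP Q hQ hne.symm with h1 | ⟨j, k, hjk, h1⟩ | ⟨j, k, hjk, h1⟩
  · exact absurd (show P.midpoint i ∈ P.region ∩ Q.region from ⟨hMP, hM⟩) (by simp [h1])
  · have hmem : P.midpoint i ∈ P.region ∩ Q.region := ⟨hMP, hM⟩
    rw [h1, Set.mem_singleton_iff] at hmem
    have e1 := huniq j (by rw [hmem]; exact P.height_vertex_eq_zero_iff.2 (Or.inl rfl))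
    have e2 := huniq (j - 1) (by
      rw [hmem]; exact P.height_vertex_eq_zero_iff.2 (Or.inr (sub_add_cancel _ _).symm))
    rw [← e1, sub_eq_self] at e2
    exact absurd e2 (by decide)
  · have hmem : P.midpoint i ∈ P.region ∩ Q.region := ⟨hMP, hM⟩
    rw [h1, mem_side_iff] at hmem
    obtain rfl := huniq j hmem.1
    refine ⟨Q, hQ, (isRelabelling_or_of_side_eq hjk).resolve_left fun h => hne ?_⟩
    exact hT.eq_of_center_eq hQ hP h.center_eq

lemma exists_tile (hT : IsTiling T) {P : Pentagon} (hP : P ∈ T) (g : P.group) :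
    ∃ Q ∈ T, IsRelabelling Q (P.map g.1) := by
  obtain ⟨w, rfl⟩ := exists_word g
  induction w using List.reverseRecOn with
  | nil => exact ⟨P, hP, 0, Or.inl fun k => by rw [zero_add]; rfl⟩
  | append_singleton w i ih =>
    obtain ⟨Q, hQ, hrel⟩ := ih
    set k := (w.map P.gen).prod
    obtain ⟨σ, hσ⟩ := hrel.exists_height_eq
    obtain ⟨R, hR, hrel'⟩ := hT.exists_neighbor hQ (σ i)
    refine ⟨R, hR, hrel'.trans ?_⟩
    rw [refl_eq_of_height_eq (hσ i)]
    refine (hrel.map _).trans ⟨0, Or.inl fun j => ?_⟩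
    simp only [zero_add, map_vertex, refl_map, List.map_append, List.prod_append, List.map_cons,
      List.map_nil, List.prod_singleton]
    rfl

end IsTiling

/-! ### The dual complex as a Cayley complex -/

namespace Pentagon

variable {P : Pentagon}

lemma center_injective {g h : P.group} (e : g.1 P.center = h.1 P.center) : g = h := by
  by_contra hne
  have := innerRadius_le_dist hne
  rw [e, dist_self] at this
  linarith [innerRadius_pos]

lemma height_gen_self_neg (i : ZMod 5) : P.height i ((P.gen i).1 P.center) < 0 := by
  change P.height i (P.refl i P.center) < 0
  rw [height_refl_self]
  linarith [P.height_center_pos i]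

lemma height_gen_pos {i j : ZMod 5} (h : j ≠ i) : 0 < P.height j ((P.gen i).1 P.center) := by
  change 0 < P.height j (P.refl i P.center)
  have h1 := P.height_center_pos i
  have h2 := P.height_center_pos j
  have := phi_pos
  rcases eq_or_adjacent_or_nonadjacent i j with h' | h' | h'
  · exact absurd h' h
  · rwa [height_refl_of_adjacent P h']
  · rw [height_refl_of_nonadjacent P h']
    positivity

lemma gen_injective : Function.Injective P.gen := by
  intro i j h
  by_contra hne
  have h1 := height_gen_self_neg (P := P) i
  have h2 := height_gen_pos (P := P) (i := j) (j := i) hne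
  rw [h] at h1
  linarith

lemma gen_ne_one (i : ZMod 5) : P.gen i ≠ 1 := by
  intro h
  have h1 := height_gen_self_neg (P := P) i
  rw [h] at h1
  exact (P.height_center_pos i).not_gt h1

lemma length_gen (i : ZMod 5) : length (P.gen i) = 1 := by
  have h := length_gen_mul_of_pos (g := (1 : P.group)) (P.height_center_pos i)
  rwa [mul_one, length_one] at h

lemma length_gen_mul_gen {i j : ZMod 5} (h : i ≠ j) : length (P.gen i * P.gen j) = 2 := by
  rw [length_gen_mul_of_pos (height_gen_pos h), length_gen]

end Pentagon

namespace IsTiling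

open Pentagon

variable {T : Set Pentagon} {P : Pentagon}

/-- The tile with the same underlying region as the image of a fixed tile `P` under an element of
the reflection group. -/
noncomputable def tile (hT : IsTiling T) (hP : P ∈ T) (g : P.group) : T :=
  ⟨(hT.exists_tile hP g).choose, (hT.exists_tile hP g).choose_spec.1⟩

lemma isRelabelling_tile (hT : IsTiling T) (hP : P ∈ T) (g : P.group) :
    IsRelabelling (hT.tile hP g).1 (P.map g.1) := (hT.exists_tile hP g).choose_spec.2

lemma center_tile (hT : IsTiling T) (hP : P ∈ T) (g : P.group) :
    (hT.tile hP g).1.center = g.1 P.center := (hT.isRelabelling_tile hP g).center_eq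

lemma tile_injective (hT : IsTiling T) (hP : P ∈ T) : Function.Injective (hT.tile hP) := by
  intro g h e
  apply center_injective
  rw [← center_tile hT hP, ← center_tile hT hP, e]

lemma tile_one (hT : IsTiling T) (hP : P ∈ T) : hT.tile hP 1 = ⟨P, hP⟩ :=
  Subtype.ext (hT.eq_of_center_eq (hT.tile hP 1).2 hP (hT.center_tile hP 1))

lemma eq_tile_of_isRelabelling (hT : IsTiling T) (hP : P ∈ T) {Q : T} {g : P.group}
    (h : IsRelabelling Q.1 (P.map g.1)) : Q = hT.tile hP g :=
  Subtype.ext (hT.eq_of_center_eq Q.2 (hT.tile hP g).2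
    (h.center_eq.trans (hT.center_tile hP g).symm))

lemma tile_surjective (hT : IsTiling T) (hP : P ∈ T) : Function.Surjective (hT.tile hP) := by
  intro Q
  obtain ⟨g, hg⟩ := exists_mem_region_map (P := P) Q.1.center
  refine ⟨g, Subtype.ext (hT.eq_of_center_mem (hT.tile hP g).2 Q.2 ?_)⟩
  rwa [(hT.isRelabelling_tile hP g).region_eq]

lemma map_gen (P : Pentagon) (g : P.group) (i : ZMod 5) :
    IsRelabelling ((P.map g.1).map ((P.map g.1).refl i)) (P.map (g * P.gen i).1) := by
  refine ⟨0, Or.inl fun j => ?_⟩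
  simp only [zero_add, map_vertex, refl_map]
  rfl

lemma adj_tile_iff (hT : IsTiling T) (hP : P ∈ T) (g h : P.group) :
    (dualComplex T).graph.Adj (hT.tile hP g) (hT.tile hP h) ↔ ∃ i, h = g * P.gen i := by
  constructor
  · rintro ⟨hne, a, b, hab⟩
    obtain ⟨σ, hσ⟩ := (hT.isRelabelling_tile hP g).exists_side_eq
    rw [← σ.apply_symm_apply a, (hσ _).2] at hab
    refine ⟨σ.symm a, ?_⟩
    rcases isRelabelling_or_of_side_eq hab with h1 | h1
    · exact absurd (hT.eq_tile_of_isRelabelling hP h1).symm hne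
    · exact hT.tile_injective hP (hT.eq_tile_of_isRelabelling hP (h1.trans (map_gen P g _)))
  · rintro ⟨i, rfl⟩
    refine ⟨fun h => gen_ne_one i (left_eq_mul.1 (hT.tile_injective hP h)), ?_⟩
    obtain ⟨σ, hσ⟩ := (hT.isRelabelling_tile hP g).exists_side_eq
    obtain ⟨τ, hτ⟩ := (hT.isRelabelling_tile hP (g * P.gen i)).exists_side_eq
    refine ⟨σ i, τ i, ?_⟩
    rw [(hσ i).2, (hτ i).2, show (g * P.gen i).1 = g.1 * P.refl i from rfl, Pentagon.map_mul,
      side_map, side_map, side_map_refl]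

lemma range_vertex_tile (hT : IsTiling T) (hP : P ∈ T) (g : P.group) :
    Set.range (hT.tile hP g).1.vertex = g.1 '' Set.range P.vertex := by
  rw [(hT.isRelabelling_tile hP g).range_vertex_eq, ← Set.range_comp]
  rfl

lemma vertex_mem_region (P : Pentagon) (i : ZMod 5) : P.vertex i ∈ P.region := by
  rw [mem_region_iff]
  intro j
  rw [height_eq]
  exact P.isFrame_frame.lorentz_normal_nonneg j i

/-- A vertex of `P` that is also a vertex of `g P` is fixed by `g`. -/
lemma apply_vertex_eq {g : P.group} {m : ZMod 5}
    (h : P.vertex m ∈ g.1 '' Set.range P.vertex) : g.1 (P.vertex m) = P.vertex m := by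
  apply apply_eq_self_of_mem (vertex_mem_region P m)
  obtain ⟨_, ⟨k, rfl⟩, hk⟩ := h
  rw [← hk, mem_region_map]
  exact vertex_mem_region P k

lemma height_eq_zero_of_refl_eq {i : ZMod 5} {z : UpperHalfPlane} (h : P.refl i z = z) :
    P.height i z = 0 := by
  have := P.height_refl_self i z
  rw [h] at this
  linarith

/-- The squares at the vertex dual to `g P` are given by the pairs of adjacent sides. -/
lemma isSquare_tile_iff (hT : IsTiling T) (hP : P ∈ T) (g a b d : P.group) :
    (dualComplex T).IsSquare (hT.tile hP a) (hT.tile hP g) (hT.tile hP b) (hT.tile hP d) ↔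
      ∃ i j : ZMod 5, (j = i + 1 ∨ i = j + 1) ∧ a = g * P.gen i ∧ b = g * P.gen j ∧
        d = g * P.gen i * P.gen j := by
  constructor
  · rintro ⟨⟨p, pa, pg, pb, pd⟩, hab, hgd, e1, e2, e3, e4⟩
    obtain ⟨i, rfl⟩ := (hT.adj_tile_iff hP g a).1 ((dualComplex T).graph.adj_symm e1)
    obtain ⟨j, rfl⟩ := (hT.adj_tile_iff hP g b).1 e2
    obtain ⟨k, rfl⟩ := (hT.adj_tile_iff hP _ d).1 ((dualComplex T).graph.adj_symm e4)
    rw [range_vertex_tile] at pa pg pb pd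
    obtain ⟨_, ⟨m, rfl⟩, rfl⟩ := pg
    have key (x : P.group) (hx : g.1 (P.vertex m) ∈ (g * x).1 '' Set.range P.vertex) :
        x.1 (P.vertex m) = P.vertex m := by
      apply apply_vertex_eq
      obtain ⟨y, hy, hy'⟩ := hx
      exact ⟨y, hy, g.1.injective hy'⟩
    have hi := key _ pa
    have hj := key _ pb
    rw [mul_assoc] at pd
    have hk := key _ pd
    have hk' : (P.gen k).1 (P.vertex m) = P.vertex m := by
      have : (P.gen i).1 ((P.gen i * P.gen k).1 (P.vertex m)) = (P.gen i).1 (P.vertex m) := by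
        rw [hk]
      rw [hi] at this
      change (P.gen i * (P.gen i * P.gen k)).1 (P.vertex m) = _ at this
      rwa [gen_mul_gen_mul] at this
    have zi := height_eq_zero_of_refl_eq hi
    have zj := height_eq_zero_of_refl_eq hj
    have zk := height_eq_zero_of_refl_eq hk'
    rw [height_vertex_eq_zero_iff] at zi zj zk
    have hij : i ≠ j := by
      rintro rfl
      exact hab rfl
    have hik : i ≠ k := by
      rintro rfl
      rw [mul_gen_mul_gen] at hgd
      exact hgd rfl
    have hcomb : ∀ i j k m : ZMod 5, (m = i ∨ m = i + 1) → (m = j ∨ m = j + 1) →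
        (m = k ∨ m = k + 1) → i ≠ j → i ≠ k → (j = i + 1 ∨ i = j + 1) ∧ k = j := by decide
    obtain ⟨h1, rfl⟩ := hcomb i j k m zi zj zk hij hik
    exact ⟨i, k, h1, rfl, rfl, rfl⟩
  · rintro ⟨i, j, hij, rfl, rfl, rfl⟩
    have hne : i ≠ j := by
      rintro rfl
      rcases hij with h | h <;> exact absurd (left_eq_add.1 h) (by decide)
    obtain ⟨m, hm⟩ : ∃ m : ZMod 5, (m = i ∨ m = i + 1) ∧ (m = j ∨ m = j + 1) := by
      rcases hij with rfl | rfl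
      · exact ⟨i + 1, Or.inr rfl, Or.inl rfl⟩
      · exact ⟨j + 1, Or.inl rfl, Or.inr rfl⟩
    have fi : P.refl i (P.vertex m) = P.vertex m :=
      P.refl_of_height_eq_zero (P.height_vertex_eq_zero_iff.2 hm.1)
    have fj : P.refl j (P.vertex m) = P.vertex m :=
      P.refl_of_height_eq_zero (P.height_vertex_eq_zero_iff.2 hm.2)
    refine ⟨⟨g.1 (P.vertex m), ?_, ?_, ?_, ?_⟩, ?_, ?_, ?_, ?_, ?_, ?_⟩
    · rw [range_vertex_tile]
      refine ⟨_, ⟨m, rfl⟩, ?_⟩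
      change g.1 (P.refl i (P.vertex m)) = _
      rw [fi]
    · rw [range_vertex_tile]
      exact ⟨_, ⟨m, rfl⟩, rfl⟩
    · rw [range_vertex_tile]
      refine ⟨_, ⟨m, rfl⟩, ?_⟩
      change g.1 (P.refl j (P.vertex m)) = _
      rw [fj]
    · rw [range_vertex_tile]
      refine ⟨_, ⟨m, rfl⟩, ?_⟩
      change g.1 (P.refl i (P.refl j (P.vertex m))) = _
      rw [fj, fi]
    · intro h
      exact hne (gen_injective (mul_left_cancel (hT.tile_injective hP h)))
    · intro h
      have h1 := hT.tile_injective hP h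
      rw [mul_assoc, left_eq_mul] at h1
      rw [← gen_inv, inv_mul_eq_one] at h1
      exact hne (gen_injective h1)
    · exact (dualComplex T).graph.adj_symm ((hT.adj_tile_iff hP _ _).2 ⟨i, rfl⟩)
    · exact (hT.adj_tile_iff hP _ _).2 ⟨j, rfl⟩
    · refine (hT.adj_tile_iff hP _ _).2 ⟨i, ?_⟩
      rw [mul_assoc, mul_assoc, gen_comm_of_adjacent hij]
    · exact (dualComplex T).graph.adj_symm ((hT.adj_tile_iff hP _ _).2 ⟨j, rfl⟩)

/-! ### Links and connectedness -/

lemma ncard_neighborSet (hT : IsTiling T) (v : T) :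
    ((dualComplex T).graph.neighborSet v).ncard = 5 := by
  obtain ⟨P, hP⟩ := v
  have h : (dualComplex T).graph.neighborSet ⟨P, hP⟩ = Set.range fun i => hT.tile hP (P.gen i) := by
    ext Q
    obtain ⟨h, rfl⟩ := hT.tile_surjective hP Q
    rw [SimpleGraph.mem_neighborSet, ← hT.tile_one hP, adj_tile_iff]
    simp only [one_mul, Set.mem_range]
    refine exists_congr fun i => ⟨fun e => by rw [e], fun e => (hT.tile_injective hP e).symm⟩
  have hinj : Function.Injective fun i => hT.tile hP (P.gen i) :=
    (hT.tile_injective hP).comp gen_injective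
  rw [h, ← Nat.card_coe_set_eq, Nat.card_range_of_injective hinj, Nat.card_zmod]

lemma ncard_squaresAt (hT : IsTiling T) (v : T) : ((dualComplex T).squaresAt v).ncard = 5 := by
  obtain ⟨P, hP⟩ := v
  set s : ZMod 5 → Set T := fun i => hT.tile hP '' {P.gen i, 1, P.gen (i + 1),
    P.gen i * P.gen (i + 1)} with hs
  have h : (dualComplex T).squaresAt ⟨P, hP⟩ = Set.range s := by
    ext t
    simp only [SquareComplex.squaresAt, Set.mem_ofPred_eq, Set.mem_range, ← hT.tile_one hP]
    constructor
    · rintro ⟨a, b, d, hsq, rfl⟩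
      obtain ⟨a, rfl⟩ := hT.tile_surjective hP a
      obtain ⟨b, rfl⟩ := hT.tile_surjective hP b
      obtain ⟨d, rfl⟩ := hT.tile_surjective hP d
      obtain ⟨i, j, hij, rfl, rfl, rfl⟩ := (hT.isSquare_tile_iff hP _ _ _ _).1 hsq
      simp only [one_mul]
      rcases hij with rfl | rfl
      · exact ⟨i, by simp only [hs, Set.image_insert_eq, Set.image_singleton]⟩
      · refine ⟨j, ?_⟩
        simp only [hs, Set.image_insert_eq, Set.image_singleton, gen_comm]
        ext x
        simp only [Set.mem_insert_iff, Set.mem_singleton_iff]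
        tauto
    · rintro ⟨i, rfl⟩
      refine ⟨hT.tile hP (1 * P.gen i), hT.tile hP (1 * P.gen (i + 1)),
        hT.tile hP (1 * P.gen i * P.gen (i + 1)),
        (hT.isSquare_tile_iff hP _ _ _ _).2 ⟨i, i + 1, Or.inl rfl, rfl, rfl, rfl⟩, ?_⟩
      simp only [hs, Set.image_insert_eq, Set.image_singleton, one_mul]
  have hinj : Function.Injective s := by
    intro i j hij
    have hij' := (hT.tile_injective hP).image_injective hij
    have key (k : ZMod 5) (hk : P.gen k ∈ ({P.gen j, 1, P.gen (j + 1),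
        P.gen j * P.gen (j + 1)} : Set P.group)) : k = j ∨ k = j + 1 := by
      rcases hk with h | h | h | h
      · exact Or.inl (gen_injective h)
      · exact absurd h (gen_ne_one k)
      · exact Or.inr (gen_injective h)
      · have h1 := congrArg length (Set.mem_singleton_iff.1 h)
        rw [length_gen, length_gen_mul_gen] at h1
        · omega
        · intro h2
          exact absurd (left_eq_add.1 h2) (by decide)
    have h1 := key i (hij' ▸ by simp)
    have h2 := key (i + 1) (hij' ▸ by simp)
    have h3 : ∀ i j : ZMod 5, (i = j ∨ i = j + 1) → (i + 1 = j ∨ i + 1 = j + 1) → i = j := by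
      decide
    exact h3 i j h1 h2
  rw [h, ← Nat.card_coe_set_eq, Nat.card_range_of_injective hinj, Nat.card_zmod]

lemma link_no_double_edge (hT : IsTiling T) {a v b d d' : T}
    (h : (dualComplex T).IsSquare a v b d) (h' : (dualComplex T).IsSquare a v b d') :
    d = d' := by
  obtain ⟨P, hP⟩ := v
  rw [← hT.tile_one hP] at h h'
  obtain ⟨a, rfl⟩ := hT.tile_surjective hP a
  obtain ⟨b, rfl⟩ := hT.tile_surjective hP b
  obtain ⟨d, rfl⟩ := hT.tile_surjective hP d
  obtain ⟨d', rfl⟩ := hT.tile_surjective hP d'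
  obtain ⟨i, j, -, rfl, rfl, rfl⟩ := (hT.isSquare_tile_iff hP _ _ _ _).1 h
  obtain ⟨i', j', -, hi, hj, rfl⟩ := (hT.isSquare_tile_iff hP _ _ _ _).1 h'
  rw [gen_injective (mul_left_cancel hi), gen_injective (mul_left_cancel hj)]

lemma link_no_triangle (hT : IsTiling T) (v a b c : T) : ¬ ((dualComplex T).LinkAdj v a b ∧
    (dualComplex T).LinkAdj v b c ∧ (dualComplex T).LinkAdj v c a) := by
  obtain ⟨P, hP⟩ := v
  rw [← hT.tile_one hP]
  obtain ⟨a, rfl⟩ := hT.tile_surjective hP a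
  obtain ⟨b, rfl⟩ := hT.tile_surjective hP b
  obtain ⟨c, rfl⟩ := hT.tile_surjective hP c
  rintro ⟨⟨d, h1⟩, ⟨e, h2⟩, ⟨f, h3⟩⟩
  obtain ⟨d, rfl⟩ := hT.tile_surjective hP d
  obtain ⟨e, rfl⟩ := hT.tile_surjective hP e
  obtain ⟨f, rfl⟩ := hT.tile_surjective hP f
  obtain ⟨i, j, hij, rfl, rfl, -⟩ := (hT.isSquare_tile_iff hP _ _ _ _).1 h1
  obtain ⟨j', k, hjk, hj, rfl, -⟩ := (hT.isSquare_tile_iff hP _ _ _ _).1 h2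
  obtain ⟨k', i', hki, hk, hi, -⟩ := (hT.isSquare_tile_iff hP _ _ _ _).1 h3
  obtain rfl := gen_injective (mul_left_cancel hj)
  obtain rfl := gen_injective (mul_left_cancel hk)
  obtain rfl := gen_injective (mul_left_cancel hi)
  have : ∀ i j k : ZMod 5, (j = i + 1 ∨ i = j + 1) → (k = j + 1 ∨ j = k + 1) →
      ¬ (i = k + 1 ∨ k = i + 1) := by decide
  exact this _ _ _ hij hjk hki

lemma exists_walk_of_word (hT : IsTiling T) (hP : P ∈ T) (g : P.group) (w : List (ZMod 5)) :
    ∃ p : (dualComplex T).graph.Walk (hT.tile hP g) (hT.tile hP (g * (w.map P.gen).prod)),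
      p.length = w.length := by
  induction w generalizing g with
  | nil => exact ⟨SimpleGraph.Walk.nil.copy rfl (by simp), by simp⟩
  | cons i w ih =>
    obtain ⟨p, hp⟩ := ih (g * P.gen i)
    have hadj := (hT.adj_tile_iff hP g (g * P.gen i)).2 ⟨i, rfl⟩
    exact ⟨(SimpleGraph.Walk.cons hadj p).copy rfl (by simp [mul_assoc]), by simp [hp]⟩

lemma connected (hT : IsTiling T) : (dualComplex T).graph.Connected := by
  obtain ⟨P, hP, -⟩ := hT.covers UpperHalfPlane.I
  have hreach (Q : T) : (dualComplex T).graph.Reachable (hT.tile hP 1) Q := by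
    obtain ⟨g, rfl⟩ := hT.tile_surjective hP Q
    obtain ⟨w, rfl⟩ := exists_word g
    obtain ⟨p, -⟩ := hT.exists_walk_of_word hP 1 w
    rw [one_mul] at p
    exact ⟨p⟩
  have : Nonempty T := ⟨⟨P, hP⟩⟩
  exact SimpleGraph.Connected.mk fun Q R => (hreach Q).symm.trans (hreach R)

end IsTiling

/-! ### Simple connectedness -/

namespace IsTiling

open Pentagon

variable {T : Set Pentagon} {P : Pentagon}

/-- The combinatorial distance of a tile from the base tile `P`, defined through the word length
in the reflection group. -/
noncomputable def level (hT : IsTiling T) (hP : P ∈ T) (Q : T) : ℕ :=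
  length ((hT.tile_surjective hP Q).choose)⁻¹

lemma level_tile (hT : IsTiling T) (hP : P ∈ T) (g : P.group) :
    hT.level hP (hT.tile hP g) = length g⁻¹ := by
  rw [level, hT.tile_injective hP (hT.tile_surjective hP (hT.tile hP g)).choose_spec]

lemma level_ne_of_adj (hT : IsTiling T) (hP : P ∈ T) {Q R : T}
    (h : (dualComplex T).graph.Adj Q R) : hT.level hP Q ≠ hT.level hP R := by
  obtain ⟨g, rfl⟩ := hT.tile_surjective hP Q
  obtain ⟨k, rfl⟩ := hT.tile_surjective hP R
  obtain ⟨i, rfl⟩ := (hT.adj_tile_iff hP _ _).1 h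
  rw [level_tile, level_tile, mul_inv_rev, gen_inv]
  rcases (height_ne_zero g⁻¹ i).lt_or_gt with h' | h'
  · have := length_gen_mul_of_neg h'
    omega
  · have := length_gen_mul_of_pos h'
    omega

/-- If a tile is further from the base tile than two of its neighbours, then these neighbours are
equal or span a square with a tile that is closer to the base tile: the base tile lies beyond two
of the sides, so these sides are adjacent. -/
lemma exists_isSquare_of_level_lt (hT : IsTiling T) (hP : P ∈ T) {a b c : T}
    (hba : (dualComplex T).graph.Adj b a) (hbc : (dualComplex T).graph.Adj b c)
    (ha : hT.level hP a < hT.level hP b) (hc : hT.level hP c < hT.level hP b) :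
    a = c ∨ ∃ d, (dualComplex T).IsSquare a b c d ∧ hT.level hP d < hT.level hP b := by
  obtain ⟨g, rfl⟩ := hT.tile_surjective hP b
  obtain ⟨k, rfl⟩ := hT.tile_surjective hP a
  obtain ⟨l, rfl⟩ := hT.tile_surjective hP c
  obtain ⟨i, rfl⟩ := (hT.adj_tile_iff hP _ _).1 hba
  obtain ⟨j, rfl⟩ := (hT.adj_tile_iff hP _ _).1 hbc
  rw [level_tile, level_tile, mul_inv_rev, gen_inv] at ha hc
  have key (i : ZMod 5) (h : length (P.gen i * g⁻¹) < length g⁻¹) :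
      P.height i ((g⁻¹).1 P.center) < 0 := by
    by_contra hneg
    have := length_gen_mul_of_pos (lt_of_le_of_ne (not_lt.1 hneg) (height_ne_zero g⁻¹ i).symm)
    omega
  have hi := key i ha
  have hj := key j hc
  rcases eq_or_adjacent_or_nonadjacent i j with h | h | h
  · exact Or.inl (by rw [h])
  · refine Or.inr ⟨hT.tile hP (g * P.gen i * P.gen j),
      (hT.isSquare_tile_iff hP _ _ _ _).2 ⟨i, j, h, rfl, rfl, rfl⟩, ?_⟩
    rw [level_tile, level_tile, mul_inv_rev, mul_inv_rev, gen_inv, gen_inv]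
    have h1 : P.height j ((P.gen i * g⁻¹).1 P.center) < 0 := by
      rw [gen_mul_apply, height_refl_of_adjacent P h]
      exact hj
    have := length_gen_mul_of_neg h1
    omega
  · have := height_add_height_pos_of_nonadjacent (P := P) h ((g⁻¹).1 P.center)
    linarith

end IsTiling

/-- A walk that starts upwards and ends below its second vertex has a peak. -/
lemma exists_peak {V : Type} {G : SimpleGraph V} {f : V → ℕ} (hf : ∀ {u v}, G.Adj u v → f u ≠ f v)
    {b w : V} (q : G.Walk b w) : ∀ {a : V} (h : G.Adj a b), f a < f b → f w < f b →
    ∃ (x y z : V) (p₁ : G.Walk a x) (hxy : G.Adj x y) (hyz : G.Adj y z) (p₂ : G.Walk z w),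
      SimpleGraph.Walk.cons h q = p₁.append (.cons hxy (.cons hyz p₂)) ∧
        f x < f y ∧ f z < f y := by
  induction q with
  | nil => intro a h _ hw; exact absurd hw (lt_irrefl _)
  | @cons b c w hbc q ih =>
    intro a h hab hw
    rcases (hf hbc).lt_or_gt with h1 | h1
    · obtain ⟨x, y, z, p₁, hxy, hyz, p₂, he, hx, hz⟩ := ih hbc h1 (hw.trans h1)
      exact ⟨x, y, z, .cons h p₁, hxy, hyz, p₂, by rw [he]; rfl, hx, hz⟩
    · exact ⟨a, b, c, .nil, h, hbc, q, rfl, hab, h1⟩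

namespace IsTiling

open Pentagon

variable {T : Set Pentagon} {P : Pentagon}

/-- Every closed edge path is contracted by repeatedly pushing down a vertex of the path at which
the distance from the base tile has a local maximum. -/
lemma homotopic_nil (hT : IsTiling T) (v : T) : ∀ (n : ℕ) (p : (dualComplex T).graph.Walk v v),
    (p.support.map (hT.level v.2)).sum = n → (dualComplex T).Homotopic p .nil := by
  have hv : hT.level v.2 v = 0 := by
    have := hT.level_tile v.2 1
    rwa [tile_one, inv_one, length_one] at this
  intro n
  induction n using Nat.strong_induction_on with
  | _ n ih =>
    intro p hn
    cases p with
    | nil => exact .refl _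
    | @cons _ b _ h q =>
      have hb : hT.level v.2 v < hT.level v.2 b := by
        have := hT.level_ne_of_adj v.2 h
        omega
      obtain ⟨x, y, z, p₁, hxy, hyz, p₂, he, hx, hz⟩ :=
        exists_peak (fun h => hT.level_ne_of_adj v.2 h) q h hb (hv ▸ hb)
      rw [he] at hn ⊢
      rcases hT.exists_isSquare_of_level_lt v.2 hxy.symm hyz hx hz with rfl | ⟨d, hsq, hd⟩
      · refine .trans (.backtrack p₁ hxy p₂) (ih _ ?_ _ rfl)
        rw [← hn]
        simp only [SimpleGraph.Walk.support_append, SimpleGraph.Walk.support_cons, List.tail_cons,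
          List.map_append, List.map_cons, List.sum_append, List.sum_cons]
        have e : p₂.support = x :: p₂.support.tail := p₂.cons_tail_support.symm
        rw [e]
        simp only [List.tail_cons, List.map_cons, List.sum_cons]
        omega
      · have had : (dualComplex T).graph.Adj x d :=
          ((dualComplex T).adj_of_isSquare ((dualComplex T).rotate
            ((dualComplex T).rotate ((dualComplex T).rotate hsq)))).symm
        have hdc : (dualComplex T).graph.Adj d z :=
          ((dualComplex T).adj_of_isSquare
            ((dualComplex T).rotate ((dualComplex T).rotate hsq))).symm
        refine .trans (.square p₁ p₂ hsq hxy hyz had hdc) (ih _ ?_ _ rfl)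
        rw [← hn]
        simp only [SimpleGraph.Walk.support_append, SimpleGraph.Walk.support_cons, List.tail_cons,
          List.map_append, List.map_cons, List.sum_append, List.sum_cons]
        omega

theorem isCAT0 (hT : IsTiling T) : (dualComplex T).IsCAT0 where
  connected := hT.connected
  simply_connected v p := hT.homotopic_nil v _ p rfl
  link_no_double_edge := hT.link_no_double_edge
  link_no_triangle := hT.link_no_triangle

end IsTiling

/-! ### The constants -/

lemma K_eq : K = (φ - 1) / 2 := by
  rw [K, show 2 * Real.pi / 5 = 2 * (Real.pi / 5) by ring, Real.cos_two_mul, Real.cos_pi_div_five,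
    φ, Real.goldenRatio]
  have : √(5 : ℝ) ^ 2 = 5 := Real.sq_sqrt (by norm_num)
  linear_combination this / 8

lemma cConst_eq : cConst = Real.arcosh ((φ + 1) / 2) := by
  rw [cConst, K_eq]
  congr 1
  ring

lemma dConst_eq : dConst = Real.arcosh ((φ + 2) / 2) := by
  rw [dConst, K_eq]
  congr 1
  linear_combination phi_sq / 2

lemma cosh_cConst : Real.cosh cConst = (φ + 1) / 2 := by
  rw [cConst_eq, Real.cosh_arcosh (by linarith [one_lt_phi])]

lemma cosh_dConst : Real.cosh dConst = (φ + 2) / 2 := by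
  rw [dConst_eq, Real.cosh_arcosh (by linarith [one_lt_phi])]

lemma cConst_pos : 0 < cConst := by
  rw [cConst_eq]
  exact Real.arcosh_pos (by linarith [one_lt_phi])

lemma dConst_pos : 0 < dConst := by
  rw [dConst_eq]
  exact Real.arcosh_pos (by linarith [one_lt_phi])

/-! ### Distances between the midpoints of sides -/

namespace Pentagon

variable {P : Pentagon}

lemma cosh_dist_midpoint (i j : ZMod 5) : Real.cosh (dist (P.midpoint i) (P.midpoint j)) =
    (2 - φ) / 2 * -(lorentz (P.frame i + P.frame (i + 1)) (P.frame j + P.frame (j + 1))) := by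
  have hp := phi_pos
  have hr : √(2 * φ + 2) * √(2 * φ + 2) = 2 * φ + 2 := Real.mul_self_sqrt (by positivity)
  have hr0 : √(2 * φ + 2) ≠ 0 := by positivity
  rw [cosh_dist_eq, vec_midpoint, vec_midpoint]
  simp only [map_smul, LinearMap.smul_apply, smul_eq_mul]
  rw [← mul_assoc, one_div, ← mul_inv, hr, ← mul_neg]
  congr 1
  have : 2 * φ + 2 ≠ 0 := by positivity
  field_simp
  linear_combination phi_sq

lemma cosh_dist_midpoint_succ (i : ZMod 5) :
    Real.cosh (dist (P.midpoint i) (P.midpoint (i + 1))) = (φ + 1) / 2 := by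
  have hV := P.isFrame_frame
  have h1 := hV.side (i + 1)
  have h12 : i + 1 + 1 = i + 2 := by ring
  rw [h12] at h1
  rw [cosh_dist_midpoint, h12]
  simp only [map_add, LinearMap.add_apply, hV.side, hV.diagonal, hV.self, h1]
  linear_combination (-φ / 2 - 1 / 2) * phi_sq

lemma cosh_dist_midpoint_add_two (i : ZMod 5) :
    Real.cosh (dist (P.midpoint i) (P.midpoint (i + 2))) = (φ + 2) / 2 := by
  have hV := P.isFrame_frame
  have h1 := hV.side (i + 1)
  have h2 := hV.diagonal (i + 1)
  have h12 : i + 1 + 1 = i + 2 := by ring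
  have h13 : i + 2 + 1 = i + 3 := by ring
  rw [h12] at h1
  rw [show i + 1 + 2 = i + 3 by ring] at h2
  rw [cosh_dist_midpoint, h13]
  simp only [map_add, LinearMap.add_apply, hV.diagonal, hV.diagonal', h1, h2]
  linear_combination (-3 / 2 * φ + 1) * phi_sq

lemma dist_midpoint_succ (i : ZMod 5) : dist (P.midpoint i) (P.midpoint (i + 1)) = cConst := by
  rw [cConst_eq, ← cosh_dist_midpoint_succ (P := P) i, Real.arcosh_cosh dist_nonneg]

lemma dist_midpoint_add_two (i : ZMod 5) :
    dist (P.midpoint i) (P.midpoint (i + 2)) = dConst := by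
  rw [dConst_eq, ← cosh_dist_midpoint_add_two (P := P) i, Real.arcosh_cosh dist_nonneg]

lemma cConst_le_dConst : cConst ≤ dConst := by
  have := phi_pos
  rw [cConst_eq, dConst_eq, Real.arcosh_le_arcosh (by positivity) (by positivity)]
  linarith

lemma dist_midpoint_le (i j : ZMod 5) : dist (P.midpoint i) (P.midpoint j) ≤ dConst := by
  rcases eq_or_adjacent_or_nonadjacent i j with rfl | (rfl | rfl) | (rfl | rfl)
  · rw [dist_self]; exact dConst_pos.le
  · rw [dist_midpoint_succ]; exact cConst_le_dConst
  · rw [dist_comm, dist_midpoint_succ]; exact cConst_le_dConst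
  · rw [dist_midpoint_add_two]
  · rw [dist_comm, dist_midpoint_add_two]

/-- An upper bound for the distance from the centre to any point of the pentagon. -/
noncomputable def outerRadius : ℝ := Real.arcosh 2

lemma dist_center_le {z : UpperHalfPlane} (h : z ∈ P.region) : dist P.center z ≤ outerRadius := by
  rw [outerRadius, ← Real.arcosh_cosh (x := dist _ _) dist_nonneg,
    Real.arcosh_le_arcosh (Real.cosh_pos _) two_pos]
  exact P.cosh_dist_center_le_two h

lemma outerRadius_pos : 0 < outerRadius := Real.arcosh_pos one_lt_two

lemma dist_refl_of_height_eq_zero {i : ZMod 5} {x : UpperHalfPlane} (h : P.height i x = 0)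
    (y : UpperHalfPlane) : dist x (P.refl i y) = dist x y := by
  conv_lhs => rw [← P.refl_of_height_eq_zero h]
  exact (P.refl i).dist_eq x y

/-! ### The upper bound -/

/-- A path through the midpoints of the sides that are crossed; two consecutive midpoints belong to
the same pentagon, so their distance is at most `dConst`. -/
lemma dist_midpoint_apply_le (w : List (ZMod 5)) : ∀ i : ZMod 5,
    dist (P.midpoint i) ((w.map P.gen).prod.1 P.center) ≤ dConst * w.length + outerRadius := by
  induction w with
  | nil =>
    intro i
    simp only [List.map_nil, List.prod_nil, List.length_nil, Nat.cast_zero, mul_zero, zero_add]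
    rw [dist_comm]
    exact dist_center_le (P.midpoint_mem_region i)
  | cons j w ih =>
    intro i
    rw [List.map_cons, List.prod_cons, gen_mul_apply]
    have h1 := dist_triangle (P.midpoint i) (P.midpoint j)
      (P.refl j ((w.map P.gen).prod.1 P.center))
    rw [dist_refl_of_height_eq_zero (P.height_midpoint j)] at h1
    have h2 := dist_midpoint_le (P := P) i j
    have h3 := ih j
    rw [List.length_cons, Nat.cast_succ]
    linarith

lemma dist_center_apply_le (g : P.group) :
    dist P.center (g.1 P.center) ≤ dConst * length g + 2 * outerRadius := by
  obtain ⟨w, hw, rfl⟩ := exists_reduced_word g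
  have h1 := dist_midpoint_apply_le (P := P) w 0
  have h2 := dist_triangle P.center (P.midpoint 0) ((w.map P.gen).prod.1 P.center)
  have h3 := dist_center_le (P.midpoint_mem_region 0)
  rw [← hw]
  linarith

/-! ### The lower bound -/

/-- The distance from a point of a side to the bisector of the right angle at one end of that side,
as a function of the height `a` of the point over the other side of that angle. -/
noncomputable def bisectorDist (a : ℝ) : ℝ := Real.arsinh (a / √(2 * (2 * φ + 1)))

lemma bisectorDist_mono {a b : ℝ} (h : a ≤ b) : bisectorDist a ≤ bisectorDist b := by
  have := phi_pos
  rw [bisectorDist, bisectorDist, Real.arsinh_le_arsinh]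
  gcongr

/-- If `S` and `s` are the hyperbolic cosine and sine of the distance from a point of a leg of a
right angle to its bisector, then `S ^ 2 + s ^ 2` is the square of the hyperbolic cosine of the
distance to the apex, which is proportional to `X`. By the Cauchy–Schwarz inequality the product of
two such square roots is at least the hyperbolic cosine of the sum of the distances to the
bisector. -/
lemma bisectorDist_add_le {x y X Y D : ℝ} (hx : 0 ≤ x) (hy : 0 ≤ y) (hX : 0 ≤ X) (hY : 0 ≤ Y)
    (hXx : X ^ 2 = 3 * φ + 2 + φ * x ^ 2) (hYy : Y ^ 2 = 3 * φ + 2 + φ * y ^ 2) (hD : 0 ≤ D)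
    (h : X * Y ≤ (3 * φ + 2) * Real.cosh D) : bisectorDist x + bisectorDist y ≤ D := by
  have hp := phi_pos
  have h2 := phi_sq
  set r := √(2 * (2 * φ + 1)) with hr
  have hr0 : 0 < r := by positivity
  have hr2 : r ^ 2 = 2 * (2 * φ + 1) := Real.sq_sqrt (by positivity)
  have hTx : 0 ≤ bisectorDist x := Real.arsinh_nonneg_iff.2 (by positivity)
  have hTy : 0 ≤ bisectorDist y := Real.arsinh_nonneg_iff.2 (by positivity)
  have hcosh : Real.cosh (bisectorDist x + bisectorDist y) ≤ Real.cosh D := by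
    refine le_trans ?_ ((div_le_iff₀' (by positivity : (0 : ℝ) < 3 * φ + 2)).2 h)
    rw [Real.cosh_add, bisectorDist, bisectorDist, Real.sinh_arsinh, Real.sinh_arsinh,
      Real.cosh_arsinh, Real.cosh_arsinh, ← hr]
    set s := x / r with hs
    set t := y / r with ht
    have es : x = s * r := by rw [hs]; field_simp
    have et : y = t * r := by rw [ht]; field_simp
    have hS : √(1 + s ^ 2) ^ 2 = 1 + s ^ 2 := Real.sq_sqrt (by positivity)
    have hS' : √(1 + t ^ 2) ^ 2 = 1 + t ^ 2 := Real.sq_sqrt (by positivity)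
    set S := √(1 + s ^ 2)
    set S' := √(1 + t ^ 2)
    have h4 : φ * (2 * φ + 1) = 3 * φ + 2 := by linear_combination 2 * h2
    have eX : X ^ 2 = (3 * φ + 2) * (S ^ 2 + s ^ 2) := by
      rw [hXx, es, hS]
      linear_combination φ * s ^ 2 * hr2 + 2 * s ^ 2 * h4
    have eY : Y ^ 2 = (3 * φ + 2) * (S' ^ 2 + t ^ 2) := by
      rw [hYy, et, hS']
      linear_combination φ * t ^ 2 * hr2 + 2 * t ^ 2 * h4
    refine (pow_le_pow_iff_left₀ (by positivity) (by positivity) two_ne_zero).1 ?_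
    rw [div_pow, mul_pow, eX, eY]
    have : (3 * φ + 2) * (S ^ 2 + s ^ 2) * ((3 * φ + 2) * (S' ^ 2 + t ^ 2)) / (3 * φ + 2) ^ 2 =
        (S ^ 2 + s ^ 2) * (S' ^ 2 + t ^ 2) := by
      have : 3 * φ + 2 ≠ 0 := by positivity
      field_simp
    rw [this]
    nlinarith [sq_nonneg (S * t - S' * s)]
  rwa [Real.cosh_le_cosh, abs_of_nonneg (by positivity), abs_of_nonneg hD] at hcosh

/-- The distances from a point of a side to the bisectors at the two ends of that side have sum at
least `cConst`, with equality for the midpoint. -/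
lemma cConst_le_bisectorDist_add {a b : ℝ} (ha : 0 ≤ a) (hb : 0 ≤ b)
    (hab : a ^ 2 + b ^ 2 + 2 * φ * (a * b) = 3 * φ + 2) :
    cConst ≤ bisectorDist a + bisectorDist b := by
  have hp := phi_pos
  have hp1 := one_lt_phi
  have hp2 := phi_lt_two
  have h2 := phi_sq
  set r := √(2 * (2 * φ + 1)) with hr
  have hr0 : 0 < r := by positivity
  have hr2 : r ^ 2 = 2 * (2 * φ + 1) := Real.sq_sqrt (by positivity)
  have hTx : 0 ≤ bisectorDist a := Real.arsinh_nonneg_iff.2 (by positivity)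
  have hTy : 0 ≤ bisectorDist b := Real.arsinh_nonneg_iff.2 (by positivity)
  have hcosh : Real.cosh cConst ≤ Real.cosh (bisectorDist a + bisectorDist b) := by
    rw [cosh_cConst, Real.cosh_add, bisectorDist, bisectorDist, Real.sinh_arsinh,
      Real.sinh_arsinh, Real.cosh_arsinh, Real.cosh_arsinh, ← hr,
      ← Real.sqrt_mul (by positivity)]
    set s := a / r with hs
    set t := b / r with ht
    have es : a = s * r := by rw [hs]; field_simp
    have et : b = t * r := by rw [ht]; field_simp
    have hst0 : 0 ≤ s * t := by positivity
    have hsum : 2 * (s ^ 2 + t ^ 2 + 2 * φ * (s * t)) = φ := by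
      rw [es, et] at hab
      have h3 : (2 * (s ^ 2 + t ^ 2 + 2 * φ * (s * t)) - φ) * (2 * φ + 1) = 0 := by
        linear_combination hab - (s ^ 2 + t ^ 2 + 2 * φ * (s * t)) * hr2 - 2 * h2
      linarith [(mul_eq_zero.1 h3).resolve_right (by positivity)]
    have hst : 4 * (φ + 1) * (s * t) ≤ φ := by nlinarith [sq_nonneg (s - t)]
    have hst' : s * t ≤ (2 - φ) / 4 * φ := by
      have e : 4 * (φ + 1) * ((2 - φ) / 4 * φ) = φ := by
        linear_combination (-φ) * h2
      by_contra hcon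
      have := mul_lt_mul_of_pos_left (not_le.1 hcon) (by positivity : 0 < 4 * (φ + 1))
      linarith
    have hkey : (φ + 1) / 2 - s * t ≤ √((1 + s ^ 2) * (1 + t ^ 2)) := by
      apply Real.le_sqrt_of_sq_le
      nlinarith
    linarith
  rwa [Real.cosh_le_cosh, abs_of_nonneg cConst_pos.le, abs_of_nonneg (by positivity)] at hcosh

/-- The relation between the heights of a point of a side over the two adjacent sides. -/
lemma height_sq_add (i : ZMod 5) {z : UpperHalfPlane} (h : P.height i z = 0) :
    P.height (i + 1) z ^ 2 + P.height (i + 4) z ^ 2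
      + 2 * φ * (P.height (i + 1) z * P.height (i + 4) z) = 3 * φ + 2 := by
  have hV := P.isFrame_frame
  have hz := lorentz_vec_self z
  have h10 := hV.side i
  rw [lorentz_comm] at h10
  rw [P.vec_eq_of_height_eq_zero h] at hz
  simp only [map_add, map_smul, LinearMap.add_apply, LinearMap.smul_apply, smul_eq_mul, hV.self,
    hV.side, h10] at hz
  set a := P.height (i + 1) z
  set b := P.height (i + 4) z
  have h2 := phi_sq
  have e : (3 * φ + 2) * (2 - φ) ^ 2 = 1 := by
    linear_combination (3 * φ - 7) * h2
  have hz' : (2 - φ) ^ 2 * (a ^ 2 + b ^ 2 + 2 * φ * (a * b)) = 1 := by linarith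
  linear_combination (3 * φ + 2) * hz' - (a ^ 2 + b ^ 2 + 2 * φ * (a * b)) * e

lemma cosh_dist_side_succ {i : ZMod 5} {x y : UpperHalfPlane} (hx : P.height i x = 0)
    (hy : P.height (i + 1) y = 0) : (3 * φ + 2) * Real.cosh (dist x y) =
      (φ * P.height (i + 1) x + P.height (i + 4) x) *
        (P.height (i + 2) y + φ * P.height i y) := by
  have hV := P.isFrame_frame
  have h2 := phi_sq
  have h1 := hV.side (i + 1)
  have h12 : i + 1 + 1 = i + 2 := by ring
  have h14 : i + 1 + 4 = i := by rw [add_assoc, show (1 : ZMod 5) + 4 = 0 by decide, add_zero]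
  have ey := P.vec_eq_of_height_eq_zero hy
  rw [h12, h14] at ey
  rw [h12] at h1
  rw [cosh_dist_eq, P.vec_eq_of_height_eq_zero hx, ey]
  simp only [map_add, map_smul, LinearMap.add_apply, LinearMap.smul_apply, smul_eq_mul, hV.self,
    hV.side, hV.diagonal, h1]
  have e : (3 * φ + 2) * (2 - φ) ^ 2 = 1 := by
    linear_combination (3 * φ - 7) * h2
  linear_combination ((φ * P.height (i + 1) x + P.height (i + 4) x) *
        (P.height (i + 2) y + φ * P.height i y)) * e

lemma cosh_dist_side_add_two {i : ZMod 5} {x y : UpperHalfPlane} (hx : P.height i x = 0)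
    (hy : P.height (i + 2) y = 0) : (3 * φ + 2) * Real.cosh (dist x y) =
      (φ + 1) * (P.height (i + 1) x * P.height (i + 3) y)
        + (φ + 1) * (P.height (i + 1) x * P.height (i + 1) y)
        + φ * (P.height (i + 4) x * P.height (i + 3) y)
        + (φ + 1) * (P.height (i + 4) x * P.height (i + 1) y) := by
  have hV := P.isFrame_frame
  have h2 := phi_sq
  have h1 := hV.side (i + 1)
  have h1' := hV.diagonal (i + 1)
  have h12 : i + 1 + 1 = i + 2 := by ring
  have h13 : i + 2 + 1 = i + 3 := by ring
  have h14 : i + 2 + 4 = i + 1 := by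
    rw [add_assoc, show (2 : ZMod 5) + 4 = 1 by decide]
  have ey := P.vec_eq_of_height_eq_zero hy
  rw [h13, h14] at ey
  rw [h12] at h1
  rw [show i + 1 + 2 = i + 3 by ring] at h1'
  rw [cosh_dist_eq, P.vec_eq_of_height_eq_zero hx, ey]
  simp only [map_add, map_smul, LinearMap.add_apply, LinearMap.smul_apply, smul_eq_mul,
    hV.diagonal, hV.diagonal', h1, h1', h2]
  have e : (3 * φ + 2) * (2 - φ) ^ 2 = 1 := by
    linear_combination (3 * φ - 7) * h2
  linear_combination ((φ + 1) * (P.height (i + 1) x * P.height (i + 3) y)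
        + (φ + 1) * (P.height (i + 1) x * P.height (i + 1) y)
        + φ * (P.height (i + 4) x * P.height (i + 3) y)
        + (φ + 1) * (P.height (i + 4) x * P.height (i + 1) y)) * e

/-- The identity `cosh² = 1 + sinh²` for the distance from a point of a side to an end point:
`φ * a + b` is proportional to the hyperbolic cosine and `a` to the hyperbolic sine. -/
lemma sq_eq_add_mul_sq {a b : ℝ} (hab : a ^ 2 + b ^ 2 + 2 * φ * (a * b) = 3 * φ + 2) :
    (φ * a + b) ^ 2 = 3 * φ + 2 + φ * a ^ 2 := by
  linear_combination hab + a ^ 2 * phi_sq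

lemma bisectorDist_add_le_dist_succ {i : ZMod 5} {x y : UpperHalfPlane} (hx : P.height i x = 0)
    (hx' : x ∈ P.region) (hy : P.height (i + 1) y = 0) (hy' : y ∈ P.region) :
    bisectorDist (P.height (i + 1) x) + bisectorDist (P.height i y) ≤ dist x y := by
  have hp := phi_pos
  rw [mem_region_iff] at hx' hy'
  have qx := height_sq_add i hx
  have qy := height_sq_add (i + 1) hy
  have h14 : i + 1 + 4 = i := by rw [add_assoc, show (1 : ZMod 5) + 4 = 0 by decide, add_zero]
  rw [h14, show i + 1 + 1 = i + 2 by ring] at qy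
  have a1 := hx' (i + 1)
  have a2 := hx' (i + 4)
  have a3 := hy' (i + 2)
  have a4 := hy' i
  refine bisectorDist_add_le a1 a4
    (X := φ * P.height (i + 1) x + P.height (i + 4) x)
    (Y := φ * P.height i y + P.height (i + 2) y) (by positivity) (by positivity)
    (sq_eq_add_mul_sq qx) (sq_eq_add_mul_sq (by linarith)) dist_nonneg ?_
  rw [cosh_dist_side_succ hx hy]
  linarith

lemma bisectorDist_add_le_dist_add_two {i : ZMod 5} {x y : UpperHalfPlane}
    (hx : P.height i x = 0) (hx' : x ∈ P.region) (hy : P.height (i + 2) y = 0)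
    (hy' : y ∈ P.region) :
    bisectorDist (P.height (i + 1) x) + bisectorDist (P.height (i + 1) y) ≤ dist x y ∧
    bisectorDist (P.height (i + 1) x) + bisectorDist (P.height (i + 3) y) ≤ dist x y ∧
    bisectorDist (P.height (i + 4) x) + bisectorDist (P.height (i + 1) y) ≤ dist x y := by
  have hp := phi_pos
  have h2 := phi_sq
  rw [mem_region_iff] at hx' hy'
  have qx := height_sq_add i hx
  have qy := height_sq_add (i + 2) hy
  rw [show i + 2 + 1 = i + 3 by ring, add_assoc i 2 4, show (2 : ZMod 5) + 4 = 1 by decide] at qy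
  have a1 := hx' (i + 1)
  have a2 := hx' (i + 4)
  have a3 := hy' (i + 3)
  have a4 := hy' (i + 1)
  have hcosh := cosh_dist_side_add_two hx hy
  set a := P.height (i + 1) x
  set b := P.height (i + 4) x
  set a' := P.height (i + 3) y
  set b' := P.height (i + 1) y
  have m1 : 0 ≤ a * a' := by positivity
  have m2 : 0 ≤ a * b' := by positivity
  have m3 : 0 ≤ b * a' := by positivity
  have m4 : 0 ≤ b * b' := by positivity
  have hp1 := one_lt_phi
  refine ⟨?_, ?_, ?_⟩
  · refine bisectorDist_add_le a1 a4 (X := φ * a + b) (Y := φ * b' + a') (by positivity)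
      (by positivity) (sq_eq_add_mul_sq qx) (sq_eq_add_mul_sq (by linarith)) dist_nonneg ?_
    rw [hcosh]
    nlinarith
  · refine bisectorDist_add_le a1 a3 (X := φ * a + b) (Y := φ * a' + b') (by positivity)
      (by positivity) (sq_eq_add_mul_sq qx) (sq_eq_add_mul_sq (by linarith)) dist_nonneg ?_
    rw [hcosh]
    nlinarith
  · refine bisectorDist_add_le a2 a4 (X := φ * b + a) (Y := φ * b' + a') (by positivity)
      (by positivity) (sq_eq_add_mul_sq (by linarith)) (sq_eq_add_mul_sq (by linarith))
      dist_nonneg ?_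
    rw [hcosh]
    nlinarith

end Pentagon

namespace IsFrame

variable {V : ZMod 5 → ℝ × ℝ × ℝ}

/-- The sums `V i + V (i + 1)` point to the midpoints of the sides. -/
lemma midpoint_add (hV : IsFrame V) (i : ZMod 5) :
    V (i + 2) + V (i + 3) - (2 * φ) • normal V i =
      (φ + 2) • (V i + V (i + 1)) - (V (i + 3) + V (i + 4)) := by
  rw [← sub_eq_zero, normal]
  apply hV.eq_zero_of_vertex i <;>
    simp only [map_sub, map_add, map_smul, smul_eq_mul, hV.gram, add_sub_add_left_eq_sub,
      sub_add_cancel_left, add_sub_cancel_left, sub_self] <;>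
    simp (decide := true) only [if_true, if_false]
  · linear_combination (2 * φ - 2) * phi_sq
  · linear_combination (2 * φ - 2) * phi_sq
  · linear_combination (1 - φ) * phi_sq

end IsFrame

namespace Pentagon

variable {P : Pentagon}

lemma bisectorDist_nonneg {a : ℝ} (h : 0 ≤ a) : 0 ≤ bisectorDist a :=
  Real.arsinh_nonneg_iff.2 (by positivity)

lemma bisectorDist_add_le_dist_of_adjacent {i j : ZMod 5} (hij : j = i + 1 ∨ i = j + 1)
    {x y : UpperHalfPlane} (hx : P.height i x = 0) (hx' : x ∈ P.region) (hy : P.height j y = 0)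
    (hy' : y ∈ P.region) :
    bisectorDist (P.height j x) + bisectorDist (P.height i y) ≤ dist x y := by
  rcases hij with rfl | rfl
  · exact bisectorDist_add_le_dist_succ hx hx' hy hy'
  · rw [add_comm, dist_comm]
    exact bisectorDist_add_le_dist_succ hy hy' hx hx'

/-- A segment between two non-adjacent sides is no shorter than the sum of the distances from its
end points to the bisectors at the ends of those sides, in each of the combinations in which at
most one of the bisectors is at an end away from the side between them. -/
lemma bisectorDist_add_le_dist_of_nonadjacent {i s : ZMod 5} (hs : s = 1 ∨ s = -1)
    {x y : UpperHalfPlane} (hx : P.height i x = 0) (hx' : x ∈ P.region)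
    (hy : P.height (i + 2 * s) y = 0) (hy' : y ∈ P.region) :
    bisectorDist (P.height (i + s) x) + bisectorDist (P.height (i + s) y) ≤ dist x y ∧
    bisectorDist (P.height (i + s) x) + bisectorDist (P.height (i + 3 * s) y) ≤ dist x y ∧
    bisectorDist (P.height (i - s) x) + bisectorDist (P.height (i + s) y) ≤ dist x y := by
  rcases hs with rfl | rfl
  · rw [mul_one] at hy ⊢
    have := bisectorDist_add_le_dist_add_two hx hx' hy hy'
    rwa [show i + 4 = i - 1 by rw [sub_eq_add_neg, show (-1 : ZMod 5) = 4 by decide]] at this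
  · have e2 : i = i + 2 * -1 + 2 := by ring
    rw [e2] at hx
    obtain ⟨h1, h2, h3⟩ := bisectorDist_add_le_dist_add_two hy hy' hx hx'
    have e3 : i + 2 * -1 + 1 = i + -1 := by ring
    have e4 : i + 2 * -1 + 3 = i - -1 := by ring
    have e5 : i + 2 * -1 + 4 = i + 3 * -1 := by
      rw [add_assoc, show (2 : ZMod 5) * -1 + 4 = 3 * -1 by decide]
    rw [e3, dist_comm, add_comm] at h1
    rw [e3, e4, dist_comm, add_comm] at h2
    rw [e3, e5, dist_comm, add_comm] at h3
    exact ⟨h1, h3, h2⟩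

lemma cConst_le_of_mem_side {k s : ZMod 5} (hs : s = 1 ∨ s = -1) {x : UpperHalfPlane}
    (hx : P.height k x = 0) (hx' : x ∈ P.region) :
    cConst ≤ bisectorDist (P.height (k + s) x) + bisectorDist (P.height (k - s) x) := by
  rw [mem_region_iff] at hx'
  have h := cConst_le_bisectorDist_add (hx' _) (hx' _) (height_sq_add k hx)
  rw [show (4 : ZMod 5) = -1 by decide] at h
  rcases hs with rfl | rfl
  · rwa [sub_eq_add_neg]
  · rwa [sub_neg_eq_add, add_comm]

lemma height_le_of_mem_side {k s : ZMod 5} (hs : s = 1 ∨ s = -1) {x : UpperHalfPlane}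
    (hx : P.height k x = 0) (hx' : x ∈ P.region) : P.height (k + s) x ≤ φ + 1 := by
  rw [mem_region_iff] at hx'
  have hp := phi_pos
  have h := height_sq_add k hx
  have h1 := hx' (k + 1)
  have h4 := hx' (k + 4)
  have h14 : 0 ≤ φ * (P.height (k + 1) x * P.height (k + 4) x) := by positivity
  have e : (φ + 1) ^ 2 = 3 * φ + 2 := by linear_combination phi_sq
  refine (pow_le_pow_iff_left₀ (hx' _) (by positivity) two_ne_zero).1 ?_
  rcases hs with rfl | rfl
  · nlinarith [sq_nonneg (P.height (k + 4) x)]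
  · rw [show (-1 : ZMod 5) = 4 by decide]
    nlinarith [sq_nonneg (P.height (k + 1) x)]

/-- The segment from a point of the pentagon to a point `z` outside leaves the pentagon through a
side that separates the pentagon from `z`. -/
lemma exists_exit {x z : UpperHalfPlane} (hx : x ∈ P.region) (hz : ∃ k, P.height k z < 0) :
    ∃ k, P.height k z < 0 ∧ ∃ y ∈ seg x z, P.height k y = 0 ∧ y ∈ P.region := by
  classical
  rw [mem_region_iff] at hx
  obtain ⟨k₀, hk₀⟩ := hz
  -- `k` is the side whose geodesic the segment crosses first.
  obtain ⟨k, hk, hmin⟩ := Finset.exists_min_image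
    (Finset.univ.filter fun k : ZMod 5 => P.height k z < 0)
    (fun k => P.height k x / -P.height k z) ⟨k₀, by simpa using hk₀⟩
  have hk : P.height k z < 0 := by simpa using hk
  refine ⟨k, hk, ?_⟩
  obtain ⟨t, ht, y, hy, e⟩ := exists_mem_seg_crossing (x := x) (y := z) (n := normal P.frame k)
    (by rw [← height_eq]; exact hx k) (by rwa [← height_eq])
  have key (i : ZMod 5) : P.height i y =
      t * (-P.height k z * P.height i x + P.height k x * P.height i z) := by
    rw [P.height_eq i y, e]
    simp [height_eq]
    ring
  refine ⟨y, hy, by rw [key]; ring, (P.mem_region_iff y).2 fun i => ?_⟩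
  rw [key]
  apply mul_nonneg ht.le
  rcases lt_or_ge (P.height i z) 0 with hi | hi
  · have := hmin i (by simpa using hi)
    rw [div_le_div_iff₀ (by linarith) (by linarith)] at this
    linarith
  · have := mul_nonneg (hx k) hi
    have := mul_nonneg (neg_nonneg.2 hk.le) (hx i)
    linarith

/-- The distance from a point `A` of the side `j` to the centre of `g P`, when `g P` lies on the
same side of the geodesics of the sides `j` and `j + s` as `P`. The term with `bisectorDist` makes
the estimate additive along the pentagons met by the segment. -/
lemma cConst_mul_length_le_dist (n : ℕ) : ∀ g : P.group, length g = n → ∀ j s : ZMod 5,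
    (s = 1 ∨ s = -1) → ∀ A ∈ P.region, P.height j A = 0 → 0 < P.height j (g.1 P.center) →
    0 < P.height (j + s) (g.1 P.center) →
    cConst * n - bisectorDist (φ + 1) + bisectorDist (P.height (j - s) A) ≤
      dist A (g.1 P.center) := by
  induction n with
  | zero =>
    intro g _ j s hs A hA hjA _ _
    have hs' : -s = 1 ∨ -s = -1 := by rcases hs with rfl | rfl <;> simp
    have h := height_le_of_mem_side hs' hjA hA
    rw [← sub_eq_add_neg] at h
    have := bisectorDist_mono h
    have := dist_nonneg (x := A) (y := g.1 P.center)
    push_cast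
    linarith
  | succ n ih =>
    intro g hg j s hs A hA hjA hj hjs
    have hs' : -s = 1 ∨ -s = -1 := by rcases hs with rfl | rfl <;> simp
    have hg1 : g ≠ 1 := by
      rintro rfl
      rw [length_one] at hg
      omega
    obtain ⟨k, hk, B, hB, hkB, hBr⟩ := exists_exit hA (exists_height_neg hg1)
    have hlen : length (P.gen k * g) = n := by
      have := length_gen_mul_of_neg hk
      omega
    have hk' : 0 < P.height k ((P.gen k * g).1 P.center) := by
      rw [gen_mul_apply, height_refl_self]
      linarith
    have hdist : dist A B + dist B ((P.gen k * g).1 P.center) = dist A (g.1 P.center) := by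
      rw [gen_mul_apply, dist_refl_of_height_eq_zero hkB]
      exact hB
    -- `B` is the point where the segment leaves the pentagon; whichever side of the exit side the
    -- induction hypothesis uses, the two bisector terms of `B` add up to `cConst`.
    have step (t : ZMod 5) (ht : t = 1 ∨ t = -1) (hkt : 0 < P.height (k + t) (g.1 P.center)) :
        cConst * (n + 1) - bisectorDist (φ + 1) - bisectorDist (P.height (k + t) B) ≤
          dist B ((P.gen k * g).1 P.center) := by
      have h1 := ih _ hlen k t ht B hBr hkB hk' (by
        rw [gen_mul_apply, height_refl_of_adjacent]
        · exact hkt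
        · rcases ht with rfl | rfl
          · exact Or.inl rfl
          · exact Or.inr (by ring))
      have h2 := cConst_le_of_mem_side ht hkB hBr
      linarith
    have hcases : k = j - s ∨ k = j + 2 * -s ∨ k = j + 2 * s := by
      have h1 : k ≠ j := by rintro rfl; linarith
      have h2 : k ≠ j + s := by rintro rfl; linarith
      have : ∀ j k s : ZMod 5, (s = 1 ∨ s = -1) → k ≠ j → k ≠ j + s →
          k = j - s ∨ k = j + 2 * -s ∨ k = j + 2 * s := by decide
      exact this j k s hs h1 h2
    rw [Nat.cast_succ]
    rcases hcases with rfl | rfl | rfl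
    · have h1 := step s hs (by rwa [sub_add_cancel])
      rw [sub_add_cancel] at h1
      have h2 := bisectorDist_add_le_dist_of_adjacent (j := j - s) (by
        rcases hs with rfl | rfl
        · exact Or.inr (by ring)
        · exact Or.inl (by ring)) hjA hA hkB hBr
      linarith
    · obtain ⟨h1, h2, -⟩ := bisectorDist_add_le_dist_of_nonadjacent hs' hjA hA hkB hBr
      have hsum : 0 < P.height (j + 2 * -s + s) (g.1 P.center) +
          P.height (j + 2 * -s + -s) (g.1 P.center) := by
        apply height_add_height_pos_of_nonadjacent
        rcases hs with rfl | rfl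
        · exact Or.inr (by ring)
        · exact Or.inl (by ring)
      rw [← sub_eq_add_neg] at h1 h2
      rcases lt_or_ge 0 (P.height (j + 2 * -s + s) (g.1 P.center)) with hpos | hneg
      · have h3 := step s hs hpos
        rw [show j + 2 * -s + s = j - s by ring] at h3
        linarith
      · have h3 := step (-s) hs' (by linarith)
        rw [show j + 2 * -s + -s = j + 3 * -s by ring] at h3
        linarith
    · obtain ⟨-, -, h1⟩ := bisectorDist_add_le_dist_of_nonadjacent hs hjA hA hkB hBr
      have h3 := step (-s) hs' (by rwa [show j + 2 * s + -s = j + s by ring])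
      rw [show j + 2 * s + -s = j + s by ring] at h3
      linarith

lemma cConst_mul_length_le_dist_center (g : P.group) :
    cConst * length g - (bisectorDist (φ + 1) + outerRadius) ≤ dist P.center (g.1 P.center) := by
  obtain ⟨j, hj⟩ : ∃ j, 0 < P.height j (g.1 P.center) := by
    by_contra hcon
    push Not at hcon
    linarith [hcon 0, hcon (0 + 2), P.height_add_height_pos 0 (g.1 P.center)]
  obtain ⟨s, hs, hjs⟩ : ∃ s : ZMod 5, (s = 1 ∨ s = -1) ∧ 0 < P.height (j + s) (g.1 P.center) := by
    by_contra hcon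
    push Not at hcon
    have h := P.height_add_height_pos (j + -1) (g.1 P.center)
    rw [show j + -1 + 2 = j + 1 by ring] at h
    linarith [hcon 1 (Or.inl rfl), hcon (-1) (Or.inr rfl)]
  have hM := P.midpoint_mem_region j
  have h1 := cConst_mul_length_le_dist _ g rfl j s hs _ hM (P.height_midpoint j) hj hjs
  have h2 := bisectorDist_nonneg ((P.mem_region_iff _).1 hM (j - s))
  have h3 := dist_triangle (P.midpoint j) P.center (g.1 P.center)
  have h4 := dist_center_le hM
  rw [dist_comm] at h4
  linarith

/-! ### Sharpness of the constants -/

/-- The product `r_{a (n - 1)} ⋯ r_a r_0` of reflections in sides whose indices are in arithmetic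
progression. -/
noncomputable def spiral (P : Pentagon) (a : ZMod 5) : ℕ → P.group
  | 0 => 1
  | n + 1 => P.gen (a * n) * spiral P a n

lemma spiral_succ (a : ZMod 5) (n : ℕ) : P.spiral a (n + 1) = P.gen (a * n) * P.spiral a n := rfl

lemma length_spiral_le (a : ZMod 5) (n : ℕ) : length (P.spiral a n) ≤ n := by
  induction n with
  | zero => exact length_one.le
  | succ n ih => exact (length_gen_mul_le _ _).trans (Nat.succ_le_succ ih)

lemma spiral_one_pos (n : ℕ) : 0 < P.height (1 * n) ((P.spiral 1 n).1 P.center) ∧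
    0 < P.height (1 * n + 1) ((P.spiral 1 n).1 P.center) := by
  induction n with
  | zero => exact ⟨P.height_center_pos _, P.height_center_pos _⟩
  | succ n ih =>
    have hp := one_lt_phi
    rw [spiral_succ, gen_mul_apply, Nat.cast_succ,
      show (1 : ZMod 5) * (n + 1) = 1 * n + 1 by ring, height_refl_of_adjacent P (Or.inl rfl),
      height_refl_of_nonadjacent P (Or.inl (by ring))]
    refine ⟨ih.2, ?_⟩
    have h := P.height_add_height_pos (1 * n) ((P.spiral 1 n).1 P.center)
    rw [show (1 : ZMod 5) * n + 2 = 1 * n + 1 + 1 by ring] at h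
    nlinarith [ih.1]

lemma length_spiral_one (n : ℕ) : length (P.spiral 1 n) = n := by
  induction n with
  | zero => exact length_one
  | succ n ih => rw [spiral_succ, length_gen_mul_of_pos (spiral_one_pos n).1, ih]

/-- The images of the pentagon along a path through the midpoints of adjacent sides. -/
lemma dist_center_spiral_one_le (n : ℕ) :
    dist P.center ((P.spiral 1 n).1 P.center) ≤ cConst * n + 2 * outerRadius := by
  have h : dist (P.midpoint (1 * n)) ((P.spiral 1 n).1 P.center) ≤ cConst * n + outerRadius := by
    induction n with
    | zero =>
      rw [dist_comm, Nat.cast_zero (R := ℝ), mul_zero, zero_add]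
      exact dist_center_le (P.midpoint_mem_region _)
    | succ n ih =>
      have h1 := dist_triangle (P.midpoint (1 * ↑(n + 1))) (P.midpoint (1 * n))
        ((P.spiral 1 (n + 1)).1 P.center)
      rw [spiral_succ, gen_mul_apply, dist_refl_of_height_eq_zero (P.height_midpoint _),
        Nat.cast_succ (R := ZMod 5), show (1 : ZMod 5) * (n + 1) = 1 * n + 1 by ring,
        dist_comm (P.midpoint (1 * n + 1)) (P.midpoint (1 * n)), dist_midpoint_succ] at h1
      rw [spiral_succ, gen_mul_apply, Nat.cast_succ (R := ℝ), Nat.cast_succ (R := ZMod 5),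
        show (1 : ZMod 5) * (n + 1) = 1 * n + 1 by ring]
      linarith
  have h1 := dist_triangle P.center (P.midpoint (1 * n)) ((P.spiral 1 n).1 P.center)
  have h2 := dist_center_le (P.midpoint_mem_region (1 * n))
  linarith

/-- The midpoints of the sides `i - 2` and `i` and the reflection in the side `i` of the midpoint of
the side `i + 2` lie on a geodesic, at consecutive distances `dConst`, and `φ + 2 = 2 cosh dConst`;
along a geodesic this is `cosh (t + d) = 2 cosh d cosh t - cosh (t - d)`. -/
lemma cosh_dist_midpoint_refl (i : ZMod 5) (z : UpperHalfPlane) :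
    Real.cosh (dist (P.midpoint (i + 2)) (P.refl i z)) =
      (φ + 2) * Real.cosh (dist (P.midpoint i) z) - Real.cosh (dist (P.midpoint (i - 2)) z) := by
  have hV := P.isFrame_frame
  have e2 : i - 2 = i + 3 := by rw [sub_eq_add_neg, show (-2 : ZMod 5) = 3 by decide]
  have e3 : i + 3 + 1 = i + 4 := by ring
  have e4 : i + 2 + 1 = i + 3 := by ring
  have h := congrArg (fun v => lorentz v (vec z)) (hV.midpoint_add i)
  have hn := P.height_eq i z
  rw [lorentz_comm] at hn
  simp only [map_add, map_sub, map_smul, LinearMap.add_apply, LinearMap.sub_apply,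
    LinearMap.smul_apply, smul_eq_mul, ← hn] at h
  rw [dist_comm, cosh_dist_refl, dist_comm z, P.height_eq i (P.midpoint _), cosh_dist_eq,
    cosh_dist_eq, cosh_dist_eq, vec_midpoint, vec_midpoint, vec_midpoint, e2, e3, e4]
  simp only [map_smul, map_add, LinearMap.smul_apply, LinearMap.add_apply, smul_eq_mul]
  have h2 : lorentz (P.frame (i + 2)) (normal P.frame i) = φ + 1 := by
    rw [hV.lorentz_normal, if_neg, if_neg]
    · rw [add_right_inj]; decide
    · rw [add_eq_left, add_right_inj]; decide
  rw [h2, hV.normal_three]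
  linear_combination (-(1 / √(2 * φ + 2))) * h +
    (12 * (1 / √(2 * φ + 2)) * P.height i z) * phi_sq

/-- With step `2` the midpoints of the sides that are crossed lie on a geodesic. -/
lemma dist_midpoint_spiral_two (n : ℕ) :
    dist (P.midpoint (2 * n)) ((P.spiral 2 n).1 (P.midpoint (-2))) = (n + 1) * dConst ∧
    dist (P.midpoint (2 * n - 2)) ((P.spiral 2 n).1 (P.midpoint (-2))) = n * dConst := by
  induction n with
  | zero =>
    have h := P.dist_midpoint_add_two (-2)
    rw [neg_add_cancel] at h
    have e : (P.spiral 2 0).1 (P.midpoint (-2)) = P.midpoint (-2) := rfl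
    simp [e, dist_comm (P.midpoint 0), h]
  | succ n ih =>
    have hd := dConst_pos
    have e : (2 : ZMod 5) * (n + 1) - 2 = 2 * n := by ring
    rw [spiral_succ, gen_mul_apply, Nat.cast_succ (R := ZMod 5), Nat.cast_succ (R := ℝ), e,
      dist_refl_of_height_eq_zero (P.height_midpoint _)]
    refine ⟨?_, ih.1⟩
    have h := P.cosh_dist_midpoint_refl (2 * n) ((P.spiral 2 n).1 (P.midpoint (-2)))
    rw [ih.1, ih.2, show φ + 2 = 2 * Real.cosh dConst by rw [cosh_dConst]; ring] at h
    rw [show (2 : ZMod 5) * (n + 1) = 2 * n + 2 by ring]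
    have h' : Real.cosh (dist (P.midpoint (2 * n + 2))
        (P.refl (2 * n) ((P.spiral 2 n).1 (P.midpoint (-2))))) =
        Real.cosh (((n : ℝ) + 1 + 1) * dConst) := by
      rw [h, show ((n : ℝ) + 1 + 1) * dConst = (n + 1) * dConst + dConst by ring,
        show (n : ℝ) * dConst = (n + 1) * dConst - dConst by ring, Real.cosh_add, Real.cosh_sub]
      ring
    rw [← Real.arcosh_cosh (x := dist _ _) dist_nonneg, h', Real.arcosh_cosh (by positivity)]

/-- The images of the pentagon along a geodesic through the midpoints of non-adjacent sides. -/
lemma dConst_mul_le_dist_center_spiral_two (n : ℕ) :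
    dConst * n - 2 * outerRadius ≤ dist P.center ((P.spiral 2 n).1 P.center) := by
  have h := (P.dist_midpoint_spiral_two n).1
  have h1 := dist_triangle4 (P.midpoint (2 * n)) P.center ((P.spiral 2 n).1 P.center)
    ((P.spiral 2 n).1 (P.midpoint (-2)))
  rw [(P.spiral 2 n).1.dist_eq, dist_comm (P.midpoint (2 * n)) P.center, h] at h1
  have h2 := dist_center_le (P.midpoint_mem_region (2 * n))
  have h3 := dist_center_le (P.midpoint_mem_region (-2))
  have := dConst_pos
  linarith

end Pentagon

/-! ### The numerical value of `d / c` -/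

/-- Bounds for `cosh x` from bounds for the Taylor polynomial of degree nine of `exp x`. -/
lemma cosh_bounds {x : ℝ} (h0 : 0 ≤ x) (h1 : x ≤ 1) {l u : ℝ} (hl0 : 0 < l)
    (hl : l ≤ ∑ m ∈ Finset.range 10, x ^ m / m.factorial)
    (hu : ∑ m ∈ Finset.range 10, x ^ m / m.factorial +
      x ^ 10 * (10 + 1) / (Nat.factorial 10 * 10) ≤ u) :
    (l + u⁻¹) / 2 ≤ Real.cosh x ∧ Real.cosh x ≤ (u + l⁻¹) / 2 := by
  have hl' : l ≤ Real.exp x := hl.trans (Real.sum_le_exp_of_nonneg h0 10)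
  have hu' : Real.exp x ≤ u := by
    refine le_trans ?_ hu
    exact_mod_cast Real.exp_bound' h0 h1 (n := 10) (by norm_num)
  have e := Real.exp_pos x
  have h2 : u⁻¹ ≤ (Real.exp x)⁻¹ := inv_anti₀ e hu'
  have h3 : (Real.exp x)⁻¹ ≤ l⁻¹ := inv_anti₀ hl0 hl'
  rw [Real.cosh_eq, Real.exp_neg]
  constructor <;> linarith

lemma phi_bounds : 1.6180339 < φ ∧ φ < 1.618034 := by
  have h := phi_sq
  have := phi_pos
  constructor <;> nlinarith

lemma lt_of_cosh_lt {x y : ℝ} (hy : 0 ≤ y) (h : Real.cosh x < Real.cosh y) : x < y := by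
  rw [Real.cosh_lt_cosh, abs_of_nonneg hy] at h
  exact (le_abs_self x).trans_lt h

lemma cConst_bounds : 0.76719 < cConst ∧ cConst < 0.7672 := by
  obtain ⟨h1, h2⟩ := phi_bounds
  constructor
  · apply lt_of_cosh_lt cConst_pos.le
    rw [cosh_cConst]
    refine (cosh_bounds (l := 2.1537058) (u := 2.1537059) ?_ ?_ ?_ ?_ ?_).2.trans_lt ?_
    all_goals norm_num [Finset.sum_range_succ, Nat.factorial]
    all_goals linarith
  · apply lt_of_cosh_lt (by norm_num)
    rw [cosh_cConst]
    refine lt_of_lt_of_le ?_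
      (cosh_bounds (l := 2.1537273) (u := 2.1537274) ?_ ?_ ?_ ?_ ?_).1
    all_goals norm_num [Finset.sum_range_succ, Nat.factorial]
    all_goals linarith

lemma cosh_dConst_half : Real.cosh (dConst / 2) ^ 2 = (φ + 4) / 4 := by
  have h := Real.cosh_two_mul (dConst / 2)
  rw [mul_div_cancel₀ _ two_ne_zero, cosh_dConst] at h
  linarith [Real.cosh_sq (dConst / 2)]

lemma dConst_bounds : 1.19891 < dConst ∧ dConst < 1.19892 := by
  obtain ⟨h1, h2⟩ := phi_bounds
  have hd := dConst_pos
  have h := cosh_dConst_half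
  have hc := Real.cosh_pos (dConst / 2)
  constructor
  · suffices (0.599455 : ℝ) < dConst / 2 by linarith
    apply lt_of_cosh_lt (by positivity)
    refine (cosh_bounds (l := 1.8211259) (u := 1.8211262) ?_ ?_ ?_ ?_ ?_).2.trans_lt ?_
    all_goals norm_num [Finset.sum_range_succ, Nat.factorial]
    all_goals nlinarith
  · suffices dConst / 2 < (0.59946 : ℝ) by linarith
    apply lt_of_cosh_lt (by norm_num)
    refine lt_of_lt_of_le ?_
      (cosh_bounds (l := 1.8211350) (u := 1.8211353) ?_ ?_ ?_ ?_ ?_).1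
    all_goals norm_num [Finset.sum_range_succ, Nat.factorial]
    all_goals nlinarith

lemma abs_dConst_div_cConst_sub_lt : |dConst / cConst - 1.5627| < 0.00005 := by
  obtain ⟨h1, h2⟩ := cConst_bounds
  obtain ⟨h3, h4⟩ := dConst_bounds
  have hc := cConst_pos
  rw [abs_sub_lt_iff]
  constructor
  · have : dConst / cConst < 1.56275 := by
      rw [div_lt_iff₀ hc]
      linarith
    linarith
  · have : 1.56265 < dConst / cConst := by
      rw [lt_div_iff₀ hc]
      linarith
    linarith

/-! ### Comparison of the two metrics -/

namespace IsTiling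

open Pentagon

variable {T : Set Pentagon} {P : Pentagon}

lemma length_le_of_walk (hT : IsTiling T) (hP : P ∈ T) {x y : T}
    (p : (dualComplex T).graph.Walk x y) : ∀ g h : P.group, x = hT.tile hP g → y = hT.tile hP h →
    length (g⁻¹ * h) ≤ p.length := by
  induction p with
  | nil =>
    rintro g h rfl e
    rw [hT.tile_injective hP e, inv_mul_cancel, length_one]
    exact Nat.zero_le _
  | @cons x y z hadj p ih =>
    rintro g h rfl rfl
    obtain ⟨k, rfl⟩ := hT.tile_surjective hP y
    obtain ⟨i, rfl⟩ := (hT.adj_tile_iff hP g k).1 hadj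
    have h1 := ih _ h rfl rfl
    have h2 := length_gen_mul_le i ((g * P.gen i)⁻¹ * h)
    rw [mul_inv_rev, gen_inv, mul_assoc, gen_mul_gen_mul] at h2
    rw [mul_inv_rev, gen_inv, mul_assoc] at h1
    rw [SimpleGraph.Walk.length_cons]
    omega

/-- The combinatorial metric is the word metric of the reflection group. -/
lemma combDist_tile (hT : IsTiling T) (hP : P ∈ T) (g h : P.group) :
    (dualComplex T).combDist (hT.tile hP g) (hT.tile hP h) = length (g⁻¹ * h) := by
  rw [SquareComplex.combDist, Nat.cast_inj]
  apply le_antisymm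
  · obtain ⟨w, hw, e⟩ := exists_reduced_word (g⁻¹ * h)
    obtain ⟨p, hp⟩ := hT.exists_walk_of_word hP g w
    have hdist := SimpleGraph.dist_le p
    rwa [hp, hw, e, mul_inv_cancel_left] at hdist
  · obtain ⟨p, hp⟩ := hT.connected.exists_walk_length_eq_dist (hT.tile hP g) (hT.tile hP h)
    rw [← hp]
    exact hT.length_le_of_walk hP p g h rfl rfl

lemma dist_idMap_tile (hT : IsTiling T) (hP : P ∈ T) (g h : P.group) :
    dist (idMap T (hT.tile hP g)) (idMap T (hT.tile hP h)) =
      dist P.center ((g⁻¹ * h).1 P.center) := by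
  rw [idMap, idMap, center_tile, center_tile, ← g.1.dist_eq P.center]
  congr 1
  change h.1 P.center = (g * (g⁻¹ * h)).1 P.center
  rw [mul_inv_cancel_left]

lemma exists_pentagon_mem (hT : IsTiling T) : ∃ P, P ∈ T :=
  (hT.covers UpperHalfPlane.I).imp fun _ h => h.1

/-- The additive constant in the comparison of the two metrics. -/
noncomputable def additiveConst : ℝ := bisectorDist (φ + 1) + 2 * outerRadius

lemma additiveConst_pos : 0 < additiveConst := by
  have := bisectorDist_nonneg (by linarith [phi_pos] : 0 ≤ φ + 1)
  have := outerRadius_pos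
  rw [additiveConst]
  linarith

lemma dist_idMap_bounds (hT : IsTiling T) (x y : T) :
    cConst * (dualComplex T).combDist x y - additiveConst ≤ dist (idMap T x) (idMap T y) ∧
    dist (idMap T x) (idMap T y) ≤ dConst * (dualComplex T).combDist x y + additiveConst := by
  obtain ⟨P, hP⟩ := hT.exists_pentagon_mem
  obtain ⟨g, rfl⟩ := hT.tile_surjective hP x
  obtain ⟨h, rfl⟩ := hT.tile_surjective hP y
  have := bisectorDist_nonneg (by linarith [phi_pos] : 0 ≤ φ + 1)
  have := outerRadius_pos
  have h1 := cConst_mul_length_le_dist_center (g⁻¹ * h)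
  have h2 := dist_center_apply_le (g⁻¹ * h)
  rw [combDist_tile, dist_idMap_tile, additiveConst]
  constructor <;> linarith

/-- A linear function of slope `a` that is bounded above on the natural numbers has `a ≤ 0`. -/
lemma nonpos_of_mul_natCast_le {a b : ℝ} (h : ∀ n : ℕ, a * n ≤ b) : a ≤ 0 := by
  by_contra hneg
  obtain ⟨n, hn⟩ := exists_nat_gt (b / a)
  rw [div_lt_iff₀ (not_le.1 hneg)] at hn
  linarith [h n]

lemma le_cConst (hT : IsTiling T) {c' ε : ℝ} (h : ∀ x y : T,
    c' * (dualComplex T).combDist x y - ε ≤ dist (idMap T x) (idMap T y)) : c' ≤ cConst := by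
  obtain ⟨P, hP⟩ := hT.exists_pentagon_mem
  rw [← sub_nonpos]
  apply nonpos_of_mul_natCast_le (b := 2 * outerRadius + ε)
  intro n
  have h1 := h (hT.tile hP 1) (hT.tile hP (P.spiral 1 n))
  have h2 := dist_center_spiral_one_le (P := P) n
  rw [combDist_tile, dist_idMap_tile, inv_one, one_mul, length_spiral_one] at h1
  linarith

/-- The elements `spiral 2 n` are only known to have length at most `n`, which suffices once
`0 ≤ d'`. -/
lemma dConst_le (hT : IsTiling T) {d' ε : ℝ} (h : ∀ x y : T,
    dist (idMap T x) (idMap T y) ≤ d' * (dualComplex T).combDist x y + ε) : dConst ≤ d' := by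
  obtain ⟨P, hP⟩ := hT.exists_pentagon_mem
  have hd : 0 ≤ d' := by
    rw [← neg_nonpos]
    apply nonpos_of_mul_natCast_le (b := ε)
    intro n
    have h1 := dist_nonneg.trans (h (hT.tile hP 1) (hT.tile hP (P.spiral 1 n)))
    rw [combDist_tile, inv_one, one_mul, length_spiral_one] at h1
    linarith
  rw [← sub_nonpos]
  apply nonpos_of_mul_natCast_le (b := 2 * outerRadius + ε)
  intro n
  have h1 := h (hT.tile hP 1) (hT.tile hP (P.spiral 2 n))
  have h2 := dConst_mul_le_dist_center_spiral_two (P := P) n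
  rw [combDist_tile, dist_idMap_tile, inv_one, one_mul] at h1
  have h3 : d' * length (P.spiral 2 n) ≤ d' * n := by
    gcongr
    exact length_spiral_le 2 n
  linarith

lemma isQuasiisometry (hT : IsTiling T) :
    (dualComplex T).IsQuasiisometry (idMap T) (dConst / cConst) := by
  refine ⟨1 / cConst, dConst, additiveConst, one_div_pos.2 cConst_pos, dConst_pos,
    additiveConst_pos, by ring, fun x y => ?_⟩
  rw [one_div_one_div]
  exact hT.dist_idMap_bounds x y

lemma div_le_of_isQuasiisometry (hT : IsTiling T) {lam : ℝ}
    (h : (dualComplex T).IsQuasiisometry (idMap T) lam) : dConst / cConst ≤ lam := by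
  obtain ⟨lam₁, lam₂, ε, h1, h2, -, rfl, h⟩ := h
  have hc := hT.le_cConst fun x y => (h x y).1
  have hd := hT.dConst_le fun x y => (h x y).2
  rw [div_le_iff₀ h1] at hc
  rw [div_le_iff₀ cConst_pos]
  have := mul_le_mul_of_nonneg_left hc h2.le
  linarith

end IsTiling

end PentagonTiling

theorem proposition6p1 :
    -- there is a tiling by regular right-angled pentagons
    (∃ T : Set PentagonTiling.Pentagon, PentagonTiling.IsTiling T) ∧
    -- the numerical value of the constant
    |PentagonTiling.dConst / PentagonTiling.cConst - 1.5627| < 0.00005 ∧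
    ∀ T : Set PentagonTiling.Pentagon, PentagonTiling.IsTiling T →
      -- the dual complex is a CAT(0) square complex with five squares at every vertex
      (PentagonTiling.dualComplex T).IsCAT0 ∧
      (∀ v : T, ((PentagonTiling.dualComplex T).graph.neighborSet v).ncard = 5 ∧
        ((PentagonTiling.dualComplex T).squaresAt v).ncard = 5) ∧
      -- comparison of the two metrics
      (∃ ε : ℝ, 0 < ε ∧ ∀ x y : T,
        PentagonTiling.cConst * (PentagonTiling.dualComplex T).combDist x y - ε
            ≤ dist (PentagonTiling.idMap T x) (PentagonTiling.idMap T y) ∧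
        dist (PentagonTiling.idMap T x) (PentagonTiling.idMap T y)
            ≤ PentagonTiling.dConst * (PentagonTiling.dualComplex T).combDist x y + ε) ∧
      -- both multiplicative constants are sharp
      (∀ c' ε : ℝ, (∀ x y : T, c' * (PentagonTiling.dualComplex T).combDist x y - ε
          ≤ dist (PentagonTiling.idMap T x) (PentagonTiling.idMap T y)) →
        c' ≤ PentagonTiling.cConst) ∧
      (∀ d' ε : ℝ, (∀ x y : T, dist (PentagonTiling.idMap T x) (PentagonTiling.idMap T y)
          ≤ d' * (PentagonTiling.dualComplex T).combDist x y + ε) →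
        PentagonTiling.dConst ≤ d') ∧
      -- the identity is a quasiisometry with constant `d / c`, and this is optimal
      (PentagonTiling.dualComplex T).IsQuasiisometry (PentagonTiling.idMap T)
        (PentagonTiling.dConst / PentagonTiling.cConst) ∧
      (∀ lam : ℝ, (PentagonTiling.dualComplex T).IsQuasiisometry (PentagonTiling.idMap T) lam →
        PentagonTiling.dConst / PentagonTiling.cConst ≤ lam) := by
  refine ⟨?_, PentagonTiling.abs_dConst_div_cConst_sub_lt, fun T hT => ⟨hT.isCAT0,
    fun v => ⟨hT.ncard_neighborSet v, hT.ncard_squaresAt v⟩,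
    ⟨_, PentagonTiling.IsTiling.additiveConst_pos, hT.dist_idMap_bounds⟩,
    fun _ _ => hT.le_cConst, fun _ _ => hT.dConst_le, hT.isQuasiisometry,
    fun _ => hT.div_le_of_isQuasiisometry⟩⟩
  obtain ⟨P⟩ := PentagonTiling.exists_pentagon
  exact ⟨_, P.isTiling_range⟩
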